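/- **Conventions.** Equip $\mathbb C^3$ with $\langle z,w\rangle=z_1\overline{w_1}+z_2\overline{w_2}-z_3\overline{w_3}$; let $\mathrm U(2,1)\subset \mathrm{GL}_3(\mathbb C)$ be its isometry group and $\mathrm{PU}(2,1)$ the quotient of $\mathrm U(2,1)$ by its center. A vector $z$ is negative if $\langle z,z\rangle<0$; negative lines are the points of $\mathbb H^2_{\mathbb C}$. An element of $\mathrm{PU}(2,1)$ has angle pair $(\alpha_1,\alpha_2)$ if it is conjugate to the class of $\mathrm{diag}(e^{i\alpha_1},e^{i\alpha_2},1)$; it is regular elliptic if $0<\alpha_2<\alpha_1<2\pi$. The complex reflection with rotation factor $\eta$ ($|\eta|=1$, $\eta\ne1$) in the complex line (its mirror) with polar vector $c$, $\langle c,c\rangle=1$, is induced by $z\mapsto z+(\eta-1)\langle z,c\rangle c$. Let $\Gamma^{(2)}_{4,5,20}=\langle a,b,c\mid a^4=b^5=c^{20}=abc=1\rangle$. For $\rho:\Gamma^{(2)}_{4,5,20}\to\mathrm{PU}(2,1)$ put $A=\rho(a)$, $B=\rho(b)$, $C=\rho(c)$, and suppose these are regular elliptic. Then $\rho$ is irreducible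 if no two of $A,B,C$ have a common eigenspace (in lifts to $\mathrm U(2,1)$), reducible otherwise, and spherical reducible if $A,B$ have a common negative eigenvector. It is spherical decomposable if there are complex reflections $R_1,R_2,R_3$ whose mirrors are pairwise distinct and pairwise intersect in $\mathbb H^2_{\mathbb C}$, with $A=R_1R_2^{-1}$, $B=R_2R_3^{-1}$, $C=R_3R_1^{-1}$. If $c_1,c_2,c_3$ are normalized polar vectors of the mirrors (indices mod 3), the complex angles $\phi_k\in[0,\pi/2]$ are given by $\cos\phi_k=|\langle c_{k-1},c_{k+1}\rangle|$, and the angular invariant is $\alpha=\arg\prod_k\langle c_{k-1},c_{k+1}\rangle$. The relative component $\mathcal X$ is the set of $\mathrm{PU}(2,1)$-conjugacy classes of representations $\rho$ of $\Gamma^{(2)}_{4,5,20}$ for which $\rho(a),\rho(b),\rho(c)$ have angle pairs $(3\pi/2,\pi)$, $(6\pi/5,2\pi/5)$, $(8\pi/5,3\pi/10)$ respectively. It carries the topology induced from the quotient of the topology of pointwise convergence. For $\theta\in\,]\pi,3\pi/2[$ let $r_k=r_k(\theta)=\cos\phi_k$ with $\phi_k=\phi_k(\theta)\in[0,\pi/2]$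 and $$\sin^2\phi_1=\frac{\cos\frac{2\pi}5+\cos\frac{\pi}5}{\cos\frac{\pi}5+\cos(\theta-\frac{13\pi}{10})},\quad \sin^2\phi_2=\frac{\cos\frac{13\pi}{20}+\cos\frac{\pi}{20}}{\cos\frac{\pi}{20}+\cos(\theta-\frac{21\pi}{20})},\quad \sin^2\phi_3=\frac{2\cos\frac{\pi}4}{\cos\frac{\pi}4-\cos(\theta-\frac{\pi}4)},$$ and let $$D=\Big\{(\theta,\alpha)\ :\ \theta\in\,]\pi,\tfrac{3\pi}2[,\ \alpha\in[0,2\pi[,\ \cos\alpha<\frac{r_1^2+r_2^2+r_3^2-1}{2r_1r_2r_3}\Big\}.$$ **Proposition 6.8.** The relative component $\mathcal X$ consists of exactly one class of reducible representations, which is spherical reducible, and of classes of irreducible representations, all of which are spherical decomposable. The set $D$ is non-empty, and there is a homeomorphism $\Phi$ from $D$ onto the set of irreducible classes in $\mathcal X$ such that every representation in the class $\Phi(\theta,\alpha)$ has a spherical decomposition, and each of its spherical decompositions has rotation factors $e^{i\theta},e^{i(\theta-\pi/2)},e^{i(\theta-21\pi/10)}$ (for $R_1,R_2,R_3$), complex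 angles $\phi_1(\theta),\phi_2(\theta),\phi_3(\theta)$ and angular invariant $\alpha$ modulo $2\pi$. Moreover the points of $\mathcal X$ are determined by their characters: if two representations with these angle pairs have lifts $\langle a,b\rangle_{\text{free}}\to\mathrm{SU}(2,1)$ with the same trace function, they are conjugate in $\mathrm{PU}(2,1)$. -/

import Mathlib

noncomputable section

namespace CHyp

/-! ### The Hermitian form of signature (2,1) and the groups U(2,1), PU(2,1) -/

/-- The Hermitian form `⟨z, w⟩ = z₁ w̄₁ + z₂ w̄₂ - z₃ w̄₃` on `ℂ³`. -/
def herm (z w : Fin 3 → ℂ) : ℂ :=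
  z 0 * (starRingEnd ℂ) (w 0) + z 1 * (starRingEnd ℂ) (w 1) - z 2 * (starRingEnd ℂ) (w 2)

/-- `z` is of negative type: `⟨z, z⟩ < 0`. Its projective class is a point of the complex
hyperbolic plane. -/
def IsNegative (z : Fin 3 → ℂ) : Prop := (herm z z).re < 0

/-- `U(2,1)`: the subgroup of `GL₃(ℂ)` that preserves the Hermitian form. -/
def U21 : Subgroup (GL (Fin 3) ℂ) where
  carrier := {g | ∀ z w : Fin 3 → ℂ,
    herm (Matrix.mulVec (g : Matrix (Fin 3) (Fin 3) ℂ) z)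
      (Matrix.mulVec (g : Matrix (Fin 3) (Fin 3) ℂ) w) = herm z w}
  mul_mem' := by
    intro a b ha hb z w
    simp only [Set.mem_ofPred_eq] at ha hb
    simp only [Units.val_mul, ← Matrix.mulVec_mulVec]
    rw [ha, hb]
  one_mem' := by
    intro z w
    simp
  inv_mem' := by
    intro a ha z w
    simp only [Set.mem_ofPred_eq] at ha
    rw [← ha]
    simp only [Matrix.mulVec_mulVec, ← Units.val_mul, mul_inv_cancel, Units.val_one,
      Matrix.one_mulVec]

/-- The matrix underlying an element of `U(2,1)`. -/
def mat (g : U21) : Matrix (Fin 3) (Fin 3) ℂ := ((g : GL (Fin 3) ℂ) : Matrix (Fin 3) (Fin 3) ℂ)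

/-- `PU(2,1)`: the quotient of `U(2,1)` by its center, with the quotient topology. -/
abbrev PU21 : Type := U21 ⧸ Subgroup.center U21

/-- The projection `U(2,1) → PU(2,1)`. -/
def toPU : U21 →* PU21 := QuotientGroup.mk' (Subgroup.center U21)

/-! ### Elliptic elements, angle pairs -/

/-- `E(α₁, α₂) = diag(e^{iα₁}, e^{iα₂}, 1)`, an element of `U(2,1)`. -/
def ellipticE (α : ℝ × ℝ) : U21 :=
  ⟨⟨Matrix.diagonal ![Complex.exp (α.1 * Complex.I), Complex.exp (α.2 * Complex.I), 1],
    Matrix.diagonal ![Complex.exp (-(α.1 * Complex.I)), Complex.exp (-(α.2 * Complex.I)), 1],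
    by
      rw [Matrix.diagonal_mul_diagonal, ← Matrix.diagonal_one]
      congr 1
      funext i
      fin_cases i <;> simp [← Complex.exp_add],
    by
      rw [Matrix.diagonal_mul_diagonal, ← Matrix.diagonal_one]
      congr 1
      funext i
      fin_cases i <;> simp [← Complex.exp_add]⟩, by
    have key : ∀ t : ℝ, Complex.exp (t * Complex.I) *
        (starRingEnd ℂ) (Complex.exp (t * Complex.I)) = 1 := by
      intro t
      rw [Complex.mul_conj, Complex.normSq_eq_norm_sq, Complex.norm_exp_ofReal_mul_I]
      simp
    intro z w
    simp only [herm, Matrix.mulVec_diagonal, Matrix.cons_val_zero, Matrix.cons_val_one,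
      Matrix.cons_val, map_mul, one_mul]
    linear_combination (z 0 * (starRingEnd ℂ) (w 0)) * key α.1 +
      (z 1 * (starRingEnd ℂ) (w 1)) * key α.2⟩

/-- `g ∈ PU(2,1)` is elliptic in the conjugacy class with angle pair `α = (α₁, α₂)`. -/
def HasAnglePair (g : PU21) (α : ℝ × ℝ) : Prop := IsConj (toPU (ellipticE α)) g

/-- Regular elliptic elements: the angle pair satisfies `0 < α₂ < α₁ < 2π`. -/
def IsRegularElliptic (g : PU21) : Prop :=
  ∃ α : ℝ × ℝ, 0 < α.2 ∧ α.2 < α.1 ∧ α.1 < 2 * Real.pi ∧ HasAnglePair g α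

/-- `z` spans a line of `ℂ³` fixed by `g ∈ PU(2,1)`, i.e. `z` is an eigenvector of a lift. -/
def FixesLine (g : PU21) (z : Fin 3 → ℂ) : Prop :=
  z ≠ 0 ∧ ∃ M : U21, toPU M = g ∧ ∃ l : ℂ, Matrix.mulVec (mat M) z = l • z

/-! ### Irreducibility of triples and pairs -/

/-- `(A, B, C)` is irreducible: the eigenspaces of `A`, `B`, `C` are pairwise distinct. (For
regular elliptic elements all eigenspaces are lines.) -/
def IsIrreducibleTriple (A B C : PU21) : Prop :=
  (¬ ∃ z, FixesLine A z ∧ FixesLine B z) ∧ (¬ ∃ z, FixesLine B z ∧ FixesLine C z) ∧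
    (¬ ∃ z, FixesLine A z ∧ FixesLine C z)

/-- `(A, B)` is spherical reducible: `A` and `B` have a common eigenvector of negative type. -/
def IsSphericalReduciblePair (A B : PU21) : Prop :=
  ∃ z, IsNegative z ∧ FixesLine A z ∧ FixesLine B z

/-! ### Complex reflections and decomposable triples -/

/-- `R` is the complex reflection with rotation factor `η` in the complex line with polar vector
`c`, where `⟨c, c⟩ = 1`: it is induced by `z ↦ z + (η - 1) ⟨z, c⟩ c`. -/
def IsComplexReflection (R : PU21) (c : Fin 3 → ℂ) (η : ℂ) : Prop :=
  herm c c = 1 ∧ ‖η‖ = 1 ∧ η ≠ 1 ∧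
    ∃ M : U21, toPU M = R ∧ ∀ z, Matrix.mulVec (mat M) z = z + ((η - 1) * herm z c) • c

/-- The complex lines polar to `c` and `d` are distinct and meet in a point of the complex
hyperbolic plane. -/
def LinesIntersect (c d : Fin 3 → ℂ) : Prop :=
  LinearIndependent ℂ ![c, d] ∧ ∃ p, IsNegative p ∧ herm p c = 0 ∧ herm p d = 0

/-- `A = R₁R₂⁻¹`, `B = R₂R₃⁻¹`, `C = R₃R₁⁻¹`, where `R_k` is the complex reflection with rotation
factor `η k` in the complex line with normalized polar vector `c k`, and the three mirrors
intersect pairwise in the complex hyperbolic plane. -/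
def IsSphericalDecomposition (A B C : PU21) (c : Fin 3 → Fin 3 → ℂ) (η : Fin 3 → ℂ) : Prop :=
  (∀ j k, j ≠ k → LinesIntersect (c j) (c k)) ∧
    ∃ R : Fin 3 → PU21, (∀ k, IsComplexReflection (R k) (c k) (η k)) ∧
      A = R 0 * (R 1)⁻¹ ∧ B = R 1 * (R 2)⁻¹ ∧ C = R 2 * (R 0)⁻¹

/-- Spherical decomposable triples of regular elliptic elements with `ABC = 1`. -/
def IsSphericalDecomposable (A B C : PU21) : Prop :=
  IsRegularElliptic A ∧ IsRegularElliptic B ∧ IsRegularElliptic C ∧ A * B * C = 1 ∧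
    ∃ c η, IsSphericalDecomposition A B C c η

/-- `α` is an angular invariant of the triangle of complex lines with normalized polar vectors
`c 0, c 1, c 2`: an argument of `∏ₖ ⟨c_{k-1}, c_{k+1}⟩` (indices modulo 3), which is nonzero. -/
def HasAngularInvariant (c : Fin 3 → Fin 3 → ℂ) (α : ℝ) : Prop :=
  (∏ k : Fin 3, herm (c (k - 1)) (c (k + 1))) ≠ 0 ∧
  (∏ k : Fin 3, herm (c (k - 1)) (c (k + 1))) =
    (‖∏ k : Fin 3, herm (c (k - 1)) (c (k + 1))‖ : ℂ) * Complex.exp (α * Complex.I)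

/-! ### Representations of triangle groups, relative components -/

/-- The relators `a^p, b^q, c^r, abc`. -/
def triangleRels (p q r : ℕ) : Set (FreeGroup (Fin 3)) :=
  {FreeGroup.of 0 ^ p, FreeGroup.of 1 ^ q, FreeGroup.of 2 ^ r,
    FreeGroup.of 0 * FreeGroup.of 1 * FreeGroup.of 2}

/-- `Γ^{(2)}_{p,q,r} = ⟨a, b, c | a^p = b^q = c^r = abc = 1⟩`. -/
abbrev TriangleGroup (p q r : ℕ) : Type := PresentedGroup (triangleRels p q r)

/-- The generators `a`, `b`, `c` are `gen 0`, `gen 1`, `gen 2`. -/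
def gen {p q r : ℕ} (k : Fin 3) : TriangleGroup p q r := PresentedGroup.of k

/-- Representations of `Γ^{(2)}_{p,q,r}` in `PU(2,1)`. -/
abbrev Rep (p q r : ℕ) : Type := TriangleGroup p q r →* PU21

/-- The topology of pointwise convergence on representations. -/
instance instTopologicalSpaceRep (p q r : ℕ) : TopologicalSpace (Rep p q r) :=
  TopologicalSpace.induced (fun (ρ : Rep p q r) (γ : TriangleGroup p q r) => ρ γ) inferInstance

/-- Conjugacy of representations under `PU(2,1)`. -/
instance repSetoid (p q r : ℕ) : Setoid (Rep p q r) where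
  r ρ ρ' := ∃ g : PU21, ∀ γ, ρ' γ = g * ρ γ * g⁻¹
  iseqv :=
    { refl := fun ρ => ⟨1, fun γ => by simp⟩
      symm := by
        rintro ρ ρ' ⟨g, hg⟩
        refine ⟨g⁻¹, fun γ => ?_⟩
        rw [hg γ]
        group
      trans := by
        rintro ρ ρ' ρ'' ⟨g, hg⟩ ⟨h, hh⟩
        refine ⟨h * g, fun γ => ?_⟩
        rw [hh γ, hg γ]
        group }

/-- Representations modulo conjugation in `PU(2,1)`, with the quotient topology. -/
abbrev RepClasses (p q r : ℕ) : Type := Quotient (repSetoid p q r)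

/-- The representations `ρ` such that `ρ(a)`, `ρ(b)`, `ρ(c)` lie in the elliptic conjugacy classes
with the prescribed angle pairs. -/
def relativeReps (p q r : ℕ) (α β γ : ℝ × ℝ) : Set (Rep p q r) :=
  {ρ | HasAnglePair (ρ (gen 0)) α ∧ HasAnglePair (ρ (gen 1)) β ∧ HasAnglePair (ρ (gen 2)) γ}

/-- `ρ` is irreducible. -/
def IsIrreducibleRep {p q r : ℕ} (ρ : Rep p q r) : Prop :=
  IsIrreducibleTriple (ρ (gen 0)) (ρ (gen 1)) (ρ (gen 2))

/-- `σ` is a lift to `SU(2,1)` of the representation of the free group `⟨a, b⟩` induced by `ρ`. -/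
def IsSULift {p q r : ℕ} (σ : FreeGroup (Fin 2) →* U21) (ρ : Rep p q r) : Prop :=
  (∀ w, (mat (σ w)).det = 1) ∧ toPU (σ (FreeGroup.of 0)) = ρ (gen 0) ∧
    toPU (σ (FreeGroup.of 1)) = ρ (gen 1)

/-! ### The relative component of the (4,5,20)-group -/

/-- Representations of the `(4,5,20)`-group with angle pairs
`(3π/2, π)`, `(6π/5, 2π/5)`, `(8π/5, 3π/10)`. -/
def reps4520 : Set (Rep 4 5 20) :=
  relativeReps 4 5 20 (3 * Real.pi / 2, Real.pi) (6 * Real.pi / 5, 2 * Real.pi / 5)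
    (8 * Real.pi / 5, 3 * Real.pi / 10)

/-- The classes of irreducible representations in the relative component. -/
def irreducibleClasses4520 : Set (RepClasses 4 5 20) :=
  {x | ∃ ρ ∈ reps4520, IsIrreducibleRep ρ ∧ (⟦ρ⟧ : RepClasses 4 5 20) = x}

/-- The rotation angles `(θ₁, θ₂, θ₃) = (θ, θ - π/2, θ - 21π/10)` of the three reflections. -/
def rotationAngle (θ : ℝ) : Fin 3 → ℝ :=
  ![θ, θ - Real.pi / 2, θ - 21 * Real.pi / 10]

/-- `sin² φ_k`, where `φ_k` is the complex angle between the mirrors of `R_{k-1}` and `R_{k+1}`,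
as a function of the rotation angle `θ` of the first reflection. -/
def sinSqAngle (θ : ℝ) : Fin 3 → ℝ :=
  ![(Real.cos (2 * Real.pi / 5) + Real.cos (Real.pi / 5)) /
      (Real.cos (Real.pi / 5) + Real.cos (θ - 13 * Real.pi / 10)),
    (Real.cos (13 * Real.pi / 20) + Real.cos (Real.pi / 20)) /
      (Real.cos (Real.pi / 20) + Real.cos (θ - 21 * Real.pi / 20)),
    2 * Real.cos (Real.pi / 4) / (Real.cos (Real.pi / 4) - Real.cos (θ - Real.pi / 4))]

/-- `r_k = cos φ_k`, with `φ_k ∈ [0, π/2]`. -/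
def cosAngle (θ : ℝ) (k : Fin 3) : ℝ := Real.sqrt (1 - sinSqAngle θ k)

/-- The parameters `(θ, α)` with `θ ∈ ]π, 3π/2[`, `α ∈ [0, 2π[` and
`cos α < (r₁² + r₂² + r₃² - 1) / (2 r₁ r₂ r₃)`. -/
def paramDomain : Set (ℝ × ℝ) :=
  {x | x.1 ∈ Set.Ioo Real.pi (3 * Real.pi / 2) ∧ x.2 ∈ Set.Ico 0 (2 * Real.pi) ∧
    Real.cos x.2 < (∑ k, cosAngle x.1 k ^ 2 - 1) / (2 * ∏ k, cosAngle x.1 k)}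

/-- The decomposition with polar vectors `c` and rotation factors `η` has parameters `(θ, α)`:
the `k`-th reflection rotates through the `k`-th rotation angle attached to `θ`, the mirrors meet
at the complex angles `φ_k` attached to `θ`, and the angular invariant is `α`. -/
def HasParameters (c : Fin 3 → Fin 3 → ℂ) (η : Fin 3 → ℂ) (x : ℝ × ℝ) : Prop :=
  (∀ k, η k = Complex.exp (rotationAngle x.1 k * Complex.I)) ∧
  (∀ k, ‖herm (c (k - 1)) (c (k + 1))‖ = cosAngle x.1 k) ∧
  HasAngularInvariant c x.2

end CHyp

end

noncomputable section

namespace CHyp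

open Matrix

/-! ### The Hermitian form -/

/-! Lift A, B, C to U(2,1) so that the negative eigenvector has eigenvalue 1. The six angles add up
to 6π, so the product of the three lifts is a cube root of unity, and an estimate of Re tr(AB)
forces it to be 1 (`exists_triple`). No product of positive-type eigenvalues, one from each of A, B,
C, equals 1; hence an eigenvector shared by two of the lifts is a negative vector fixed by all three
(`Triple.common_eigenvector`). So reducible means `Triple.Degenerate`. In that case A and B fix a
common point and act on its orthogonal plane, where tr(AB) determines the pair up to conjugation
(`Triple.Degenerate.equiv`); `exists_degenerate` exhibits one.

Otherwise the negative fixed vectors p, q, r of A, B, C span ℂ³. The reflection whose mirror passes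
through p and q and which carries r to Br = A⁻¹r, together with its two cyclic analogues, decomposes
the triple (`Triple.exists_decomposition`). Conversely, in any spherical decomposition the
determinants express all rotation factors through e^{iθ}, the traces give the moduli of the Gram
entries of the polar vectors, and the sign of the Gram determinant in signature (2,1) is the
inequality that defines `paramDomain` (`Triple.Dec.hasParameters`). Numerical estimates place θ in
]π, 3π/2[ and exclude α = 0 (`angular_bound_le_one`), so that α never crosses the ends of its
interval.

Both parameters are arguments of traces of noncommutative polynomials in A, B and their adjoints
(`Triple.Dec.trace_rotationElement`, `Triple.Dec.trace_angularElement`). They are therefore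
independent of the decomposition, invariant under conjugation, continuous, and determined by the
character. They fix the Gram matrix of the polar vectors up to phases, hence the class
(`Triple.equiv_of_params`). Explicit polar vectors depending continuously on (θ, α) realize every
point of the domain (`exists_stdTriple`), which gives `paramHomeo`. For characters, a further
polynomial with trace |⟨p, q⟩|² separates the degenerate class from the others. -/

lemma herm_add_left (x y w : Fin 3 → ℂ) : herm (x + y) w = herm x w + herm y w := by
  simp [herm]; ring

lemma herm_add_right (x y w : Fin 3 → ℂ) : herm w (x + y) = herm w x + herm w y := by
  simp [herm]; ring

lemma herm_smul_left (s : ℂ) (x w : Fin 3 → ℂ) : herm (s • x) w = s * herm x w := by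
  simp [herm]; ring

lemma herm_smul_right (s : ℂ) (x w : Fin 3 → ℂ) :
    herm w (s • x) = (starRingEnd ℂ) s * herm w x := by
  simp [herm]; ring

lemma herm_sub_left (x y w : Fin 3 → ℂ) : herm (x - y) w = herm x w - herm y w := by
  simp [herm]; ring

lemma herm_sub_right (x y w : Fin 3 → ℂ) : herm w (x - y) = herm w x - herm w y := by
  simp [herm]; ring

@[simp] lemma herm_zero_left (w : Fin 3 → ℂ) : herm 0 w = 0 := by simp [herm]

@[simp] lemma herm_zero_right (w : Fin 3 → ℂ) : herm w 0 = 0 := by simp [herm]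

lemma conj_herm (z w : Fin 3 → ℂ) : (starRingEnd ℂ) (herm z w) = herm w z := by
  simp [herm]; ring

lemma herm_eq_zero_symm {z w : Fin 3 → ℂ} (h : herm z w = 0) : herm w z = 0 := by
  rw [← conj_herm, h, map_zero]

lemma norm_herm_comm (z w : Fin 3 → ℂ) : ‖herm z w‖ = ‖herm w z‖ := by
  rw [← conj_herm, Complex.norm_conj]

lemma herm_mul_herm_swap (z w : Fin 3 → ℂ) : herm z w * herm w z = ((‖herm z w‖ ^ 2 : ℝ) : ℂ) := by
  rw [← conj_herm z w, Complex.mul_conj, Complex.normSq_eq_norm_sq]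

lemma herm_self_re (z : Fin 3 → ℂ) : ((herm z z).re : ℂ) = herm z z := by
  apply Complex.conj_eq_iff_re.mp
  exact conj_herm z z

lemma herm_self_re_eq (z : Fin 3 → ℂ) :
    (herm z z).re = ‖z 0‖ ^ 2 + ‖z 1‖ ^ 2 - ‖z 2‖ ^ 2 := by
  simp only [herm, Complex.mul_conj, Complex.normSq_eq_norm_sq]
  norm_cast

lemma eq_zero_of_herm_left {z : Fin 3 → ℂ} (h : ∀ w, herm z w = 0) : z = 0 := by
  funext i
  fin_cases i
  · simpa [herm] using h ![1, 0, 0]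
  · simpa [herm] using h ![0, 1, 0]
  · simpa [herm] using h ![0, 0, 1]

/-- The orthogonal complement of a negative vector is positive definite. -/
lemma herm_self_pos_of_orthogonal {p z : Fin 3 → ℂ} (hp : IsNegative p) (h : herm z p = 0)
    (hz : z ≠ 0) : 0 < (herm z z).re := by
  unfold IsNegative at hp
  rw [herm_self_re_eq] at *
  by_contra hcon
  push Not at hcon
  have h2 : z 2 * (starRingEnd ℂ) (p 2) =
      z 0 * (starRingEnd ℂ) (p 0) + z 1 * (starRingEnd ℂ) (p 1) := by
    unfold herm at h
    linear_combination -h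
  have h3 : ‖z 2‖ * ‖p 2‖ ≤ ‖z 0‖ * ‖p 0‖ + ‖z 1‖ * ‖p 1‖ := by
    have := norm_add_le (z 0 * (starRingEnd ℂ) (p 0)) (z 1 * (starRingEnd ℂ) (p 1))
    rw [← h2] at this
    simpa [norm_mul, Complex.norm_conj] using this
  have h4 : (‖z 2‖ * ‖p 2‖) ^ 2 ≤ (‖z 0‖ * ‖p 0‖ + ‖z 1‖ * ‖p 1‖) ^ 2 := by
    gcongr
  have h5 : (‖z 0‖ * ‖p 0‖ + ‖z 1‖ * ‖p 1‖) ^ 2 ≤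
      (‖z 0‖ ^ 2 + ‖z 1‖ ^ 2) * (‖p 0‖ ^ 2 + ‖p 1‖ ^ 2) := by
    nlinarith [sq_nonneg (‖z 0‖ * ‖p 1‖ - ‖z 1‖ * ‖p 0‖)]
  have h6 : ‖z 2‖ ^ 2 = 0 := by
    have hz2 := sq_nonneg ‖z 2‖
    by_contra hne
    have hpos : 0 < ‖z 2‖ ^ 2 := lt_of_le_of_ne hz2 (Ne.symm hne)
    have : (‖z 0‖ ^ 2 + ‖z 1‖ ^ 2) * (‖p 0‖ ^ 2 + ‖p 1‖ ^ 2) ≤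
        ‖z 2‖ ^ 2 * (‖p 0‖ ^ 2 + ‖p 1‖ ^ 2) := by
      gcongr
      linarith
    nlinarith
  have h0 : ‖z 0‖ = 0 := by nlinarith [sq_nonneg ‖z 0‖, sq_nonneg ‖z 1‖]
  have h1 : ‖z 1‖ = 0 := by nlinarith [sq_nonneg ‖z 0‖, sq_nonneg ‖z 1‖]
  have h2' : ‖z 2‖ = 0 := by simpa using h6
  apply hz
  funext i
  fin_cases i
  · simpa using h0
  · simpa using h1
  · simpa using h2'

/-! ### Adjoints and rank one operators -/

/-- The diagonal matrix of the Hermitian form. -/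
def formMatrix : Matrix (Fin 3) (Fin 3) ℂ := Matrix.diagonal ![1, 1, -1]

/-- The adjoint of a matrix with respect to the Hermitian form. -/
def adj (M : Matrix (Fin 3) (Fin 3) ℂ) : Matrix (Fin 3) (Fin 3) ℂ :=
  formMatrix * Mᴴ * formMatrix

lemma formMatrix_mul_self : formMatrix * formMatrix = 1 := by
  unfold formMatrix
  rw [diagonal_mul_diagonal, ← diagonal_one]
  congr 1
  funext i
  fin_cases i <;> simp

lemma formMatrix_conjTranspose : formMatrixᴴ = formMatrix := by
  unfold formMatrix
  rw [diagonal_conjTranspose]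
  congr 1
  funext i
  fin_cases i <;> simp

lemma herm_eq_dotProduct (z w : Fin 3 → ℂ) : herm z w = star w ⬝ᵥ (formMatrix *ᵥ z) := by
  simp [herm, formMatrix, dotProduct, Fin.sum_univ_three, mulVec_diagonal]
  ring

lemma herm_mulVec_left (M : Matrix (Fin 3) (Fin 3) ℂ) (z w : Fin 3 → ℂ) :
    herm (M *ᵥ z) w = herm z (adj M *ᵥ w) := by
  simp only [herm_eq_dotProduct, adj, star_mulVec, conjTranspose_mul, formMatrix_conjTranspose,
    conjTranspose_conjTranspose]
  rw [dotProduct_mulVec, dotProduct_mulVec, dotProduct_mulVec, vecMul_vecMul, vecMul_vecMul]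
  congr 2
  simp only [Matrix.mul_assoc, formMatrix_mul_self, Matrix.mul_one]

lemma adj_mul (M N : Matrix (Fin 3) (Fin 3) ℂ) : adj (M * N) = adj N * adj M := by
  have : ∀ X : Matrix (Fin 3) (Fin 3) ℂ, formMatrix * (formMatrix * X) = X := fun X => by
    rw [← Matrix.mul_assoc, formMatrix_mul_self, Matrix.one_mul]
  simp only [adj, conjTranspose_mul, Matrix.mul_assoc, this]

lemma adj_adj (M : Matrix (Fin 3) (Fin 3) ℂ) : adj (adj M) = M := by
  have : ∀ X : Matrix (Fin 3) (Fin 3) ℂ, formMatrix * (formMatrix * X) = X := fun X => by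
    rw [← Matrix.mul_assoc, formMatrix_mul_self, Matrix.one_mul]
  simp only [adj, conjTranspose_mul, formMatrix_conjTranspose, conjTranspose_conjTranspose,
    Matrix.mul_assoc, this, formMatrix_mul_self, Matrix.mul_one]

lemma adj_sub (M N : Matrix (Fin 3) (Fin 3) ℂ) : adj (M - N) = adj M - adj N := by
  simp [adj, Matrix.mul_sub, Matrix.sub_mul]

lemma adj_one : adj 1 = 1 := by simp [adj, formMatrix_mul_self]

lemma trace_adj (M : Matrix (Fin 3) (Fin 3) ℂ) : (adj M).trace = (starRingEnd ℂ) M.trace := by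
  unfold adj
  rw [trace_mul_comm, ← Matrix.mul_assoc, formMatrix_mul_self, Matrix.one_mul,
    trace_conjTranspose]
  rfl

lemma herm_mulVec_right (M : Matrix (Fin 3) (Fin 3) ℂ) (z w : Fin 3 → ℂ) :
    herm z (M *ᵥ w) = herm (adj M *ᵥ z) w := by
  rw [herm_mulVec_left, adj_adj]

/-- The rank one operator `z ↦ ⟨z, v⟩ v`. -/
def rankOne (v : Fin 3 → ℂ) : Matrix (Fin 3) (Fin 3) ℂ :=
  vecMulVec v (formMatrix *ᵥ star v)

lemma rankOne_mulVec (v z : Fin 3 → ℂ) : rankOne v *ᵥ z = herm z v • v := by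
  rw [rankOne, vecMulVec_mulVec, herm_eq_dotProduct]
  funext i
  simp [formMatrix, mulVec_diagonal, dotProduct, Fin.sum_univ_three]
  ring

lemma ext_mulVec {M N : Matrix (Fin 3) (Fin 3) ℂ} (h : ∀ z, M *ᵥ z = N *ᵥ z) : M = N := by
  apply Matrix.toLin'.injective
  ext1 z
  ext1
  simp [h]

lemma mul_rankOne (M : Matrix (Fin 3) (Fin 3) ℂ) (v : Fin 3 → ℂ) :
    M * rankOne v = vecMulVec (M *ᵥ v) (formMatrix *ᵥ star v) := by
  rw [rankOne, mul_vecMulVec]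

lemma trace_mul_rankOne (M : Matrix (Fin 3) (Fin 3) ℂ) (v : Fin 3 → ℂ) :
    (M * rankOne v).trace = herm (M *ᵥ v) v := by
  rw [mul_rankOne, trace_vecMulVec, herm_eq_dotProduct]
  simp [formMatrix, mulVec_diagonal, dotProduct, Fin.sum_univ_three]
  ring

lemma trace_rankOne (v : Fin 3 → ℂ) : (rankOne v).trace = herm v v := by
  have := trace_mul_rankOne 1 v
  simpa using this

lemma mul_rankOne_mul_adj (M : Matrix (Fin 3) (Fin 3) ℂ) (v : Fin 3 → ℂ) :
    M * rankOne v * adj M = rankOne (M *ᵥ v) := by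
  apply ext_mulVec
  intro z
  rw [← mulVec_mulVec, ← mulVec_mulVec, rankOne_mulVec, rankOne_mulVec, mulVec_smul,
    herm_mulVec_right]

lemma rankOne_smul (s : ℂ) (v : Fin 3 → ℂ) :
    rankOne (s • v) = ((‖s‖ ^ 2 : ℝ) : ℂ) • rankOne v := by
  apply ext_mulVec
  intro z
  rw [rankOne_mulVec, smul_mulVec, rankOne_mulVec, herm_smul_right, smul_smul, smul_smul]
  congr 1
  rw [← Complex.normSq_eq_norm_sq, ← Complex.mul_conj]
  ring

lemma trace_rankOne_three (u v w : Fin 3 → ℂ) :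
    (rankOne u * rankOne v * rankOne w).trace = herm w v * herm v u * herm u w := by
  rw [trace_mul_rankOne, ← mulVec_mulVec, rankOne_mulVec, rankOne_mulVec,
    herm_smul_left, herm_smul_left]

/-! ### Elements of `U(2,1)` -/

@[simp] lemma mat_mul (g h : U21) : mat (g * h) = mat g * mat h := rfl

@[simp] lemma mat_one : mat 1 = 1 := rfl

lemma herm_mat (g : U21) (z w : Fin 3 → ℂ) : herm (mat g *ᵥ z) (mat g *ᵥ w) = herm z w :=
  g.2 z w

lemma mat_injective : Function.Injective mat := fun _ _ h => Subtype.ext (Units.ext h)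

lemma mat_mul_mat_inv (g : U21) : mat g * mat g⁻¹ = 1 := by
  rw [← mat_mul, mul_inv_cancel, mat_one]

lemma mat_inv_mul_mat (g : U21) : mat g⁻¹ * mat g = 1 := by
  rw [← mat_mul, inv_mul_cancel, mat_one]

lemma adj_mul_self_of_isometry {M : Matrix (Fin 3) (Fin 3) ℂ}
    (h : ∀ z w, herm (M *ᵥ z) (M *ᵥ w) = herm z w) : adj M * M = 1 := by
  apply ext_mulVec
  intro z
  rw [one_mulVec, ← sub_eq_zero]
  apply eq_zero_of_herm_left
  intro w
  rw [herm_sub_left, ← mulVec_mulVec, herm_mulVec_left, adj_adj, h, sub_self]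

lemma mat_inv (g : U21) : mat g⁻¹ = adj (mat g) := by
  have h := adj_mul_self_of_isometry (herm_mat g)
  calc mat g⁻¹ = (adj (mat g) * mat g) * mat g⁻¹ := by rw [h, Matrix.one_mul]
    _ = adj (mat g) := by rw [Matrix.mul_assoc, mat_mul_mat_inv, Matrix.mul_one]

lemma mat_mul_adj_mat (g : U21) : mat g * adj (mat g) = 1 := by
  rw [← mat_inv, mat_mul_mat_inv]

/-- An isometric matrix as an element of `U(2,1)`. -/
def ofIsometry (M : Matrix (Fin 3) (Fin 3) ℂ)
    (h : ∀ z w, herm (M *ᵥ z) (M *ᵥ w) = herm z w) : U21 :=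
  ⟨⟨M, adj M, mul_eq_one_comm.mp (adj_mul_self_of_isometry h), adj_mul_self_of_isometry h⟩, h⟩

@[simp] lemma mat_ofIsometry (M : Matrix (Fin 3) (Fin 3) ℂ)
    (h : ∀ z w, herm (M *ᵥ z) (M *ᵥ w) = herm z w) : mat (ofIsometry M h) = M := rfl

lemma mat_mulVec_injective (g : U21) {z w : Fin 3 → ℂ} (h : mat g *ᵥ z = mat g *ᵥ w) : z = w := by
  have := congrArg (fun v => mat g⁻¹ *ᵥ v) h
  simpa [mulVec_mulVec, mat_inv_mul_mat] using this

lemma mat_inv_mulVec_eq {g : U21} {z w : Fin 3 → ℂ} (h : mat g *ᵥ z = w) : mat g⁻¹ *ᵥ w = z := by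
  rw [← h, mulVec_mulVec, mat_inv_mul_mat, one_mulVec]

lemma conj_rankOne (g : U21) (v : Fin 3 → ℂ) :
    mat g * rankOne v * mat g⁻¹ = rankOne (mat g *ᵥ v) := by
  rw [mat_inv, mul_rankOne_mul_adj]

lemma det_mat_ne_zero (g : U21) : (mat g).det ≠ 0 := by
  intro h
  have := congrArg det (mat_mul_mat_inv g)
  simp [h] at this

/-- The matrix of the complex reflection `z ↦ z + (η - 1) ⟨z, c⟩ c`. -/
def reflMatrix (c : Fin 3 → ℂ) (η : ℂ) : Matrix (Fin 3) (Fin 3) ℂ := 1 + (η - 1) • rankOne c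

lemma reflMatrix_mulVec (c : Fin 3 → ℂ) (η : ℂ) (z : Fin 3 → ℂ) :
    reflMatrix c η *ᵥ z = z + ((η - 1) * herm z c) • c := by
  rw [reflMatrix, add_mulVec, one_mulVec, smul_mulVec, rankOne_mulVec, smul_smul]

lemma mul_conj_of_norm_one {η : ℂ} (h : ‖η‖ = 1) : η * (starRingEnd ℂ) η = 1 := by
  rw [Complex.mul_conj, Complex.normSq_eq_norm_sq, h]; simp

lemma reflMatrix_isometry {c : Fin 3 → ℂ} {η : ℂ} (hc : herm c c = 1) (hη : ‖η‖ = 1)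
    (z w : Fin 3 → ℂ) :
    herm (reflMatrix c η *ᵥ z) (reflMatrix c η *ᵥ w) = herm z w := by
  simp only [reflMatrix_mulVec, herm_add_left, herm_add_right, herm_smul_left, herm_smul_right, hc,
    map_mul, map_sub, map_one, conj_herm]
  linear_combination (herm z c * herm c w) * mul_conj_of_norm_one hη

/-- The complex reflection with polar vector `c` and rotation factor `η`, in `U(2,1)`. -/
def refl (c : Fin 3 → ℂ) (η : ℂ) (hc : herm c c = 1) (hη : ‖η‖ = 1) : U21 :=
  ofIsometry (reflMatrix c η) (reflMatrix_isometry hc hη)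

/-! ### The center -/

lemma mem_center_of_scalar {g : U21} {l : ℂ} (h : mat g = l • (1 : Matrix (Fin 3) (Fin 3) ℂ)) :
    g ∈ Subgroup.center U21 := by
  rw [Subgroup.mem_center_iff]
  intro k
  apply mat_injective
  simp [h]

lemma norm_eq_one_of_scalar {g : U21} {l : ℂ} (h : mat g = l • (1 : Matrix (Fin 3) (Fin 3) ℂ)) :
    ‖l‖ = 1 := by
  have := herm_mat g ![1, 0, 0] ![1, 0, 0]
  rw [h, smul_mulVec, one_mulVec, herm_smul_left, herm_smul_right] at this
  simp [herm, Complex.mul_conj, Complex.normSq_eq_norm_sq] at this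
  norm_cast at this
  rcases this with h1 | h1
  · exact h1
  · have := norm_nonneg l
    rw [h1] at this
    norm_num at this

/-- Commuting with the reflections of order two makes every unit positive vector an eigenvector. The
four vectors (1,0,0), (0,1,0), (1,1,1), (1,1,-1) already force a scalar matrix. -/
lemma scalar_of_mem_center {g : U21} (hg : g ∈ Subgroup.center U21) :
    ∃ l : ℂ, ‖l‖ = 1 ∧ mat g = l • (1 : Matrix (Fin 3) (Fin 3) ℂ) := by
  rw [Subgroup.mem_center_iff] at hg
  have key : ∀ c : Fin 3 → ℂ, herm c c = 1 → mat g *ᵥ c = herm (mat g *ᵥ c) c • c := by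
    intro c hc
    have h := congrArg mat (hg (refl c (-1) hc (by simp)))
    have h2 := congrArg (fun M => M *ᵥ c) h
    simp only [mat_mul, ← mulVec_mulVec, refl, mat_ofIsometry, reflMatrix_mulVec, hc,
      mulVec_add, mulVec_smul] at h2
    have h3 : ((-1 - 1 : ℂ) * herm (mat g *ᵥ c) c) • c = ((-1 - 1 : ℂ) * 1) • (mat g *ᵥ c) :=
      add_left_cancel h2
    have h4 : (-2 : ℂ) • (mat g *ᵥ c) = (-2 : ℂ) • (herm (mat g *ᵥ c) c • c) := by
      rw [smul_smul]
      convert h3.symm using 2 <;> norm_num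
    exact smul_right_injective _ (by norm_num : (-2 : ℂ) ≠ 0) h4
  have h0 := key ![1, 0, 0] (by simp [herm])
  have h1 := key ![0, 1, 0] (by simp [herm])
  have h2 := key ![1, 1, 1] (by simp [herm])
  set M := mat g with hM
  have e : ∀ z i, (M *ᵥ z) i = M i 0 * z 0 + M i 1 * z 1 + M i 2 * z 2 := by
    intro z i; simp [mulVec, dotProduct, Fin.sum_univ_three]
  have a0 := congrFun h0 1
  have b0 := congrFun h0 2
  have a1 := congrFun h1 0
  have b1 := congrFun h1 2
  have a2 := congrFun h2 0
  have b2 := congrFun h2 1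
  have d2 := congrFun h2 2
  simp only [e, herm] at a0 b0 a1 b1 a2 b2 d2
  simp at a0 b0 a1 b1 a2 b2 d2
  have h3 := key ![1, 1, -1] (by simp [herm])
  have a3 := congrFun h3 0
  have b3 := congrFun h3 1
  have d3 := congrFun h3 2
  simp only [e, herm] at a3 b3 d3
  simp at a3 b3 d3
  simp only [a0, b0, a1, b1, zero_add, add_zero] at a2 b2 d2 a3 b3 d3
  have e1 : M 0 2 = 0 := by linear_combination a2 / 2 - a3 / 2 - d2 / 2 - d3 / 2
  have e2 : M 1 2 = 0 := by linear_combination b2 / 2 - b3 / 2 - d2 / 2 - d3 / 2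
  have e3 : M 1 1 = M 0 0 := by linear_combination b2 - a2 + e1 - e2
  have e4 : M 2 2 = M 0 0 := by linear_combination d2 - a2 + e1
  have hs : mat g = (M 0 0) • (1 : Matrix (Fin 3) (Fin 3) ℂ) := by
    ext i j
    fin_cases i <;> fin_cases j <;> simp [← hM, a0, b0, a1, b1, e1, e2, e3, e4]
  exact ⟨M 0 0, norm_eq_one_of_scalar hs, hs⟩

lemma toPU_eq_iff (g h : U21) :
    toPU g = toPU h ↔ ∃ l : ℂ, ‖l‖ = 1 ∧ mat g = l • mat h := by
  constructor
  · intro e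
    have e' : h⁻¹ * g ∈ Subgroup.center U21 := QuotientGroup.eq.mp e.symm
    obtain ⟨l, hl, hm⟩ := scalar_of_mem_center e'
    refine ⟨l, hl, ?_⟩
    have : mat g = mat h * mat (h⁻¹ * g) := by rw [← mat_mul, mul_inv_cancel_left]
    rw [this, hm]
    simp
  · rintro ⟨l, hl, e⟩
    symm
    apply QuotientGroup.eq.mpr
    apply mem_center_of_scalar (l := l)
    rw [mat_mul, e, mul_smul_comm, mat_inv_mul_mat]

lemma toPU_surjective : Function.Surjective toPU := QuotientGroup.mk'_surjective _

/-! ### Orthonormal frames -/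

/-- An orthonormal frame of signature `(+, +, -)`. -/
structure IsFrame (a b p : Fin 3 → ℂ) : Prop where
  aa : herm a a = 1
  bb : herm b b = 1
  pp : herm p p = -1
  ab : herm a b = 0
  ap : herm a p = 0
  bp : herm b p = 0

lemma IsFrame.ba {a b p : Fin 3 → ℂ} (h : IsFrame a b p) : herm b a = 0 :=
  herm_eq_zero_symm h.ab

lemma IsFrame.pa {a b p : Fin 3 → ℂ} (h : IsFrame a b p) : herm p a = 0 :=
  herm_eq_zero_symm h.ap

lemma IsFrame.pb {a b p : Fin 3 → ℂ} (h : IsFrame a b p) : herm p b = 0 :=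
  herm_eq_zero_symm h.bp

/-- The matrix with columns `a`, `b`, `p`. -/
def colMatrix (a b p : Fin 3 → ℂ) : Matrix (Fin 3) (Fin 3) ℂ := (Matrix.of ![a, b, p])ᵀ

lemma colMatrix_mulVec (a b p z : Fin 3 → ℂ) :
    colMatrix a b p *ᵥ z = z 0 • a + z 1 • b + z 2 • p := by
  funext i
  simp [colMatrix, mulVec, dotProduct, Fin.sum_univ_three]
  ring

/-- The element of `U(2,1)` that maps the standard basis to a frame. -/
def IsFrame.toU {a b p : Fin 3 → ℂ} (h : IsFrame a b p) : U21 :=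
  ofIsometry (colMatrix a b p) (by
    intro z w
    simp only [colMatrix_mulVec, herm_add_left, herm_add_right, herm_smul_left, herm_smul_right,
      h.aa, h.bb, h.pp, h.ab, h.ap, h.bp, h.ba, h.pa, h.pb]
    simp [herm]
    ring)

lemma IsFrame.mat_toU {a b p : Fin 3 → ℂ} (h : IsFrame a b p) :
    mat h.toU = colMatrix a b p := rfl

lemma IsFrame.toU_mulVec {a b p : Fin 3 → ℂ} (h : IsFrame a b p) (z : Fin 3 → ℂ) :
    mat h.toU *ᵥ z = z 0 • a + z 1 • b + z 2 • p := by
  rw [h.mat_toU, colMatrix_mulVec]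

lemma IsFrame.expand {a b p : Fin 3 → ℂ} (h : IsFrame a b p) (z : Fin 3 → ℂ) :
    z = herm z a • a + herm z b • b - herm z p • p := by
  obtain ⟨y, rfl⟩ : ∃ y, z = mat h.toU *ᵥ y :=
    ⟨mat h.toU⁻¹ *ᵥ z, by rw [mulVec_mulVec, mat_mul_mat_inv, one_mulVec]⟩
  rw [h.toU_mulVec]
  simp only [herm_add_left, herm_smul_left, h.aa, h.bb, h.pp, h.ab, h.ap, h.bp, h.ba, h.pa, h.pb]
  module

lemma IsFrame.sum_rankOne {a b p : Fin 3 → ℂ} (h : IsFrame a b p) :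
    rankOne a + rankOne b - rankOne p = 1 := by
  apply ext_mulVec
  intro z
  rw [sub_mulVec, add_mulVec, rankOne_mulVec, rankOne_mulVec, rankOne_mulVec, one_mulVec]
  exact (h.expand z).symm

lemma IsFrame.isNegative {a b p : Fin 3 → ℂ} (h : IsFrame a b p) : IsNegative p := by
  simp [IsNegative, h.pp]

lemma IsFrame.ne_zero {a b p : Fin 3 → ℂ} (h : IsFrame a b p) : p ≠ 0 := by
  rintro rfl
  simpa using h.pp

lemma IsFrame.map {a b p : Fin 3 → ℂ} (h : IsFrame a b p) (g : U21) :
    IsFrame (mat g *ᵥ a) (mat g *ᵥ b) (mat g *ᵥ p) := by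
  constructor <;> rw [herm_mat]
  exacts [h.aa, h.bb, h.pp, h.ab, h.ap, h.bp]

lemma isFrame_std : IsFrame ![1, 0, 0] ![0, 1, 0] ![0, 0, 1] := by
  constructor <;> simp [herm]

/-! ### Elliptic elements in normal form -/

/-- The matrix with eigenvalue `1` on the negative vector of a frame `a, b, p` and eigenvalues
`μ`, `ν` on `a`, `b`. -/
def ellMatrix (μ ν : ℂ) (a b : Fin 3 → ℂ) : Matrix (Fin 3) (Fin 3) ℂ :=
  1 + (μ - 1) • rankOne a + (ν - 1) • rankOne b

lemma ellMatrix_mulVec (μ ν : ℂ) (a b z : Fin 3 → ℂ) :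
    ellMatrix μ ν a b *ᵥ z = z + ((μ - 1) * herm z a) • a + ((ν - 1) * herm z b) • b := by
  simp only [ellMatrix, add_mulVec, one_mulVec, smul_mulVec, rankOne_mulVec, smul_smul]

/-- `g` is in normal form with frame `a, b, p` and eigenvalues `μ, ν, 1`. -/
structure IsNormalForm (g : U21) (μ ν : ℂ) (a b p : Fin 3 → ℂ) : Prop where
  frame : IsFrame a b p
  mat_eq : mat g = ellMatrix μ ν a b

lemma IsNormalForm.conj {g : U21} {μ ν : ℂ} {a b p : Fin 3 → ℂ} (h : IsNormalForm g μ ν a b p)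
    (k : U21) : IsNormalForm (k * g * k⁻¹) μ ν (mat k *ᵥ a) (mat k *ᵥ b) (mat k *ᵥ p) := by
  refine ⟨h.frame.map k, ?_⟩
  simp only [mat_mul, h.mat_eq, ellMatrix, Matrix.mul_add, Matrix.add_mul, Matrix.mul_one,
    mat_mul_mat_inv, Matrix.mul_smul, Matrix.smul_mul, conj_rankOne]

lemma isNormalForm_ellipticE (α : ℝ × ℝ) :
    IsNormalForm (ellipticE α) (Complex.exp (α.1 * Complex.I)) (Complex.exp (α.2 * Complex.I))
      ![1, 0, 0] ![0, 1, 0] ![0, 0, 1] := by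
  refine ⟨isFrame_std, ?_⟩
  apply ext_mulVec
  intro z
  rw [ellMatrix_mulVec]
  simp only [mat, ellipticE]
  funext i
  have e : Matrix.mulVec (Matrix.diagonal ![Complex.exp (α.1 * Complex.I),
      Complex.exp (α.2 * Complex.I), 1]) z i = ![Complex.exp (α.1 * Complex.I) * z 0,
      Complex.exp (α.2 * Complex.I) * z 1, z 2] i := by
    rw [mulVec_diagonal]
    fin_cases i <;> simp
  refine e.trans ?_
  fin_cases i <;> simp [herm, vecHead, vecTail] <;> ring_nf

lemma IsNormalForm.eq_of_frame {g h : U21} {μ ν : ℂ} {a b p : Fin 3 → ℂ}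
    (hg : IsNormalForm g μ ν a b p) (hh : IsNormalForm h μ ν a b p) : g = h :=
  mat_injective (hg.mat_eq.trans hh.mat_eq.symm)

lemma exists_normalForm_of_hasAnglePair {A : PU21} {α : ℝ × ℝ} (h : HasAnglePair A α) :
    ∃ (g : U21) (a b p : Fin 3 → ℂ), toPU g = A ∧
      IsNormalForm g (Complex.exp (α.1 * Complex.I)) (Complex.exp (α.2 * Complex.I)) a b p := by
  obtain ⟨k, hk⟩ := isConj_iff.mp h
  obtain ⟨k, rfl⟩ := toPU_surjective k
  refine ⟨k * ellipticE α * k⁻¹, _, _, _, ?_, (isNormalForm_ellipticE α).conj k⟩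
  rw [map_mul, map_mul, map_inv, hk]

lemma IsNormalForm.hasAnglePair {g : U21} {α : ℝ × ℝ} {a b p : Fin 3 → ℂ}
    (h : IsNormalForm g (Complex.exp (α.1 * Complex.I)) (Complex.exp (α.2 * Complex.I)) a b p) :
    HasAnglePair (toPU g) α := by
  apply isConj_iff.mpr
  refine ⟨toPU h.frame.toU, ?_⟩
  rw [← map_mul, ← map_inv, ← map_mul]
  congr 1
  have := (isNormalForm_ellipticE α).conj h.frame.toU
  simp only [h.frame.toU_mulVec] at this
  simp at this
  exact this.eq_of_frame h

lemma IsNormalForm.trace {g : U21} {μ ν : ℂ} {a b p : Fin 3 → ℂ} (h : IsNormalForm g μ ν a b p) :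
    (mat g).trace = 1 + μ + ν := by
  simp [h.mat_eq, ellMatrix, trace_rankOne, h.frame.aa, h.frame.bb]
  ring

lemma IsNormalForm.apply_a {g : U21} {μ ν : ℂ} {a b p : Fin 3 → ℂ} (h : IsNormalForm g μ ν a b p) :
    mat g *ᵥ a = μ • a := by
  rw [h.mat_eq, ellMatrix_mulVec, h.frame.aa, h.frame.ab]
  module

lemma IsNormalForm.apply_b {g : U21} {μ ν : ℂ} {a b p : Fin 3 → ℂ} (h : IsNormalForm g μ ν a b p) :
    mat g *ᵥ b = ν • b := by
  rw [h.mat_eq, ellMatrix_mulVec, h.frame.bb, h.frame.ba]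
  module

lemma IsNormalForm.apply_p {g : U21} {μ ν : ℂ} {a b p : Fin 3 → ℂ} (h : IsNormalForm g μ ν a b p) :
    mat g *ᵥ p = p := by
  rw [h.mat_eq, ellMatrix_mulVec, h.frame.pa, h.frame.pb]
  module

lemma IsNormalForm.det {g : U21} {μ ν : ℂ} {a b p : Fin 3 → ℂ} (h : IsNormalForm g μ ν a b p) :
    (mat g).det = μ * ν := by
  have e : mat g * colMatrix a b p = colMatrix a b p * diagonal ![μ, ν, 1] := by
    apply ext_mulVec
    intro z
    rw [← mulVec_mulVec, ← mulVec_mulVec, colMatrix_mulVec, colMatrix_mulVec, mulVec_add,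
      mulVec_add, mulVec_smul, mulVec_smul, mulVec_smul, h.apply_a, h.apply_b, h.apply_p]
    simp only [mulVec_diagonal]
    simp
    module
  have := congrArg Matrix.det e
  rw [det_mul, det_mul, det_diagonal, Fin.prod_univ_three, mul_comm] at this
  have hne : (colMatrix a b p).det ≠ 0 := by
    rw [← h.frame.mat_toU]
    exact det_mat_ne_zero _
  simpa using mul_left_cancel₀ hne this

lemma IsNormalForm.herm_apply {g : U21} {μ ν : ℂ} {a b p : Fin 3 → ℂ}
    (h : IsNormalForm g μ ν a b p) (z : Fin 3 → ℂ) :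
    herm (mat g *ᵥ z) a = μ * herm z a ∧ herm (mat g *ᵥ z) b = ν * herm z b ∧
      herm (mat g *ᵥ z) p = herm z p := by
  rw [h.mat_eq, ellMatrix_mulVec]
  simp only [herm_add_left, herm_smul_left, h.frame.aa, h.frame.bb, h.frame.ab, h.frame.ap,
    h.frame.bp, h.frame.ba]
  refine ⟨?_, ?_, ?_⟩ <;> ring

/-- Eigenvectors of an element in normal form with three distinct eigenvalues. -/
lemma IsNormalForm.eigenvector {g : U21} {μ ν : ℂ} {a b p : Fin 3 → ℂ}
    (h : IsNormalForm g μ ν a b p) (hμν : μ ≠ ν) (hμ : μ ≠ 1) (hν : ν ≠ 1) {z : Fin 3 → ℂ}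
    (hz : z ≠ 0) {l : ℂ} (hl : mat g *ᵥ z = l • z) :
    (l = μ ∧ z = herm z a • a) ∨ (l = ν ∧ z = herm z b • b) ∨ (l = 1 ∧ z = -herm z p • p) := by
  obtain ⟨ea, eb, ep⟩ := h.herm_apply z
  rw [hl, herm_smul_left] at ea eb ep
  have ea' : (l - μ) * herm z a = 0 := by linear_combination ea
  have eb' : (l - ν) * herm z b = 0 := by linear_combination eb
  have ep' : (l - 1) * herm z p = 0 := by linear_combination ep
  have hx := h.frame.expand z
  by_cases h1 : l = μ
  · subst h1
    rw [mul_eq_zero, sub_eq_zero] at eb' ep'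
    have hb := eb'.resolve_left hμν
    have hp := ep'.resolve_left hμ
    left
    rw [hb, hp] at hx
    exact ⟨rfl, by simpa using hx⟩
  · have ha := (mul_eq_zero.mp ea').resolve_left (sub_ne_zero.mpr h1)
    by_cases h2 : l = ν
    · subst h2
      rw [mul_eq_zero, sub_eq_zero] at ep'
      have hp := ep'.resolve_left hν
      right; left
      rw [ha, hp] at hx
      exact ⟨rfl, by simpa using hx⟩
    · have hb := (mul_eq_zero.mp eb').resolve_left (sub_ne_zero.mpr h2)
      by_cases h3 : l = 1
      · right; right
        rw [ha, hb] at hx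
        exact ⟨h3, by simpa using hx⟩
      · have hp := (mul_eq_zero.mp ep').resolve_left (sub_ne_zero.mpr h3)
        rw [ha, hb, hp] at hx
        simp at hx
        exact absurd hx hz

/-! ### Recognition of elliptic elements -/

lemma det_sub_scalar (M : Matrix (Fin 3) (Fin 3) ℂ) (x : ℂ) :
    (M - x • (1 : Matrix (Fin 3) (Fin 3) ℂ)).det =
      M.det - x * M.adjugate.trace + x ^ 2 * M.trace - x ^ 3 := by
  rw [det_fin_three, det_fin_three, adjugate_fin_three, trace_fin_three, trace_fin_three]
  simp
  ring

/-- Since the inverse is the adjoint, the middle coefficient of the characteristic polynomial comes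
from the trace and the determinant, which therefore determine the whole polynomial. -/
lemma trace_adjugate_mat (g : U21) :
    (mat g).adjugate.trace = (mat g).det * (starRingEnd ℂ) (mat g).trace := by
  have h : (mat g).adjugate = (mat g).det • adj (mat g) := by
    calc (mat g).adjugate = (mat g).adjugate * (mat g * adj (mat g)) := by
          rw [mat_mul_adj_mat, Matrix.mul_one]
      _ = _ := by rw [← Matrix.mul_assoc, adjugate_mul, Matrix.smul_mul, Matrix.one_mul]
  rw [h, trace_smul, trace_adj, smul_eq_mul]

lemma exists_eigenvector (g : U21) {x μ ν : ℂ} (hμ : ‖μ‖ = 1) (hν : ‖ν‖ = 1)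
    (htr : (mat g).trace = 1 + μ + ν) (hdet : (mat g).det = μ * ν)
    (hx : (1 - x) * (μ - x) * (ν - x) = 0) : ∃ z ≠ 0, mat g *ᵥ z = x • z := by
  have hdet0 : (mat g - x • (1 : Matrix (Fin 3) (Fin 3) ℂ)).det = 0 := by
    rw [det_sub_scalar, trace_adjugate_mat, htr, hdet]
    simp only [map_add, map_one]
    linear_combination hx - (x * ν) * mul_conj_of_norm_one hμ - (x * μ) * mul_conj_of_norm_one hν
  obtain ⟨z, hz, he⟩ := exists_mulVec_eq_zero_iff.mpr hdet0
  refine ⟨z, hz, ?_⟩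
  rw [sub_mulVec, smul_mulVec, one_mulVec, sub_eq_zero] at he
  exact he

lemma herm_eq_zero_of_eigen (g : U21) {x y : ℂ} (hy : ‖y‖ = 1) (hxy : x ≠ y) {z w : Fin 3 → ℂ}
    (hz : mat g *ᵥ z = x • z) (hw : mat g *ᵥ w = y • w) : herm z w = 0 := by
  have h := herm_mat g z w
  rw [hz, hw, herm_smul_left, herm_smul_right] at h
  have h2 : (x - y) * herm z w = 0 := by
    linear_combination y * h - x * herm z w * mul_conj_of_norm_one hy
  exact (mul_eq_zero.mp h2).resolve_left (sub_ne_zero.mpr hxy)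

lemma exists_normalize_pos {z : Fin 3 → ℂ} (hz : 0 < (herm z z).re) :
    ∃ s : ℝ, 0 < s ∧ herm ((s : ℂ) • z) ((s : ℂ) • z) = 1 := by
  refine ⟨(Real.sqrt (herm z z).re)⁻¹, by positivity, ?_⟩
  rw [herm_smul_left, herm_smul_right, ← herm_self_re z, Complex.conj_ofReal]
  norm_cast
  have := Real.sq_sqrt hz.le
  have h3 : Real.sqrt (herm z z).re ≠ 0 := (Real.sqrt_pos.mpr hz).ne'
  field_simp
  simpa using this.symm

lemma exists_normalize_neg {z : Fin 3 → ℂ} (hz : IsNegative z) :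
    ∃ s : ℝ, 0 < s ∧ herm ((s : ℂ) • z) ((s : ℂ) • z) = -1 := by
  have hz' : 0 < -(herm z z).re := by
    unfold IsNegative at hz
    linarith
  refine ⟨(Real.sqrt (-(herm z z).re))⁻¹, by positivity, ?_⟩
  rw [herm_smul_left, herm_smul_right, ← herm_self_re z, Complex.conj_ofReal]
  norm_cast
  have := Real.sq_sqrt hz'.le
  have h3 : Real.sqrt (-(herm z z).re) ≠ 0 := (Real.sqrt_pos.mpr hz').ne'
  field_simp
  rw [this]
  push_cast
  ring

/-- Trace and determinant give the eigenvalues but not which of them has negative type; the fixed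
negative vector p decides this. The other two eigenvectors are orthogonal to p, hence positive. -/
lemma exists_normalForm (g : U21) {μ ν : ℂ} (hμ : ‖μ‖ = 1) (hν : ‖ν‖ = 1) (hμν : μ ≠ ν)
    (hμ1 : μ ≠ 1) (hν1 : ν ≠ 1) (htr : (mat g).trace = 1 + μ + ν) (hdet : (mat g).det = μ * ν)
    {p : Fin 3 → ℂ} (hp : IsNegative p) (hgp : mat g *ᵥ p = p) :
    ∃ a b q, IsNormalForm g μ ν a b q := by
  obtain ⟨a, ha0, ha⟩ := exists_eigenvector g (x := μ) hμ hν htr hdet (by ring)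
  obtain ⟨b, hb0, hb⟩ := exists_eigenvector g (x := ν) hμ hν htr hdet (by ring)
  have hgp1 : mat g *ᵥ p = (1 : ℂ) • p := by rw [hgp, one_smul]
  have hap := herm_eq_zero_of_eigen g (by simp) hμ1 ha hgp1
  have hbp := herm_eq_zero_of_eigen g (by simp) hν1 hb hgp1
  have hab := herm_eq_zero_of_eigen g hν hμν ha hb
  obtain ⟨s, -, hs⟩ := exists_normalize_pos (herm_self_pos_of_orthogonal hp hap ha0)
  obtain ⟨t, -, ht⟩ := exists_normalize_pos (herm_self_pos_of_orthogonal hp hbp hb0)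
  obtain ⟨r, -, hr⟩ := exists_normalize_neg hp
  have hF : IsFrame ((s : ℂ) • a) ((t : ℂ) • b) ((r : ℂ) • p) := by
    refine ⟨hs, ht, hr, ?_, ?_, ?_⟩ <;> rw [herm_smul_left, herm_smul_right] <;>
      simp only [hap, hbp, hab, mul_zero]
  refine ⟨_, _, _, hF, ?_⟩
  apply ext_mulVec
  intro z
  rw [ellMatrix_mulVec]
  conv_lhs => rw [hF.expand z]
  conv_rhs => rw [add_assoc, hF.expand z]
  simp only [mulVec_add, mulVec_sub, mulVec_smul, ha, hb, hgp, herm_add_left, herm_sub_left,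
    herm_smul_left (herm z _), hF.aa, hF.bb, hF.ab, hF.ba, hF.pa, hF.pb]
  module

/-! ### Numerical values -/

/-- `cis t = e^{it}`. -/
def cis (t : ℝ) : ℂ := Complex.exp (t * Complex.I)

lemma cis_re (t : ℝ) : (cis t).re = Real.cos t := Complex.exp_ofReal_mul_I_re t

lemma cis_im (t : ℝ) : (cis t).im = Real.sin t := Complex.exp_ofReal_mul_I_im t

lemma norm_cis (t : ℝ) : ‖cis t‖ = 1 := Complex.norm_exp_ofReal_mul_I t

lemma cis_add (s t : ℝ) : cis (s + t) = cis s * cis t := by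
  rw [cis, cis, cis, ← Complex.exp_add]
  push_cast
  ring_nf

lemma cis_zero : cis 0 = 1 := by simp [cis]

lemma conj_cis (t : ℝ) : (starRingEnd ℂ) (cis t) = cis (-t) := by
  apply Complex.ext <;> simp [cis_re, cis_im]

lemma cis_ne_zero (t : ℝ) : cis t ≠ 0 := Complex.exp_ne_zero _

lemma cis_eq_one_iff (t : ℝ) : cis t = 1 ↔ ∃ n : ℤ, t = n * (2 * Real.pi) := by
  rw [cis, Complex.exp_eq_one_iff]
  constructor
  · rintro ⟨n, hn⟩
    refine ⟨n, ?_⟩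
    have h : (t : ℂ) = n * (2 * Real.pi) := by
      apply mul_right_cancel₀ Complex.I_ne_zero
      rw [hn]; ring
    exact_mod_cast h
  · rintro ⟨n, rfl⟩
    refine ⟨n, ?_⟩
    push_cast
    ring

lemma cis_pow (t : ℝ) (n : ℕ) : cis t ^ n = cis (n * t) := by
  rw [cis, cis, ← Complex.exp_nat_mul]
  push_cast
  ring_nf

lemma cis_int_two_pi (n : ℤ) : cis (n * (2 * Real.pi)) = 1 := (cis_eq_one_iff _).mpr ⟨n, rfl⟩

lemma cis_eq_iff (s t : ℝ) : cis s = cis t ↔ ∃ n : ℤ, s - t = n * (2 * Real.pi) := by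
  rw [← cis_eq_one_iff, sub_eq_add_neg, cis_add, ← conj_cis]
  constructor
  · intro h
    rw [h, mul_conj_of_norm_one (norm_cis t)]
  · intro h
    linear_combination cis t * h - cis s * mul_conj_of_norm_one (norm_cis t)

/-- `e^{2πik/40} ≠ 1` unless `40` divides `k`. -/
lemma cis_ne_one {t : ℝ} (k : ℤ) (ht : t = k * (Real.pi / 20)) (hk : ¬ (40 : ℤ) ∣ k) :
    cis t ≠ 1 := by
  rw [Ne, cis_eq_one_iff]
  rintro ⟨n, hn⟩
  apply hk
  refine ⟨n, ?_⟩
  rw [ht] at hn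
  have hpi := Real.pi_pos
  have : (k : ℝ) = 40 * n := by
    have h2 : ((k : ℝ) - 40 * n) * (Real.pi / 20) = 0 := by linear_combination hn
    rcases mul_eq_zero.mp h2 with h | h
    · linarith
    · exfalso; linarith
  exact_mod_cast this

lemma cis_ne_cis {s t : ℝ} (k : ℤ) (ht : s - t = k * (Real.pi / 20)) (hk : ¬ (40 : ℤ) ∣ k) :
    cis s ≠ cis t := by
  intro h
  obtain ⟨n, hn⟩ := (cis_eq_iff s t).mp h
  exact cis_ne_one k ht hk ((cis_eq_one_iff _).mpr ⟨n, hn⟩)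

lemma sqrt_five_bounds : 2.23606 < Real.sqrt 5 ∧ Real.sqrt 5 < 2.23607 := by
  constructor
  · exact Real.lt_sqrt_of_sq_lt (by norm_num)
  · rw [Real.sqrt_lt' (by norm_num)]; norm_num

lemma cos_two_pi_div_five : Real.cos (2 * Real.pi / 5) = (Real.sqrt 5 - 1) / 4 := by
  have h : 2 * Real.pi / 5 = 2 * (Real.pi / 5) := by ring
  have h5 : Real.sqrt 5 ^ 2 = 5 := Real.sq_sqrt (by norm_num)
  rw [h, Real.cos_two_mul, Real.cos_pi_div_five]
  linear_combination h5 / 8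

lemma cos_pi_div_five_bounds :
    0.809 < Real.cos (Real.pi / 5) ∧ Real.cos (Real.pi / 5) < 0.80902 := by
  rw [Real.cos_pi_div_five]
  obtain ⟨h1, h2⟩ := sqrt_five_bounds
  constructor <;> linarith

lemma cos_two_pi_div_five_bounds :
    0.309 < Real.cos (2 * Real.pi / 5) ∧ Real.cos (2 * Real.pi / 5) < 0.30902 := by
  rw [cos_two_pi_div_five]
  obtain ⟨h1, h2⟩ := sqrt_five_bounds
  constructor <;> linarith

lemma sin_pi_div_five_bounds :
    0.5877 < Real.sin (Real.pi / 5) ∧ Real.sin (Real.pi / 5) < 0.5879 := by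
  have hp : 0 < Real.sin (Real.pi / 5) :=
    Real.sin_pos_of_pos_of_lt_pi (by positivity) (by linarith [Real.pi_pos])
  have h := Real.sin_sq_add_cos_sq (Real.pi / 5)
  obtain ⟨h1, h2⟩ := cos_pi_div_five_bounds
  constructor <;> nlinarith

lemma sin_two_pi_div_five_bounds :
    0.951 < Real.sin (2 * Real.pi / 5) ∧ Real.sin (2 * Real.pi / 5) < 0.9511 := by
  have hp : 0 < Real.sin (2 * Real.pi / 5) :=
    Real.sin_pos_of_pos_of_lt_pi (by positivity) (by linarith [Real.pi_pos])
  have h := Real.sin_sq_add_cos_sq (2 * Real.pi / 5)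
  obtain ⟨h1, h2⟩ := cos_two_pi_div_five_bounds
  constructor <;> nlinarith

lemma cis_three_pi_div_two : cis (3 * Real.pi / 2) = -Complex.I := by
  have h : 3 * Real.pi / 2 = Real.pi + Real.pi / 2 := by ring
  rw [h]
  apply Complex.ext <;> simp [cis_re, cis_im, Real.cos_add, Real.sin_add]

lemma cis_pi : cis Real.pi = -1 := by
  apply Complex.ext <;> simp [cis_re, cis_im]

lemma cos_six_pi_div_five : Real.cos (6 * Real.pi / 5) = -Real.cos (Real.pi / 5) := by
  rw [show 6 * Real.pi / 5 = Real.pi / 5 + Real.pi by ring, Real.cos_add_pi]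

lemma sin_six_pi_div_five : Real.sin (6 * Real.pi / 5) = -Real.sin (Real.pi / 5) := by
  rw [show 6 * Real.pi / 5 = Real.pi / 5 + Real.pi by ring, Real.sin_add_pi]

lemma cos_eight_pi_div_five : Real.cos (8 * Real.pi / 5) = Real.cos (2 * Real.pi / 5) := by
  rw [show 8 * Real.pi / 5 = 2 * Real.pi - 2 * Real.pi / 5 by ring, Real.cos_two_pi_sub]

lemma sin_eight_pi_div_five : Real.sin (8 * Real.pi / 5) = -Real.sin (2 * Real.pi / 5) := by
  rw [show 8 * Real.pi / 5 = 2 * Real.pi - 2 * Real.pi / 5 by ring, Real.sin_two_pi_sub]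

lemma cos_three_pi_div_ten : Real.cos (3 * Real.pi / 10) = Real.sin (Real.pi / 5) := by
  rw [show 3 * Real.pi / 10 = Real.pi / 2 - Real.pi / 5 by ring, Real.cos_pi_div_two_sub]

lemma sin_three_pi_div_ten : Real.sin (3 * Real.pi / 10) = Real.cos (Real.pi / 5) := by
  rw [show 3 * Real.pi / 10 = Real.pi / 2 - Real.pi / 5 by ring, Real.sin_pi_div_two_sub]

/-! ### The trace of a product of two elliptic elements -/

lemma IsFrame.parseval {a b p : Fin 3 → ℂ} (h : IsFrame a b p) (z : Fin 3 → ℂ) :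
    ‖herm z a‖ ^ 2 + ‖herm z b‖ ^ 2 - ‖herm z p‖ ^ 2 = (herm z z).re := by
  have e : herm z z = herm z a * herm a z + herm z b * herm b z - herm z p * herm p z := by
    conv_lhs => enter [1]; rw [h.expand z]
    rw [herm_sub_left, herm_add_left, herm_smul_left, herm_smul_left, herm_smul_left]
  rw [herm_mul_herm_swap, herm_mul_herm_swap, herm_mul_herm_swap] at e
  rw [e]
  norm_cast

lemma trace_rankOne_two (u v : Fin 3 → ℂ) :
    (rankOne u * rankOne v).trace = ((‖herm u v‖ ^ 2 : ℝ) : ℂ) := by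
  rw [trace_mul_rankOne, rankOne_mulVec, herm_smul_left, mul_comm, herm_mul_herm_swap]

lemma trace_mul_normalForm {A B : U21} {μ ν κ l : ℂ} {a a' p b b' q : Fin 3 → ℂ}
    (hA : IsNormalForm A μ ν a a' p) (hB : IsNormalForm B κ l b b' q) :
    (mat (A * B)).trace = μ + ν + κ + l - 1 +
      ((μ - 1) * (κ - 1) * (‖herm a b‖ ^ 2 : ℝ) + (μ - 1) * (l - 1) * (‖herm a b'‖ ^ 2 : ℝ) +
        (ν - 1) * (κ - 1) * (‖herm a' b‖ ^ 2 : ℝ) + (ν - 1) * (l - 1) * (‖herm a' b'‖ ^ 2 : ℝ)) := by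
  rw [mat_mul, hA.mat_eq, hB.mat_eq]
  simp only [ellMatrix, Matrix.mul_add, Matrix.add_mul, Matrix.mul_one, Matrix.one_mul,
    Matrix.mul_smul, Matrix.smul_mul, trace_add, trace_smul, trace_rankOne_two, trace_rankOne,
    hA.frame.aa, hA.frame.bb, hB.frame.aa, hB.frame.bb, smul_eq_mul, trace_one]
  simp
  ring

lemma re_mul_ofReal' (z w : ℂ) (s : ℝ) : (z * w * (s : ℂ)).re = (z.re * w.re - z.im * w.im) * s := by
  rw [Complex.re_mul_ofReal, Complex.mul_re]

/-- This rules out the nontrivial cube roots of unity in `exists_triple`. By Parseval, the matrix of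
squared moduli of the products between the positive eigenvectors of A and those of B has row and
column sums at least 1, because the negative eigenvectors only add to them. -/
lemma re_trace_mul_pos {A B : U21} {a a' p b b' q : Fin 3 → ℂ}
    (hA : IsNormalForm A (cis (3 * Real.pi / 2)) (cis Real.pi) a a' p)
    (hB : IsNormalForm B (cis (6 * Real.pi / 5)) (cis (2 * Real.pi / 5)) b b' q) :
    0 < (mat (A * B)).trace.re := by
  rw [trace_mul_normalForm hA hB]
  have r1 := hB.frame.parseval a
  have r2 := hB.frame.parseval a'
  have c1 := hA.frame.parseval b
  have c2 := hA.frame.parseval b'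
  rw [hA.frame.aa, Complex.one_re] at r1
  rw [hA.frame.bb, Complex.one_re] at r2
  rw [hB.frame.aa, Complex.one_re, norm_herm_comm b a, norm_herm_comm b a'] at c1
  rw [hB.frame.bb, Complex.one_re, norm_herm_comm b' a, norm_herm_comm b' a'] at c2
  have hq1 := sq_nonneg ‖herm a q‖
  have hq2 := sq_nonneg ‖herm a' q‖
  have hp1 := sq_nonneg ‖herm b p‖
  have hp2 := sq_nonneg ‖herm b' p‖
  have h11 := sq_nonneg ‖herm a b‖
  have h12 := sq_nonneg ‖herm a b'‖
  have h21 := sq_nonneg ‖herm a' b‖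
  have h22 := sq_nonneg ‖herm a' b'‖
  rw [cis_three_pi_div_two, cis_pi]
  simp only [Complex.add_re, Complex.sub_re, re_mul_ofReal', cis_re, cis_im, Complex.neg_re,
    Complex.sub_im, Complex.I_re, Complex.I_im, Complex.neg_im, Complex.one_re, Complex.one_im,
    cos_six_pi_div_five, sin_six_pi_div_five]
  obtain ⟨u1, u2⟩ := cos_pi_div_five_bounds
  obtain ⟨v1, v2⟩ := cos_two_pi_div_five_bounds
  obtain ⟨w1, w2⟩ := sin_pi_div_five_bounds
  obtain ⟨y1, y2⟩ := sin_two_pi_div_five_bounds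
  set S11 := ‖herm a b‖ ^ 2
  set S12 := ‖herm a b'‖ ^ 2
  set S21 := ‖herm a' b‖ ^ 2
  set S22 := ‖herm a' b'‖ ^ 2
  generalize Real.cos (Real.pi / 5) = x1 at *
  generalize Real.cos (2 * Real.pi / 5) = x2 at *
  generalize Real.sin (Real.pi / 5) = x3 at *
  generalize Real.sin (2 * Real.pi / 5) = x4 at *
  -- The real part is -5/2 plus a combination of the four squares with coefficients at least 1.22,
  -- 1.64, 3.6, 1.38. Under the row and column constraints the minimum of that combination is 1.22 +
  -- 1.38 = 2.6, attained at the identity matrix.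
  have k11 := mul_nonneg h11 (by linarith :
    0 ≤ x1 + 1 - x3 - 1.22)
  have k12 := mul_nonneg h12 (by linarith :
    0 ≤ 1 - x2 + x4 - 1.64)
  have k21 := mul_nonneg h21 (by linarith : 0 ≤ 2 * (x1 + 1) - 3.6)
  have k22 := mul_nonneg h22 (by linarith : 0 ≤ 2 * (1 - x2) - 1.38)
  ring_nf at k11 k12 k21 k22 ⊢
  linarith

/-- A primitive cube root of unity has real part -1/2 and imaginary part of modulus below 1, so
Re(lt) < -0.75 + 0.5 < 0. -/
lemma eq_one_of_cube_eq_one {l : ℂ} (hl : l ^ 3 = 1) {t : ℂ} (ht : 1.5 < t.re)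
    (ht' : |t.im| < 0.5) (h : 0 < (l * t).re) : l = 1 := by
  have h1 : (l - 1) * (l ^ 2 + l + 1) = 0 := by linear_combination hl
  rcases mul_eq_zero.mp h1 with h2 | h2
  · exact sub_eq_zero.mp h2
  · exfalso
    have hr := congrArg Complex.re h2
    have hi := congrArg Complex.im h2
    simp [pow_two] at hr hi
    have hi' : l.im * (2 * l.re + 1) = 0 := by linarith
    have him : l.im ≠ 0 := by
      intro h0
      rw [h0] at hr
      nlinarith [sq_nonneg (l.re + 1 / 2)]
    have hre : l.re = -1 / 2 := by
      rcases mul_eq_zero.mp hi' with h0 | h0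
      · exact absurd h0 him
      · linarith
    rw [hre] at hr
    have him2 : l.im ^ 2 < 1 ^ 2 := by nlinarith
    have hab := abs_lt_of_sq_lt_sq him2 (by norm_num)
    rw [Complex.mul_re, hre] at h
    have h3 : |l.im * t.im| < 1 * 0.5 := by
      rw [abs_mul]
      nlinarith [abs_nonneg l.im, abs_nonneg t.im]
    have := abs_lt.mp h3
    linarith [this.1]

/-! ### Normalized lifts of representations -/

/-- A normalized lift to `U(2,1)` of the images of `a`, `b`, `c`, together with eigenbases: the
negative eigenvectors have eigenvalue `1`, and the product of the lifts is the identity. -/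
structure Triple where
  A : U21
  B : U21
  C : U21
  a₁ : Fin 3 → ℂ
  a₂ : Fin 3 → ℂ
  p : Fin 3 → ℂ
  b₁ : Fin 3 → ℂ
  b₂ : Fin 3 → ℂ
  q : Fin 3 → ℂ
  c₁ : Fin 3 → ℂ
  c₂ : Fin 3 → ℂ
  r : Fin 3 → ℂ
  hA : IsNormalForm A (cis (3 * Real.pi / 2)) (cis Real.pi) a₁ a₂ p
  hB : IsNormalForm B (cis (6 * Real.pi / 5)) (cis (2 * Real.pi / 5)) b₁ b₂ q
  hC : IsNormalForm C (cis (8 * Real.pi / 5)) (cis (3 * Real.pi / 10)) c₁ c₂ r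
  mul_eq : A * B * C = 1

/-- The triple `T` lifts the representation `ρ`. -/
def Triple.Lifts (T : Triple) (ρ : Rep 4 5 20) : Prop :=
  toPU T.A = ρ (gen 0) ∧ toPU T.B = ρ (gen 1) ∧ toPU T.C = ρ (gen 2)

lemma gen_mul_gen_mul_gen (p q r : ℕ) :
    (gen 0 * gen 1 * gen 2 : TriangleGroup p q r) = 1 := by
  have h : PresentedGroup.mk (triangleRels p q r)
      (FreeGroup.of 0 * FreeGroup.of 1 * FreeGroup.of 2) = 1 :=
    PresentedGroup.one_of_mem (by simp [triangleRels])
  simpa [gen, PresentedGroup.of] using h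

lemma Triple.Lifts.mem {T : Triple} {ρ : Rep 4 5 20} (h : T.Lifts ρ) : ρ ∈ reps4520 := by
  obtain ⟨h0, h1, h2⟩ := h
  refine ⟨?_, ?_, ?_⟩
  · rw [← h0]; exact IsNormalForm.hasAnglePair T.hA
  · rw [← h1]; exact IsNormalForm.hasAnglePair T.hB
  · rw [← h2]; exact IsNormalForm.hasAnglePair T.hC

/-- The relation abc = 1 lifts only up to a scalar l. The determinants give l³ = 1, and tr(AB)
equals l times the conjugate of tr C, a number close to the positive real axis, so
`re_trace_mul_pos` leaves only l = 1. -/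
theorem exists_triple {ρ : Rep 4 5 20} (h : ρ ∈ reps4520) : ∃ T : Triple, T.Lifts ρ := by
  obtain ⟨h0, h1, h2⟩ := h
  obtain ⟨A, a₁, a₂, p, eA, hA⟩ := exists_normalForm_of_hasAnglePair h0
  obtain ⟨B, b₁, b₂, q, eB, hB⟩ := exists_normalForm_of_hasAnglePair h1
  obtain ⟨C, c₁, c₂, r, eC, hC⟩ := exists_normalForm_of_hasAnglePair h2
  change IsNormalForm A (cis (3 * Real.pi / 2)) (cis Real.pi) a₁ a₂ p at hA
  change IsNormalForm B (cis (6 * Real.pi / 5)) (cis (2 * Real.pi / 5)) b₁ b₂ q at hB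
  change IsNormalForm C (cis (8 * Real.pi / 5)) (cis (3 * Real.pi / 10)) c₁ c₂ r at hC
  have e1 : toPU (A * B * C) = toPU 1 := by
    rw [map_mul, map_mul, eA, eB, eC, ← map_mul, ← map_mul, gen_mul_gen_mul_gen, map_one, map_one]
  obtain ⟨l, hl, hm⟩ := (toPU_eq_iff _ _).mp e1
  have hdet : l ^ 3 = 1 := by
    have := congrArg det hm
    rw [mat_mul, mat_mul, det_mul, det_mul, hA.det, hB.det, hC.det, mat_one, det_smul, det_one,
      ← cis_add, ← cis_add, ← cis_add, ← cis_add, ← cis_add] at this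
    -- The six prescribed angles sum to 6π, that is to three full turns.
    have h6 : cis (3 * Real.pi / 2 + Real.pi + (6 * Real.pi / 5 + 2 * Real.pi / 5) +
        (8 * Real.pi / 5 + 3 * Real.pi / 10)) = 1 := by
      rw [← cis_int_two_pi 3]
      congr 1
      push_cast
      ring
    rw [h6] at this
    simpa using this.symm
  have htr : (mat (A * B)).trace = l * (starRingEnd ℂ) (mat C).trace := by
    have : mat (A * B) = l • adj (mat C) := by
      calc mat (A * B) = mat (A * B * C) * adj (mat C) := by
            rw [mat_mul (A * B), Matrix.mul_assoc, mat_mul_adj_mat, Matrix.mul_one]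
        _ = _ := by rw [hm, mat_one, Matrix.smul_mul, Matrix.one_mul]
    rw [this, trace_smul, trace_adj, smul_eq_mul]
  have hpos := re_trace_mul_pos hA hB
  have hl1 : l = 1 := by
    rw [htr] at hpos
    obtain ⟨u1, u2⟩ := cos_pi_div_five_bounds
    obtain ⟨v1, v2⟩ := cos_two_pi_div_five_bounds
    obtain ⟨w1, w2⟩ := sin_pi_div_five_bounds
    obtain ⟨y1, y2⟩ := sin_two_pi_div_five_bounds
    refine eq_one_of_cube_eq_one hdet ?_ ?_ hpos
    · rw [hC.trace]
      simp only [Complex.conj_re, Complex.add_re, cis_re, Complex.one_re, cos_eight_pi_div_five,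
        cos_three_pi_div_ten]
      linarith
    · rw [hC.trace, abs_lt]
      simp only [Complex.conj_im, Complex.add_im, cis_im, Complex.one_im, sin_eight_pi_div_five,
        sin_three_pi_div_ten]
      constructor <;> linarith
  subst hl1
  have hABC : A * B * C = 1 := mat_injective (by simpa using hm)
  exact ⟨⟨A, B, C, a₁, a₂, p, b₁, b₂, q, c₁, c₂, r, hA, hB, hC, hABC⟩, eA, eB, eC⟩

/-! ### Common eigenvectors -/

lemma fixesLine_toPU {g : U21} {z : Fin 3 → ℂ} :
    FixesLine (toPU g) z ↔ z ≠ 0 ∧ ∃ l : ℂ, mat g *ᵥ z = l • z := by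
  constructor
  · rintro ⟨hz, M, hM, l, hl⟩
    refine ⟨hz, ?_⟩
    obtain ⟨s, -, hs⟩ := (toPU_eq_iff g M).mp hM.symm
    exact ⟨s * l, by rw [hs, smul_mulVec, hl, smul_smul]⟩
  · rintro ⟨hz, l, hl⟩
    exact ⟨hz, g, rfl, l, hl⟩

lemma IsNegative.ne_zero {z : Fin 3 → ℂ} (hz : IsNegative z) : z ≠ 0 := by
  rintro rfl
  simp [IsNegative] at hz

lemma herm_smul_self (s : ℂ) (z : Fin 3 → ℂ) :
    (herm (s • z) (s • z)).re = ‖s‖ ^ 2 * (herm z z).re := by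
  rw [herm_smul_left, herm_smul_right, ← mul_assoc, Complex.mul_conj,
    Complex.normSq_eq_norm_sq, Complex.re_ofReal_mul]

lemma IsNormalForm.eigenvector_type {g : U21} {μ ν : ℂ} {a b p : Fin 3 → ℂ}
    (h : IsNormalForm g μ ν a b p) (hμν : μ ≠ ν) (hμ : μ ≠ 1) (hν : ν ≠ 1) {z : Fin 3 → ℂ}
    (hz : z ≠ 0) {l : ℂ} (hl : mat g *ᵥ z = l • z) :
    (0 < (herm z z).re ∧ (l = μ ∨ l = ν)) ∨
      (IsNegative z ∧ l = 1 ∧ z = -herm z p • p) := by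
  have hpos : ∀ (s : ℂ) (v : Fin 3 → ℂ), herm v v = 1 → z = s • v → 0 < (herm z z).re := by
    intro s v hv e
    have hs : s ≠ 0 := by
      rintro rfl
      exact hz (by simpa using e)
    rw [e, herm_smul_self, hv]
    have := norm_pos_iff.mpr hs
    simp
    positivity
  rcases h.eigenvector hμν hμ hν hz hl with ⟨h1, h2⟩ | ⟨h1, h2⟩ | ⟨h1, h2⟩
  · exact Or.inl ⟨hpos _ _ h.frame.aa h2, Or.inl h1⟩
  · exact Or.inl ⟨hpos _ _ h.frame.bb h2, Or.inr h1⟩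
  · refine Or.inr ⟨?_, h1, h2⟩
    have hs : -herm z p ≠ 0 := by
      intro e
      rw [e] at h2
      exact hz (by simpa using h2)
    unfold IsNegative
    rw [h2, herm_smul_self, h.frame.pp]
    have := norm_pos_iff.mpr hs
    have : 0 < ‖-herm z p‖ ^ 2 := by positivity
    simp only [Complex.neg_re, Complex.one_re]
    linarith

lemma mulVec_inv_of_eigen {g : U21} {z : Fin 3 → ℂ} (hz : z ≠ 0) {l : ℂ}
    (h : mat g *ᵥ z = l • z) : l ≠ 0 ∧ mat g⁻¹ *ᵥ z = l⁻¹ • z := by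
  have hl : l ≠ 0 := by
    rintro rfl
    rw [zero_smul] at h
    exact hz (mat_mulVec_injective g (h.trans (mulVec_zero _).symm))
  refine ⟨hl, ?_⟩
  have := mat_inv_mulVec_eq h
  rw [mulVec_smul] at this
  rw [← this, smul_smul, inv_mul_cancel₀ hl, one_smul, this]

lemma Triple.eigA (T : Triple) {z : Fin 3 → ℂ} (hz : z ≠ 0) {l : ℂ}
    (hl : mat T.A *ᵥ z = l • z) :
    (0 < (herm z z).re ∧ (l = cis (3 * Real.pi / 2) ∨ l = cis Real.pi)) ∨
      (IsNegative z ∧ l = 1 ∧ z = -herm z T.p • T.p) :=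
  T.hA.eigenvector_type (cis_ne_cis 10 (by push_cast; ring) (by norm_num))
    (cis_ne_one 30 (by push_cast; ring) (by norm_num))
    (cis_ne_one 20 (by push_cast; ring) (by norm_num)) hz hl

lemma Triple.eigB (T : Triple) {z : Fin 3 → ℂ} (hz : z ≠ 0) {l : ℂ}
    (hl : mat T.B *ᵥ z = l • z) :
    (0 < (herm z z).re ∧ (l = cis (6 * Real.pi / 5) ∨ l = cis (2 * Real.pi / 5))) ∨
      (IsNegative z ∧ l = 1 ∧ z = -herm z T.q • T.q) :=
  T.hB.eigenvector_type (cis_ne_cis 16 (by push_cast; ring) (by norm_num))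
    (cis_ne_one 24 (by push_cast; ring) (by norm_num))
    (cis_ne_one 8 (by push_cast; ring) (by norm_num)) hz hl

lemma Triple.eigC (T : Triple) {z : Fin 3 → ℂ} (hz : z ≠ 0) {l : ℂ}
    (hl : mat T.C *ᵥ z = l • z) :
    (0 < (herm z z).re ∧ (l = cis (8 * Real.pi / 5) ∨ l = cis (3 * Real.pi / 10))) ∨
      (IsNegative z ∧ l = 1 ∧ z = -herm z T.r • T.r) :=
  T.hC.eigenvector_type (cis_ne_cis 26 (by push_cast; ring) (by norm_num))
    (cis_ne_one 32 (by push_cast; ring) (by norm_num))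
    (cis_ne_one 6 (by push_cast; ring) (by norm_num)) hz hl

/-- The type of z is the same for the three lifts. If z is positive, the three eigenvalues are of
positive type and have product 1, which the angles forbid. -/
lemma Triple.common_eigenvector (T : Triple) {z : Fin 3 → ℂ} (hz : z ≠ 0) {k l m : ℂ}
    (hA : mat T.A *ᵥ z = k • z) (hB : mat T.B *ᵥ z = l • z) (hC : mat T.C *ᵥ z = m • z) :
    IsNegative z ∧ k = 1 ∧ l = 1 ∧ m = 1 := by
  have hprod : k * l * m = 1 := by
    have h : mat (T.A * T.B * T.C) *ᵥ z = (k * l * m) • z := by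
      rw [mat_mul, mat_mul, ← mulVec_mulVec, ← mulVec_mulVec, hC, mulVec_smul, mulVec_smul, hB,
        mulVec_smul, hA, smul_smul, smul_smul]
      ring_nf
    rw [T.mul_eq, mat_one, one_mulVec] at h
    have h2 : (k * l * m - 1) • z = 0 := by rw [sub_smul, one_smul, ← h, sub_self]
    exact sub_eq_zero.mp ((smul_eq_zero.mp h2).resolve_right hz)
  have hcontra : 0 < (herm z z).re → ¬ IsNegative z := fun h1 h2 => by
    unfold IsNegative at h2
    linarith
  rcases T.eigA hz hA with ⟨pA, hk⟩ | ⟨nA, hk, -⟩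
  · rcases T.eigB hz hB with ⟨-, hl⟩ | ⟨nB, -, -⟩
    · rcases T.eigC hz hC with ⟨-, hm⟩ | ⟨nC, -, -⟩
      · exfalso
        rcases hk with rfl | rfl <;> rcases hl with rfl | rfl <;> rcases hm with rfl | rfl <;>
          rw [← cis_add, ← cis_add] at hprod
        -- In units of π/20 the positive-type angles are 30, 20 for A, 24, 8 for B and 32, 6 for C;
        -- none of the eight sums is a multiple of 40.
        · exact cis_ne_one 86 (by push_cast; ring) (by norm_num) hprod
        · exact cis_ne_one 60 (by push_cast; ring) (by norm_num) hprod
        · exact cis_ne_one 70 (by push_cast; ring) (by norm_num) hprod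
        · exact cis_ne_one 44 (by push_cast; ring) (by norm_num) hprod
        · exact cis_ne_one 76 (by push_cast; ring) (by norm_num) hprod
        · exact cis_ne_one 50 (by push_cast; ring) (by norm_num) hprod
        · exact cis_ne_one 60 (by push_cast; ring) (by norm_num) hprod
        · exact cis_ne_one 34 (by push_cast; ring) (by norm_num) hprod
      · exact absurd nC (hcontra pA)
    · exact absurd nB (hcontra pA)
  · rcases T.eigB hz hB with ⟨pB, -⟩ | ⟨-, hl, -⟩
    · exact absurd nA (hcontra pB)
    · rcases T.eigC hz hC with ⟨pC, -⟩ | ⟨-, hm, -⟩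
      · exact absurd nA (hcontra pC)
      · exact ⟨nA, hk, hl, hm⟩

/-- The three normalized lifts have a common negative fixed vector. -/
def Triple.Degenerate (T : Triple) : Prop :=
  ∃ z, IsNegative z ∧ mat T.A *ᵥ z = z ∧ mat T.B *ᵥ z = z ∧ mat T.C *ᵥ z = z

lemma Triple.C_eq (T : Triple) : T.C = T.B⁻¹ * T.A⁻¹ := by
  calc T.C = T.B⁻¹ * T.A⁻¹ * (T.A * T.B * T.C) := by group
    _ = T.B⁻¹ * T.A⁻¹ := by rw [T.mul_eq, mul_one]

lemma Triple.A_eq (T : Triple) : T.A = T.C⁻¹ * T.B⁻¹ := by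
  rw [T.C_eq]; group

lemma Triple.B_eq (T : Triple) : T.B = T.A⁻¹ * T.C⁻¹ := by
  rw [T.C_eq]; group

lemma Triple.degenerate_of_common (T : Triple) {z : Fin 3 → ℂ} (hz : z ≠ 0) {k l m : ℂ}
    (hA : mat T.A *ᵥ z = k • z) (hB : mat T.B *ᵥ z = l • z) (hC : mat T.C *ᵥ z = m • z) :
    T.Degenerate := by
  obtain ⟨hn, rfl, rfl, rfl⟩ := T.common_eigenvector hz hA hB hC
  exact ⟨z, hn, by simpa using hA, by simpa using hB, by simpa using hC⟩

lemma Triple.degenerate_of_AB (T : Triple) {z : Fin 3 → ℂ} (hz : z ≠ 0) {k l : ℂ}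
    (hA : mat T.A *ᵥ z = k • z) (hB : mat T.B *ᵥ z = l • z) : T.Degenerate := by
  refine T.degenerate_of_common hz hA hB (m := k⁻¹ * l⁻¹) ?_
  rw [T.C_eq, mat_mul, ← mulVec_mulVec, (mulVec_inv_of_eigen hz hA).2, mulVec_smul,
    (mulVec_inv_of_eigen hz hB).2, smul_smul]

lemma Triple.degenerate_of_BC (T : Triple) {z : Fin 3 → ℂ} (hz : z ≠ 0) {k l : ℂ}
    (hB : mat T.B *ᵥ z = k • z) (hC : mat T.C *ᵥ z = l • z) : T.Degenerate := by
  refine T.degenerate_of_common hz (k := k⁻¹ * l⁻¹) ?_ hB hC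
  rw [T.A_eq, mat_mul, ← mulVec_mulVec, (mulVec_inv_of_eigen hz hB).2, mulVec_smul,
    (mulVec_inv_of_eigen hz hC).2, smul_smul]

lemma Triple.degenerate_of_AC (T : Triple) {z : Fin 3 → ℂ} (hz : z ≠ 0) {k l : ℂ}
    (hA : mat T.A *ᵥ z = k • z) (hC : mat T.C *ᵥ z = l • z) : T.Degenerate := by
  refine T.degenerate_of_common hz hA (l := l⁻¹ * k⁻¹) ?_ hC
  rw [T.B_eq, mat_mul, ← mulVec_mulVec, (mulVec_inv_of_eigen hz hC).2, mulVec_smul,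
    (mulVec_inv_of_eigen hz hA).2, smul_smul]

/-- As ABC = 1, an eigenvector of two of the lifts is an eigenvector of the third, so the three
conditions of irreducibility all reduce to the absence of a common negative fixed vector. -/
lemma Triple.irreducible_iff (T : Triple) :
    IsIrreducibleTriple (toPU T.A) (toPU T.B) (toPU T.C) ↔ ¬ T.Degenerate := by
  simp only [IsIrreducibleTriple, fixesLine_toPU]
  constructor
  · rintro ⟨h, -, -⟩ ⟨z, hn, hA, hB, -⟩
    exact h ⟨z, ⟨hn.ne_zero, 1, by simpa using hA⟩, ⟨hn.ne_zero, 1, by simpa using hB⟩⟩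
  · intro h
    refine ⟨?_, ?_, ?_⟩
    · rintro ⟨z, ⟨hz, k, hk⟩, ⟨-, l, hl⟩⟩
      exact h (T.degenerate_of_AB hz hk hl)
    · rintro ⟨z, ⟨hz, k, hk⟩, ⟨-, l, hl⟩⟩
      exact h (T.degenerate_of_BC hz hk hl)
    · rintro ⟨z, ⟨hz, k, hk⟩, ⟨-, l, hl⟩⟩
      exact h (T.degenerate_of_AC hz hk hl)

lemma Triple.Lifts.irreducible_iff {T : Triple} {ρ : Rep 4 5 20} (h : T.Lifts ρ) :
    IsIrreducibleRep ρ ↔ ¬ T.Degenerate := by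
  rw [← T.irreducible_iff, h.1, h.2.1, h.2.2]
  rfl

lemma Triple.B_r_ne (T : Triple) (h : ¬ T.Degenerate) : mat T.B *ᵥ T.r ≠ T.r := fun e =>
  h (T.degenerate_of_BC T.hC.frame.ne_zero (k := 1) (l := 1) (by simpa using e)
    (by simpa using T.hC.apply_p))

lemma Triple.A_q_ne (T : Triple) (h : ¬ T.Degenerate) : mat T.A *ᵥ T.q ≠ T.q := fun e =>
  h (T.degenerate_of_AB T.hB.frame.ne_zero (k := 1) (l := 1) (by simpa using e)
    (by simpa using T.hB.apply_p))

lemma Triple.C_p_ne (T : Triple) (h : ¬ T.Degenerate) : mat T.C *ᵥ T.p ≠ T.p := fun e =>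
  h (T.degenerate_of_AC T.hA.frame.ne_zero (k := 1) (l := 1) (by simpa using T.hA.apply_p)
    (by simpa using e))

/-! ### Existence of spherical decompositions -/

/-- From XYZ = 1 and Zr = r comes Yr = X⁻¹r, so r and Yr have equal products with p (fixed by X) and
with q (fixed by Y). Hence w = Yr - r is orthogonal to p and q and polar to the line through them,
and a reflection along w carries r to Yr. -/
lemma exists_reflection {X Y Z : U21} (hXYZ : X * Y * Z = 1) {p q r : Fin 3 → ℂ}
    (hp : IsNegative p) (hXp : mat X *ᵥ p = p) (hYq : mat Y *ᵥ q = q) (hZr : mat Z *ᵥ r = r)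
    (hYr : mat Y *ᵥ r ≠ r) :
    ∃ (c : Fin 3 → ℂ) (η : ℂ), herm c c = 1 ∧ ‖η‖ = 1 ∧ η ≠ 1 ∧ herm p c = 0 ∧ herm q c = 0 ∧
      herm r c ≠ 0 ∧ reflMatrix c η *ᵥ r = mat Y *ᵥ r := by
  set w := mat Y *ᵥ r - r with hw
  have hw0 : w ≠ 0 := sub_ne_zero.mpr hYr
  have hXr : mat X⁻¹ *ᵥ r = mat Y *ᵥ r := by
    apply mat_inv_mulVec_eq
    calc mat X *ᵥ (mat Y *ᵥ r) = mat X *ᵥ (mat Y *ᵥ (mat Z *ᵥ r)) := by rw [hZr]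
      _ = mat (X * Y * Z) *ᵥ r := by
        rw [mat_mul, mat_mul, ← mulVec_mulVec, ← mulVec_mulVec]
      _ = r := by rw [hXYZ, mat_one, one_mulVec]
  have hwq : herm w q = 0 := by
    have := herm_mat Y r q
    rw [hYq] at this
    rw [hw, herm_sub_left, this, sub_self]
  have hwp : herm w p = 0 := by
    have := herm_mat X⁻¹ r p
    rw [mat_inv_mulVec_eq hXp, hXr] at this
    rw [hw, herm_sub_left, this, sub_self]
  obtain ⟨s, hs, hc⟩ := exists_normalize_pos (herm_self_pos_of_orthogonal hp hwp hw0)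
  have hrw : herm r w + herm w r + herm w w = 0 := by
    have e : mat Y *ᵥ r = r + w := by rw [hw]; abel
    have := herm_mat Y r r
    rw [e] at this
    simp only [herm_add_left, herm_add_right] at this
    linear_combination this
  have hww : s ^ 2 * herm w w = 1 := by
    rw [herm_smul_left, herm_smul_right, Complex.conj_ofReal] at hc
    linear_combination hc
  have hs0 : (s : ℂ) ≠ 0 := by exact_mod_cast hs.ne'
  have hrw0 : herm r w ≠ 0 := by
    intro h
    rw [h, herm_eq_zero_symm h] at hrw
    rw [zero_add, zero_add] at hrw
    rw [hrw] at hww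
    simp at hww
  -- The requirement that r be sent to r + w dictates this rotation factor. It has modulus 1 because
  -- ⟨Yr, Yr⟩ = ⟨r, r⟩ rewrites it as minus a quotient of conjugate numbers.
  have hη : 1 + herm w w / herm r w = -(herm w r / herm r w) := by
    field_simp
    linear_combination hrw
  refine ⟨(s : ℂ) • w, 1 + herm w w / herm r w, hc, ?_, ?_, ?_, ?_, ?_, ?_⟩
  · rw [hη, norm_neg, norm_div, norm_herm_comm w r, div_self]
    rwa [norm_ne_zero_iff]
  · intro h
    have h1 : herm w w / herm r w = 0 := by linear_combination h
    rcases div_eq_zero_iff.mp h1 with h2 | h2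
    · rw [h2] at hww; simp at hww
    · exact hrw0 h2
  · rw [herm_smul_right, herm_eq_zero_symm hwp, mul_zero]
  · rw [herm_smul_right, herm_eq_zero_symm hwq, mul_zero]
  · rw [herm_smul_right, Complex.conj_ofReal]
    exact mul_ne_zero hs0 hrw0
  · rw [reflMatrix_mulVec, smul_smul, herm_smul_right, Complex.conj_ofReal]
    have : (1 + herm w w / herm r w - 1) * (s * herm r w) * s = 1 := by
      field_simp
      linear_combination hww
    rw [this, one_smul, hw]
    abel

/-- The pairing matrix of p, q, r against c₂, c₀, c₁ is diagonal with nonzero entries. -/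
lemma colMatrix_det_ne_zero {p q r c₀ c₁ c₂ : Fin 3 → ℂ} (hp0 : herm p c₀ = 0)
    (hp1 : herm p c₁ = 0) (hq1 : herm q c₁ = 0) (hq2 : herm q c₂ = 0) (hr2 : herm r c₂ = 0)
    (hr0 : herm r c₀ = 0) (hp : herm p c₂ ≠ 0) (hq : herm q c₀ ≠ 0) (hr : herm r c₁ ≠ 0) :
    (colMatrix p q r).det ≠ 0 := by
  intro h
  obtain ⟨v, hv, he⟩ := exists_mulVec_eq_zero_iff.mpr h
  rw [colMatrix_mulVec] at he
  apply hv
  have h0 := congrArg (fun z => herm z c₀) he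
  have h1 := congrArg (fun z => herm z c₁) he
  have h2 := congrArg (fun z => herm z c₂) he
  simp only [herm_add_left, herm_smul_left, hp0, hp1, hq1, hq2, hr2, hr0, herm_zero_left,
    mul_zero, zero_add, add_zero] at h0 h1 h2
  funext i
  fin_cases i
  · exact (mul_eq_zero.mp h2).resolve_right hp
  · exact (mul_eq_zero.mp h0).resolve_right hq
  · exact (mul_eq_zero.mp h1).resolve_right hr

lemma eq_of_agree {p q r : Fin 3 → ℂ} (h : (colMatrix p q r).det ≠ 0)
    {M N : Matrix (Fin 3) (Fin 3) ℂ} (hp : M *ᵥ p = N *ᵥ p) (hq : M *ᵥ q = N *ᵥ q)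
    (hr : M *ᵥ r = N *ᵥ r) : M = N := by
  have e : M * colMatrix p q r = N * colMatrix p q r := by
    apply ext_mulVec
    intro z
    simp only [← mulVec_mulVec, colMatrix_mulVec, mulVec_add, mulVec_smul, hp, hq, hr]
  have := congrArg (fun X => X * (colMatrix p q r)⁻¹) e
  simpa [Matrix.mul_assoc, Matrix.mul_nonsing_inv _ (isUnit_iff_ne_zero.mpr h)] using this

/-- The vectors q and r act as dual vectors, each killing one of c, d and not the other, which gives
independence. -/
lemma linesIntersect_of {c d p q r : Fin 3 → ℂ} (hp : IsNegative p) (hpc : herm p c = 0)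
    (hpd : herm p d = 0) (hqc : herm q c ≠ 0) (hqd : herm q d = 0) (hrd : herm r d ≠ 0)
    (hrc : herm r c = 0) : LinesIntersect c d := by
  refine ⟨?_, p, hp, hpc, hpd⟩
  rw [LinearIndependent.pair_iff]
  intro s t h
  have h0 := congrArg (fun z => herm z q) h
  have h1 := congrArg (fun z => herm z r) h
  simp only [herm_add_left, herm_smul_left, herm_eq_zero_symm hqd, herm_eq_zero_symm hrc,
    herm_zero_left, mul_zero, zero_add, add_zero] at h0 h1
  exact ⟨(mul_eq_zero.mp h0).resolve_right fun e => hqc (herm_eq_zero_symm e),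
    (mul_eq_zero.mp h1).resolve_right fun e => hrd (herm_eq_zero_symm e)⟩

lemma LinesIntersect.symm {c d : Fin 3 → ℂ} (h : LinesIntersect c d) : LinesIntersect d c := by
  obtain ⟨hl, p, hp, hc, hd⟩ := h
  refine ⟨?_, p, hp, hd, hc⟩
  rw [LinearIndependent.pair_iff] at hl ⊢
  intro s t e
  have := hl t s (by rw [add_comm]; exact e)
  exact ⟨this.2, this.1⟩

lemma linesIntersect_pairwise {c : Fin 3 → Fin 3 → ℂ} (h01 : LinesIntersect (c 0) (c 1))
    (h12 : LinesIntersect (c 1) (c 2)) (h20 : LinesIntersect (c 2) (c 0)) :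
    ∀ j k, j ≠ k → LinesIntersect (c j) (c k) := by
  intro j k hjk
  fin_cases j <;> fin_cases k
  · exact absurd rfl hjk
  · exact h01
  · exact h20.symm
  · exact h01.symm
  · exact absurd rfl hjk
  · exact h12
  · exact h20
  · exact h12.symm
  · exact absurd rfl hjk

lemma isComplexReflection_refl {c : Fin 3 → ℂ} {η : ℂ} (hc : herm c c = 1) (hη : ‖η‖ = 1)
    (h1 : η ≠ 1) : IsComplexReflection (toPU (refl c η hc hη)) c η :=
  ⟨hc, hη, h1, _, rfl, fun z => reflMatrix_mulVec c η z⟩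

lemma reflMatrix_mulVec_of_orthogonal {c : Fin 3 → ℂ} {η : ℂ} {z : Fin 3 → ℂ}
    (h : herm z c = 0) : reflMatrix c η *ᵥ z = z := by
  rw [reflMatrix_mulVec, h]
  simp

/-- The mirrors are the sides of the triangle of fixed points p, q, r. Each identity, such as A =
R₁R₂⁻¹, needs checking only on p, q, r, which form a basis. -/
theorem Triple.exists_decomposition (T : Triple) (h : ¬ T.Degenerate) :
    ∃ c η, IsSphericalDecomposition (toPU T.A) (toPU T.B) (toPU T.C) c η := by
  have hBCA : T.B * T.C * T.A = 1 := by rw [T.C_eq]; group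
  have hCAB : T.C * T.A * T.B = 1 := by rw [T.C_eq]; group
  have hAp := T.hA.apply_p
  have hBq := T.hB.apply_p
  have hCr := T.hC.apply_p
  -- The same lemma serves the three cyclic rotations of ABC = 1: c0 is polar to the line through p
  -- and r, c1 to the line through p and q, c2 to the line through q and r.
  obtain ⟨c0, η0, hc0, hη0, h10, hr0, hp0, hq0, e0⟩ :=
    exists_reflection hCAB T.hC.frame.isNegative hCr hAp hBq (T.A_q_ne h)
  obtain ⟨c1, η1, hc1, hη1, h11, hp1, hq1, hr1, e1⟩ :=
    exists_reflection T.mul_eq T.hA.frame.isNegative hAp hBq hCr (T.B_r_ne h)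
  obtain ⟨c2, η2, hc2, hη2, h12, hq2, hr2, hp2, e2⟩ :=
    exists_reflection hBCA T.hB.frame.isNegative hBq hCr hAp (T.C_p_ne h)
  have hdet := colMatrix_det_ne_zero hp0 hp1 hq1 hq2 hr2 hr0 hp2 hq0 hr1
  have hABr : mat T.A *ᵥ (mat T.B *ᵥ T.r) = T.r := by
    conv_lhs => rw [← hCr]
    rw [mulVec_mulVec, mulVec_mulVec, ← mat_mul, ← mat_mul, T.mul_eq, mat_one,
      one_mulVec]
  have hBCp : mat T.B *ᵥ (mat T.C *ᵥ T.p) = T.p := by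
    conv_lhs => rw [← hAp]
    rw [mulVec_mulVec, mulVec_mulVec, ← mat_mul, ← mat_mul, hBCA, mat_one,
      one_mulVec]
  have hCAq : mat T.C *ᵥ (mat T.A *ᵥ T.q) = T.q := by
    conv_lhs => rw [← hBq]
    rw [mulVec_mulVec, mulVec_mulVec, ← mat_mul, ← mat_mul, hCAB, mat_one,
      one_mulVec]
  refine ⟨![c0, c1, c2], ![η0, η1, η2], linesIntersect_pairwise ?_ ?_ ?_,
    ![toPU (refl c0 η0 hc0 hη0), toPU (refl c1 η1 hc1 hη1), toPU (refl c2 η2 hc2 hη2)], ?_, ?_, ?_,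
    ?_⟩
  · exact linesIntersect_of T.hA.frame.isNegative hp0 hp1 hq0 hq1 hr1 hr0
  · exact linesIntersect_of T.hB.frame.isNegative hq1 hq2 hr1 hr2 hp2 hp1
  · exact linesIntersect_of T.hC.frame.isNegative hr2 hr0 hp2 hp0 hq0 hq2
  · intro k
    fin_cases k
    exacts [isComplexReflection_refl hc0 hη0 h10, isComplexReflection_refl hc1 hη1 h11,
      isComplexReflection_refl hc2 hη2 h12]
  · change toPU T.A = toPU _ * (toPU _)⁻¹
    rw [← map_inv, ← map_mul]
    congr 1
    -- With the inverse moved to the left, both sides fix p, both send q to Aq, and both fix r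
    -- because ABr = r.
    rw [eq_mul_inv_iff_mul_eq]
    apply mat_injective
    apply eq_of_agree hdet <;>
      simp only [mat_mul, ← mulVec_mulVec, refl, mat_ofIsometry,
        reflMatrix_mulVec_of_orthogonal hp1, reflMatrix_mulVec_of_orthogonal hp0,
        reflMatrix_mulVec_of_orthogonal hq1, reflMatrix_mulVec_of_orthogonal hr0, e0, e1, hAp, hABr]
  · change toPU T.B = toPU _ * (toPU _)⁻¹
    rw [← map_inv, ← map_mul]
    congr 1
    rw [eq_mul_inv_iff_mul_eq]
    apply mat_injective
    apply eq_of_agree hdet <;>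
      simp only [mat_mul, ← mulVec_mulVec, refl, mat_ofIsometry,
        reflMatrix_mulVec_of_orthogonal hp1, reflMatrix_mulVec_of_orthogonal hq2,
        reflMatrix_mulVec_of_orthogonal hq1, reflMatrix_mulVec_of_orthogonal hr2, e2, e1, hBq, hBCp]
  · change toPU T.C = toPU _ * (toPU _)⁻¹
    rw [← map_inv, ← map_mul]
    congr 1
    rw [eq_mul_inv_iff_mul_eq]
    apply mat_injective
    apply eq_of_agree hdet <;>
      simp only [mat_mul, ← mulVec_mulVec, refl, mat_ofIsometry,
        reflMatrix_mulVec_of_orthogonal hp0, reflMatrix_mulVec_of_orthogonal hq2,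
        reflMatrix_mulVec_of_orthogonal hr0, reflMatrix_mulVec_of_orthogonal hr2, e2, e0, hCr, hCAq]

lemma Triple.isSphericalDecomposable (T : Triple) (h : ¬ T.Degenerate) :
    IsSphericalDecomposable (toPU T.A) (toPU T.B) (toPU T.C) := by
  have hpi := Real.pi_pos
  refine ⟨⟨(3 * Real.pi / 2, Real.pi), ?_, ?_, ?_, IsNormalForm.hasAnglePair T.hA⟩,
    ⟨(6 * Real.pi / 5, 2 * Real.pi / 5), ?_, ?_, ?_, IsNormalForm.hasAnglePair T.hB⟩,
    ⟨(8 * Real.pi / 5, 3 * Real.pi / 10), ?_, ?_, ?_, IsNormalForm.hasAnglePair T.hC⟩, ?_,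
    T.exists_decomposition h⟩
  any_goals dsimp only; linarith
  rw [← map_mul, ← map_mul, T.mul_eq, map_one]

/-! ### The structure of spherical decompositions -/

/-- Polar vectors `c` and rotation factors `η` that decompose the normalized lifts themselves. -/
structure Triple.Dec (T : Triple) (c : Fin 3 → Fin 3 → ℂ) (η : Fin 3 → ℂ) : Prop where
  unit : ∀ k, herm (c k) (c k) = 1
  norm_one : ∀ k, ‖η k‖ = 1
  ne_one : ∀ k, η k ≠ 1
  A_eq : mat T.A = reflMatrix (c 0) (η 0) * reflMatrix (c 1) ((starRingEnd ℂ) (η 1))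
  B_eq : mat T.B = reflMatrix (c 1) (η 1) * reflMatrix (c 2) ((starRingEnd ℂ) (η 2))
  C_eq : mat T.C = reflMatrix (c 2) (η 2) * reflMatrix (c 0) ((starRingEnd ℂ) (η 0))
  p0 : herm T.p (c 0) = 0
  p1 : herm T.p (c 1) = 0
  q1 : herm T.q (c 1) = 0
  q2 : herm T.q (c 2) = 0
  r2 : herm T.r (c 2) = 0
  r0 : herm T.r (c 0) = 0

lemma adj_reflMatrix {c : Fin 3 → ℂ} {η : ℂ} (hc : herm c c = 1) (hη : ‖η‖ = 1) :
    adj (reflMatrix c η) = reflMatrix c ((starRingEnd ℂ) η) := by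
  have h1 : adj (reflMatrix c η) * reflMatrix c η = 1 :=
    adj_mul_self_of_isometry (reflMatrix_isometry hc hη)
  have h2 : reflMatrix c η * reflMatrix c ((starRingEnd ℂ) η) = 1 := by
    apply ext_mulVec
    intro z
    rw [← mulVec_mulVec, reflMatrix_mulVec, reflMatrix_mulVec, herm_add_left, herm_smul_left, hc,
      one_mulVec]
    have := mul_conj_of_norm_one hη
    rw [add_assoc, ← add_smul]
    have e : ((starRingEnd ℂ) η - 1) * herm z c +
        (η - 1) * (herm z c + ((starRingEnd ℂ) η - 1) * herm z c * 1) = 0 := by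
      linear_combination (herm z c) * this
    rw [e]
    simp
  calc adj (reflMatrix c η) = adj (reflMatrix c η) *
        (reflMatrix c η * reflMatrix c ((starRingEnd ℂ) η)) := by rw [h2, Matrix.mul_one]
    _ = _ := by rw [← Matrix.mul_assoc, h1, Matrix.one_mul]

lemma mat_eq_refl_mul {g : U21} {R S : PU21} {c d : Fin 3 → ℂ} {η ζ : ℂ}
    (hR : IsComplexReflection R c η) (hS : IsComplexReflection S d ζ) (hg : toPU g = R * S⁻¹) :
    ∃ l : ℂ, mat g = l • (reflMatrix c η * reflMatrix d ((starRingEnd ℂ) ζ)) := by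
  obtain ⟨hc, hη, -, M, rfl, hM⟩ := hR
  obtain ⟨hd, hζ, -, N, rfl, hN⟩ := hS
  rw [← map_inv, ← map_mul] at hg
  obtain ⟨l, -, hl⟩ := (toPU_eq_iff _ _).mp hg
  refine ⟨l, ?_⟩
  have eM : mat M = reflMatrix c η := ext_mulVec fun z => by rw [hM, reflMatrix_mulVec]
  have eN : mat N = reflMatrix d ζ := ext_mulVec fun z => by rw [hN, reflMatrix_mulVec]
  rw [hl, mat_mul, mat_inv, eM, eN, adj_reflMatrix hd hζ]

/-- The scalar is the eigenvalue of g at a negative vector, which is 1 for a normalized lift. The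
hypothesis `heig` has the shape provided by `Triple.eigA`, `Triple.eigB`, `Triple.eigC`. Moreover z
is then a multiple of p, so orthogonality passes from z to p. -/
lemma scalar_eq_one {g : U21} {M : Matrix (Fin 3) (Fin 3) ℂ} {l : ℂ} (h : mat g = l • M)
    {z p : Fin 3 → ℂ} {P : Prop} (hz : IsNegative z) (hM : M *ᵥ z = z)
    (heig : mat g *ᵥ z = l • z → (0 < (herm z z).re ∧ P) ∨
      (IsNegative z ∧ l = 1 ∧ z = -herm z p • p)) :
    mat g = M ∧ ∀ c, herm z c = 0 → herm p c = 0 := by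
  have e : mat g *ᵥ z = l • z := by rw [h, smul_mulVec, hM]
  rcases heig e with ⟨h1, -⟩ | ⟨-, h2, h3⟩
  · unfold IsNegative at hz
    linarith
  · refine ⟨by rw [h, h2, one_smul], fun c hc => ?_⟩
    have hs : -herm z p ≠ 0 := by
      intro e0
      rw [e0] at h3
      exact hz.ne_zero (by simpa using h3)
    rw [h3, herm_smul_left] at hc
    exact (mul_eq_zero.mp hc).resolve_left hs

/-- The intersection point of two mirrors is fixed by the corresponding product of reflections. It
is therefore the fixed point of A, B or C, and the projective identities hold exactly for the
normalized lifts. -/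
theorem Triple.dec_of_decomposition (T : Triple) {c : Fin 3 → Fin 3 → ℂ} {η : Fin 3 → ℂ}
    (h : IsSphericalDecomposition (toPU T.A) (toPU T.B) (toPU T.C) c η) : T.Dec c η := by
  obtain ⟨hl, R, hR, hA, hB, hC⟩ := h
  obtain ⟨kA, eA⟩ := mat_eq_refl_mul (hR 0) (hR 1) hA
  obtain ⟨kB, eB⟩ := mat_eq_refl_mul (hR 1) (hR 2) hB
  obtain ⟨kC, eC⟩ := mat_eq_refl_mul (hR 2) (hR 0) hC
  obtain ⟨-, x, hx, hx0, hx1⟩ := hl 0 1 (by decide)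
  obtain ⟨-, y, hy, hy1, hy2⟩ := hl 1 2 (by decide)
  obtain ⟨-, z, hz, hz2, hz0⟩ := hl 2 0 (by decide)
  obtain ⟨fA, gA⟩ := scalar_eq_one eA hx
    (by rw [← mulVec_mulVec, reflMatrix_mulVec_of_orthogonal hx1,
      reflMatrix_mulVec_of_orthogonal hx0]) (T.eigA hx.ne_zero)
  obtain ⟨fB, gB⟩ := scalar_eq_one eB hy
    (by rw [← mulVec_mulVec, reflMatrix_mulVec_of_orthogonal hy2,
      reflMatrix_mulVec_of_orthogonal hy1]) (T.eigB hy.ne_zero)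
  obtain ⟨fC, gC⟩ := scalar_eq_one eC hz
    (by rw [← mulVec_mulVec, reflMatrix_mulVec_of_orthogonal hz0,
      reflMatrix_mulVec_of_orthogonal hz2]) (T.eigC hz.ne_zero)
  exact ⟨fun k => (hR k).1, fun k => (hR k).2.1, fun k => (hR k).2.2.1, fA, fB, fC, gA _ hx0,
    gA _ hx1, gB _ hy1, gB _ hy2, gC _ hz2, gC _ hz0⟩

/-! ### Determinants and traces -/

lemma det_reflMatrix {c : Fin 3 → ℂ} (hc : herm c c = 1) (η : ℂ) : (reflMatrix c η).det = η := by
  have h : formMatrix *ᵥ star c ⬝ᵥ c = 1 := by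
    rw [← hc]
    simp [herm, formMatrix, mulVec_diagonal, dotProduct, Fin.sum_univ_three]
    ring
  rw [reflMatrix, rankOne, ← smul_vecMulVec, vecMulVec_eq Unit,
    det_one_add_replicateCol_mul_replicateRow, dotProduct_smul, h]
  simp

lemma trace_reflMatrix_mul {c d : Fin 3 → ℂ} (hc : herm c c = 1) (hd : herm d d = 1) (η ζ : ℂ) :
    (reflMatrix c η * reflMatrix d ζ).trace =
      1 + η + ζ + (η - 1) * (ζ - 1) * (‖herm c d‖ ^ 2 : ℝ) := by
  simp only [reflMatrix, Matrix.mul_add, Matrix.add_mul, Matrix.mul_one, Matrix.one_mul,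
    Matrix.mul_smul, Matrix.smul_mul, trace_add, trace_smul, trace_rankOne_two, trace_rankOne,
    hc, hd, smul_eq_mul, trace_one]
  simp
  ring

/-- The Gram matrix is X* J X with J = diag(1, 1, -1), so its determinant is minus a square modulus;
the left side expands this determinant for unit vectors. -/
lemma gram_det (c : Fin 3 → Fin 3 → ℂ) (hc : ∀ k, herm (c k) (c k) = 1) :
    1 - ‖herm (c 2) (c 1)‖ ^ 2 - ‖herm (c 0) (c 2)‖ ^ 2 - ‖herm (c 1) (c 0)‖ ^ 2 +
      2 * (herm (c 2) (c 1) * herm (c 0) (c 2) * herm (c 1) (c 0)).re =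
      -‖(colMatrix (c 0) (c 1) (c 2)).det‖ ^ 2 := by
  set X := colMatrix (c 0) (c 1) (c 2) with hX
  have hG : ∀ i j, (Xᴴ * formMatrix * X) i j = herm (c j) (c i) := by
    intro i j
    have e : ∀ k l, X k l = c l k := by
      intro k l
      rw [hX, colMatrix]
      fin_cases l <;> rfl
    rw [Matrix.mul_apply, Fin.sum_univ_three]
    simp only [formMatrix, mul_diagonal, conjTranspose_apply, e, herm]
    simp
    ring
  have hdet : (Xᴴ * formMatrix * X).det = ((-‖X.det‖ ^ 2 : ℝ) : ℂ) := by
    rw [det_mul, det_mul, det_conjTranspose, formMatrix, det_diagonal, Fin.prod_univ_three]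
    have : star X.det * X.det = ((‖X.det‖ ^ 2 : ℝ) : ℂ) := by
      rw [← Complex.normSq_eq_norm_sq, mul_comm]
      exact Complex.mul_conj _
    push_cast at this ⊢
    simp only [neg_mul, mul_one, mul_neg]
    linear_combination -this
  rw [det_fin_three] at hdet
  simp only [hG, hc] at hdet
  have e1 := herm_mul_herm_swap (c 2) (c 1)
  have e2 := herm_mul_herm_swap (c 0) (c 2)
  have e3 := herm_mul_herm_swap (c 1) (c 0)
  have e4 : herm (c 2) (c 1) * herm (c 0) (c 2) * herm (c 1) (c 0) +
      herm (c 1) (c 2) * herm (c 2) (c 0) * herm (c 0) (c 1) =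
      ((2 * (herm (c 2) (c 1) * herm (c 0) (c 2) * herm (c 1) (c 0)).re : ℝ) : ℂ) := by
    rw [← Complex.add_conj]
    simp only [map_mul, conj_herm]
  have e5 : ((1 - ‖herm (c 2) (c 1)‖ ^ 2 - ‖herm (c 0) (c 2)‖ ^ 2 - ‖herm (c 1) (c 0)‖ ^ 2 +
      2 * (herm (c 2) (c 1) * herm (c 0) (c 2) * herm (c 1) (c 0)).re : ℝ) : ℂ) =
      ((-‖X.det‖ ^ 2 : ℝ) : ℂ) := by
    rw [← hdet, Complex.ofReal_add, ← e4, Complex.ofReal_sub, Complex.ofReal_sub,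
      Complex.ofReal_sub, ← e1, ← e2, ← e3, Complex.ofReal_one]
    ring
  exact_mod_cast e5

/-! ### Invariants of pairs of matrices -/

/-- The projection onto the eigenspace of the eigenvalue `1`, where `μ`, `ν` are the other
eigenvalues. -/
def specProj (μ ν : ℂ) (M : Matrix (Fin 3) (Fin 3) ℂ) : Matrix (Fin 3) (Fin 3) ℂ :=
  ((1 - μ) * (1 - ν))⁻¹ • ((M - μ • 1) * (M - ν • 1))

/-- The normalized product kills the two positive eigenvectors and fixes p. The minus sign comes
from ⟨p, p⟩ = -1. -/
lemma IsNormalForm.specProj_eq {g : U21} {μ ν : ℂ} {a b p : Fin 3 → ℂ}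
    (h : IsNormalForm g μ ν a b p) (hμ : μ ≠ 1) (hν : ν ≠ 1) :
    specProj μ ν (mat g) = -rankOne p := by
  apply ext_mulVec
  intro z
  conv_lhs => rw [h.frame.expand z]
  have h1 : (1 - μ) * (1 - ν) ≠ 0 :=
    mul_ne_zero (sub_ne_zero.mpr hμ.symm) (sub_ne_zero.mpr hν.symm)
  simp only [specProj, smul_mulVec, ← mulVec_mulVec, sub_mulVec, mulVec_add, mulVec_sub,
    mulVec_smul, one_mulVec, h.apply_a, h.apply_b, h.apply_p, neg_mulVec, rankOne_mulVec]
  have e : ((1 - μ) * (1 - ν))⁻¹ • (((1 - μ) * (1 - ν)) • (-(herm z p • p))) = -(herm z p • p) := by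
    rw [smul_smul, inv_mul_cancel₀ h1, one_smul]
  rw [← e]
  module

/-- The projection onto the negative fixed vector of `A`. -/
def projA : Matrix (Fin 3) (Fin 3) ℂ → Matrix (Fin 3) (Fin 3) ℂ :=
  specProj (cis (3 * Real.pi / 2)) (cis Real.pi)

/-- The projection onto the negative fixed vector of `B`. -/
def projB : Matrix (Fin 3) (Fin 3) ℂ → Matrix (Fin 3) (Fin 3) ℂ :=
  specProj (cis (6 * Real.pi / 5)) (cis (2 * Real.pi / 5))

/-- The projection onto the negative fixed vector of `C`. -/
def projC : Matrix (Fin 3) (Fin 3) ℂ → Matrix (Fin 3) (Fin 3) ℂ :=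
  specProj (cis (8 * Real.pi / 5)) (cis (3 * Real.pi / 10))

/-- The matrix whose trace is an invariant with the argument of `1 - η₁`. -/
def rotationElement (M N : Matrix (Fin 3) (Fin 3) ℂ) : Matrix (Fin 3) (Fin 3) ℂ :=
  (M - 1) * projB N

/-- The matrix whose trace is an invariant with the argument of `-∏ ⟨c_{k-1}, c_{k+1}⟩`. -/
def angularElement (M N : Matrix (Fin 3) (Fin 3) ℂ) : Matrix (Fin 3) (Fin 3) ℂ :=
  ((M - 1) * projB N * adj (M - 1)) * ((N - 1) * projC (adj (M * N)) * adj (N - 1)) *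
    ((adj (M * N) - 1) * projA M * adj (adj (M * N) - 1))

/-! ### Invariant traces of a decomposed triple. -/

namespace Triple

variable (T : Triple)

lemma projA_eq : projA (mat T.A) = -rankOne T.p :=
  T.hA.specProj_eq (cis_ne_one 30 (by push_cast; ring) (by norm_num))
    (cis_ne_one 20 (by push_cast; ring) (by norm_num))

lemma projB_eq : projB (mat T.B) = -rankOne T.q :=
  T.hB.specProj_eq (cis_ne_one 24 (by push_cast; ring) (by norm_num))
    (cis_ne_one 8 (by push_cast; ring) (by norm_num))

lemma projC_eq : projC (mat T.C) = -rankOne T.r :=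
  T.hC.specProj_eq (cis_ne_one 32 (by push_cast; ring) (by norm_num))
    (cis_ne_one 6 (by push_cast; ring) (by norm_num))

lemma adj_mul_eq : adj (mat T.A * mat T.B) = mat T.C := by
  rw [← mat_mul, ← mat_inv, _root_.mul_inv_rev, T.C_eq]

variable {T} {c : Fin 3 → Fin 3 → ℂ} {η : Fin 3 → ℂ}

lemma Dec.A_q (h : T.Dec c η) : mat T.A *ᵥ T.q = T.q + ((η 0 - 1) * herm T.q (c 0)) • c 0 := by
  rw [h.A_eq, ← mulVec_mulVec, reflMatrix_mulVec_of_orthogonal h.q1, reflMatrix_mulVec]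

lemma Dec.B_r (h : T.Dec c η) : mat T.B *ᵥ T.r = T.r + ((η 1 - 1) * herm T.r (c 1)) • c 1 := by
  rw [h.B_eq, ← mulVec_mulVec, reflMatrix_mulVec_of_orthogonal h.r2, reflMatrix_mulVec]

lemma Dec.C_p (h : T.Dec c η) : mat T.C *ᵥ T.p = T.p + ((η 2 - 1) * herm T.p (c 2)) • c 2 := by
  rw [h.C_eq, ← mulVec_mulVec, reflMatrix_mulVec_of_orthogonal h.p0, reflMatrix_mulVec]

lemma Dec.q0 (h : T.Dec c η) (hT : ¬ T.Degenerate) : herm T.q (c 0) ≠ 0 := by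
  intro e
  apply T.A_q_ne hT
  rw [h.A_q, e]
  simp

lemma Dec.r1 (h : T.Dec c η) (hT : ¬ T.Degenerate) : herm T.r (c 1) ≠ 0 := by
  intro e
  apply T.B_r_ne hT
  rw [h.B_r, e]
  simp

lemma Dec.hp2 (h : T.Dec c η) (hT : ¬ T.Degenerate) : herm T.p (c 2) ≠ 0 := by
  intro e
  apply T.C_p_ne hT
  rw [h.C_p, e]
  simp

lemma Dec.det_ne_zero (h : T.Dec c η) (hT : ¬ T.Degenerate) :
    (colMatrix (c 0) (c 1) (c 2)).det ≠ 0 := by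
  have s : ∀ {x y : Fin 3 → ℂ}, herm x y ≠ 0 → herm y x ≠ 0 := fun h e => h (herm_eq_zero_symm e)
  exact colMatrix_det_ne_zero (c₀ := T.r) (c₁ := T.p) (c₂ := T.q) (herm_eq_zero_symm h.r0)
    (herm_eq_zero_symm h.p0) (herm_eq_zero_symm h.p1) (herm_eq_zero_symm h.q1)
    (herm_eq_zero_symm h.q2) (herm_eq_zero_symm h.r2) (s (h.q0 hT)) (s (h.r1 hT)) (s (h.hp2 hT))

/-- Strict because the polar vectors are independent for a non-degenerate triple. This inequality
becomes the condition on cos α. -/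
lemma Dec.gram (h : T.Dec c η) (hT : ¬ T.Degenerate) :
    1 - ‖herm (c 2) (c 1)‖ ^ 2 - ‖herm (c 0) (c 2)‖ ^ 2 - ‖herm (c 1) (c 0)‖ ^ 2 +
      2 * (herm (c 2) (c 1) * herm (c 0) (c 2) * herm (c 1) (c 0)).re < 0 := by
  rw [gram_det c h.unit]
  have := norm_pos_iff.mpr (h.det_ne_zero hT)
  have : 0 < ‖(colMatrix (c 0) (c 1) (c 2)).det‖ ^ 2 := by positivity
  linarith

lemma Dec.detA (h : T.Dec c η) :
    η 0 * (starRingEnd ℂ) (η 1) = cis (3 * Real.pi / 2) * cis Real.pi := by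
  rw [← T.hA.det, h.A_eq, det_mul, det_reflMatrix (h.unit 0), det_reflMatrix (h.unit 1)]

lemma Dec.detC (h : T.Dec c η) :
    η 2 * (starRingEnd ℂ) (η 0) = cis (8 * Real.pi / 5) * cis (3 * Real.pi / 10) := by
  rw [← T.hC.det, h.C_eq, det_mul, det_reflMatrix (h.unit 2), det_reflMatrix (h.unit 0)]

lemma Dec.traceA (h : T.Dec c η) :
    1 + η 0 + (starRingEnd ℂ) (η 1) + (η 0 - 1) * ((starRingEnd ℂ) (η 1) - 1) *
      (‖herm (c 1) (c 0)‖ ^ 2 : ℝ) = 1 + cis (3 * Real.pi / 2) + cis Real.pi := by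
  rw [← T.hA.trace, h.A_eq, trace_reflMatrix_mul (h.unit 0) (h.unit 1), norm_herm_comm]

lemma Dec.traceB (h : T.Dec c η) :
    1 + η 1 + (starRingEnd ℂ) (η 2) + (η 1 - 1) * ((starRingEnd ℂ) (η 2) - 1) *
      (‖herm (c 2) (c 1)‖ ^ 2 : ℝ) = 1 + cis (6 * Real.pi / 5) + cis (2 * Real.pi / 5) := by
  rw [← T.hB.trace, h.B_eq, trace_reflMatrix_mul (h.unit 1) (h.unit 2), norm_herm_comm]

lemma Dec.traceC (h : T.Dec c η) :
    1 + η 2 + (starRingEnd ℂ) (η 0) + (η 2 - 1) * ((starRingEnd ℂ) (η 0) - 1) *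
      (‖herm (c 0) (c 2)‖ ^ 2 : ℝ) = 1 + cis (8 * Real.pi / 5) + cis (3 * Real.pi / 10) := by
  rw [← T.hC.trace, h.C_eq, trace_reflMatrix_mul (h.unit 2) (h.unit 0), norm_herm_comm]

/-- A - 1 maps q to (η₀ - 1)⟨q, c₀⟩c₀, so the trace is a positive multiple of 1 - η₀. Its argument
recovers the rotation angle from A and B alone, whatever decomposition is used. -/
lemma Dec.trace_rotationElement (h : T.Dec c η) :
    (rotationElement (mat T.A) (mat T.B)).trace =
      (‖herm T.q (c 0)‖ ^ 2 : ℝ) * (1 - η 0) := by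
  rw [rotationElement, T.projB_eq, Matrix.mul_neg, trace_neg, trace_mul_rankOne, sub_mulVec,
    one_mulVec, h.A_q, add_sub_cancel_left, herm_smul_left, ← herm_mul_herm_swap]
  ring

lemma conj_neg_rankOne {M : Matrix (Fin 3) (Fin 3) ℂ} {v c : Fin 3 → ℂ} {s : ℂ}
    (h : M *ᵥ v = v + s • c) :
    (M - 1) * -rankOne v * adj (M - 1) = ((-‖s‖ ^ 2 : ℝ) : ℂ) • rankOne c := by
  rw [Matrix.mul_neg, Matrix.neg_mul, mul_rankOne_mul_adj, sub_mulVec, one_mulVec, h,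
    add_sub_cancel_left, rankOne_smul, ← neg_smul]
  push_cast
  rfl

/-- Each of the three factors is a negative multiple of a rank one operator along some c k, since
for instance A - 1 maps q into the line of c 0. The trace of the product of three such operators is
the triple product of Gram entries. -/
lemma Dec.trace_angularElement (h : T.Dec c η) (hT : ¬ T.Degenerate) :
    ∃ s : ℝ, 0 < s ∧ (angularElement (mat T.A) (mat T.B)).trace =
      s * -(herm (c 2) (c 1) * herm (c 0) (c 2) * herm (c 1) (c 0)) := by
  refine ⟨‖(η 0 - 1) * herm T.q (c 0)‖ ^ 2 * ‖(η 1 - 1) * herm T.r (c 1)‖ ^ 2 *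
    ‖(η 2 - 1) * herm T.p (c 2)‖ ^ 2, ?_, ?_⟩
  · have h0 := norm_pos_iff.mpr (mul_ne_zero (sub_ne_zero.mpr (h.ne_one 0)) (h.q0 hT))
    have h1 := norm_pos_iff.mpr (mul_ne_zero (sub_ne_zero.mpr (h.ne_one 1)) (h.r1 hT))
    have h2 := norm_pos_iff.mpr (mul_ne_zero (sub_ne_zero.mpr (h.ne_one 2)) (h.hp2 hT))
    positivity
  · rw [angularElement, T.adj_mul_eq, T.projA_eq, T.projB_eq, T.projC_eq,
      conj_neg_rankOne h.A_q, conj_neg_rankOne h.B_r, conj_neg_rankOne h.C_p]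
    simp only [Matrix.smul_mul, Matrix.mul_smul, trace_smul, trace_rankOne_three, smul_eq_mul]
    push_cast
    ring

end Triple

/-! ### Trace equations -/

lemma two_cos (t : ℝ) : ((2 * Real.cos t : ℝ) : ℂ) = cis t + cis (-t) := by
  apply Complex.ext <;> simp [cis_re, cis_im, -Complex.ofReal_cos, two_mul]

lemma cis_add_cis (a b : ℝ) :
    cis a + cis b = cis ((a + b) / 2) * (2 * Real.cos ((a - b) / 2) : ℝ) := by
  rw [two_cos, mul_add, ← cis_add, ← cis_add]
  congr 2 <;> ring

/-- The term t is a squared Gram modulus. Half-angle formulas extract the common phase cis((θ -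
θ')/2), the square root of the determinant, and leave a real factor. -/
lemma trace_formula (θ θ' t : ℝ) :
    1 + cis θ + cis (-θ') + (cis θ - 1) * (cis (-θ') - 1) * (t : ℂ) =
      1 + cis ((θ - θ') / 2) *
        ((2 * Real.cos ((θ + θ') / 2) : ℝ) * (1 - t) + (2 * Real.cos ((θ - θ') / 2) : ℝ) * t) := by
  have h1 : cis ((θ - θ') / 2) * (2 * Real.cos ((θ + θ') / 2) : ℝ) = cis θ + cis (-θ') := by
    rw [cis_add_cis, show (θ + -θ') / 2 = (θ - θ') / 2 by ring,
      show (θ - -θ') / 2 = (θ + θ') / 2 by ring]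
  have h2 : cis ((θ - θ') / 2) * (2 * Real.cos ((θ - θ') / 2) : ℝ) = cis θ * cis (-θ') + 1 := by
    rw [two_cos, mul_add, ← cis_add, ← cis_add, ← cis_add, ← cis_zero]
    congr 2 <;> ring
  linear_combination (-(1 - (t : ℂ))) * h1 - t * h2

/-- Once the determinants match, both traces minus 1 are real multiples of one phase up to the sign
σ, so the complex trace equation amounts to a single real one. Being an equivalence, it serves both
to analyse decompositions and to construct them. -/
lemma trace_formula_iff {θ θ' a b σ : ℝ} (t : ℝ)
    (h : cis ((a + b) / 2) = σ * cis ((θ - θ') / 2)) :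
    1 + cis θ + cis (-θ') + (cis θ - 1) * (cis (-θ') - 1) * (t : ℂ) = 1 + cis a + cis b ↔
      Real.cos ((θ + θ') / 2) * (1 - t) + Real.cos ((θ - θ') / 2) * t =
        σ * Real.cos ((a - b) / 2) := by
  rw [trace_formula, add_assoc 1 (cis a), cis_add_cis, h, mul_comm (σ : ℂ), mul_assoc,
    add_right_inj]
  constructor
  · intro e
    have e2 := mul_left_cancel₀ (cis_ne_zero _) e
    have e3 : 2 * Real.cos ((θ + θ') / 2) * (1 - t) + 2 * Real.cos ((θ - θ') / 2) * t =
        σ * (2 * Real.cos ((a - b) / 2)) := by exact_mod_cast e2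
    linarith
  · intro e
    congr 1
    have e3 : 2 * Real.cos ((θ + θ') / 2) * (1 - t) + 2 * Real.cos ((θ - θ') / 2) * t =
        σ * (2 * Real.cos ((a - b) / 2)) := by linarith
    exact_mod_cast e3

lemma trace_iff_A (θ t : ℝ) :
    1 + cis θ + cis (-(θ - Real.pi / 2)) + (cis θ - 1) * (cis (-(θ - Real.pi / 2)) - 1) * (t : ℂ) =
      1 + cis (3 * Real.pi / 2) + cis Real.pi ↔
    (1 - t) * (Real.cos (Real.pi / 4) + Real.cos (θ - 5 * Real.pi / 4)) =
      2 * Real.cos (Real.pi / 4) := by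
  -- Here σ = -1: the half sum of the angles of A is 5π/4, half a turn beyond π/4. For B and C the
  -- sign is +1.
  have h : cis ((3 * Real.pi / 2 + Real.pi) / 2) =
      ((-1 : ℝ) : ℂ) * cis ((θ - (θ - Real.pi / 2)) / 2) := by
    rw [show (3 * Real.pi / 2 + Real.pi) / 2 = Real.pi + (θ - (θ - Real.pi / 2)) / 2 by ring,
      cis_add, cis_pi]
    push_cast
    rfl
  rw [trace_formula_iff t h,
    show (θ + (θ - Real.pi / 2)) / 2 = (θ - 5 * Real.pi / 4) + Real.pi by ring, Real.cos_add_pi,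
    show (θ - (θ - Real.pi / 2)) / 2 = Real.pi / 4 by ring,
    show (3 * Real.pi / 2 - Real.pi) / 2 = Real.pi / 4 by ring]
  constructor <;> intro e <;> linear_combination -e

lemma trace_iff_B (θ t : ℝ) :
    1 + cis (θ - Real.pi / 2) + cis (-(θ - 21 * Real.pi / 10)) +
      (cis (θ - Real.pi / 2) - 1) * (cis (-(θ - 21 * Real.pi / 10)) - 1) * (t : ℂ) =
      1 + cis (6 * Real.pi / 5) + cis (2 * Real.pi / 5) ↔
    (1 - t) * (Real.cos (Real.pi / 5) + Real.cos (θ - 13 * Real.pi / 10)) =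
      Real.cos (2 * Real.pi / 5) + Real.cos (Real.pi / 5) := by
  have h : cis ((6 * Real.pi / 5 + 2 * Real.pi / 5) / 2) =
      ((1 : ℝ) : ℂ) * cis ((θ - Real.pi / 2 - (θ - 21 * Real.pi / 10)) / 2) := by
    rw [Complex.ofReal_one, one_mul]
    congr 1
    ring
  rw [trace_formula_iff t h,
    show (θ - Real.pi / 2 + (θ - 21 * Real.pi / 10)) / 2 = θ - 13 * Real.pi / 10 by ring,
    show (θ - Real.pi / 2 - (θ - 21 * Real.pi / 10)) / 2 = Real.pi - Real.pi / 5 by ring,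
    Real.cos_pi_sub, show (6 * Real.pi / 5 - 2 * Real.pi / 5) / 2 = 2 * Real.pi / 5 by ring]
  constructor <;> intro e <;> linear_combination e

lemma trace_iff_C (θ t : ℝ) :
    1 + cis (θ - 21 * Real.pi / 10) + cis (-θ) +
      (cis (θ - 21 * Real.pi / 10) - 1) * (cis (-θ) - 1) * (t : ℂ) =
      1 + cis (8 * Real.pi / 5) + cis (3 * Real.pi / 10) ↔
    (1 - t) * (Real.cos (Real.pi / 20) + Real.cos (θ - 21 * Real.pi / 20)) =
      Real.cos (13 * Real.pi / 20) + Real.cos (Real.pi / 20) := by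
  have h : cis ((8 * Real.pi / 5 + 3 * Real.pi / 10) / 2) =
      ((1 : ℝ) : ℂ) * cis ((θ - 21 * Real.pi / 10 - θ) / 2) := by
    rw [Complex.ofReal_one, one_mul, cis_eq_iff]
    refine ⟨1, ?_⟩
    push_cast
    ring
  rw [trace_formula_iff t h,
    show (θ - 21 * Real.pi / 10 + θ) / 2 = θ - 21 * Real.pi / 20 by ring,
    show (θ - 21 * Real.pi / 10 - θ) / 2 = -(Real.pi / 20 + Real.pi) by ring, Real.cos_neg,
    Real.cos_add_pi, show (8 * Real.pi / 5 - 3 * Real.pi / 10) / 2 = 13 * Real.pi / 20 by ring]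
  constructor <;> intro e <;> linear_combination e

/-! ### Estimates for the complex angles -/

lemma cos_pi_div_twenty_bounds :
    0.9876 < Real.cos (Real.pi / 20) ∧ Real.cos (Real.pi / 20) < 0.9878 := by
  have h1 := Real.pi_gt_d4
  have h2 := Real.pi_lt_d4
  have hx : |Real.pi / 20| ≤ 1 := by rw [abs_of_pos (by positivity)]; linarith
  have h := abs_le.mp (Real.cos_bound hx)
  rw [abs_of_pos (by positivity : 0 < Real.pi / 20)] at h
  have l2 : (0.15707 : ℝ) ^ 2 ≤ (Real.pi / 20) ^ 2 := by gcongr; linarith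
  have u2 : (Real.pi / 20) ^ 2 ≤ (0.15708 : ℝ) ^ 2 := by gcongr; linarith
  have u4 : (Real.pi / 20) ^ 4 ≤ (0.15708 : ℝ) ^ 4 := by gcongr; linarith
  norm_num at l2 u2 u4
  constructor <;> linarith [h.1, h.2]

lemma sin_pi_div_twenty_bounds :
    0.1563 < Real.sin (Real.pi / 20) ∧ Real.sin (Real.pi / 20) < 0.1565 := by
  have h1 := Real.pi_gt_d4
  have h2 := Real.pi_lt_d4
  have hx : |Real.pi / 20| ≤ 1 := by rw [abs_of_pos (by positivity)]; linarith
  have h := abs_le.mp (Real.sin_bound hx)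
  rw [abs_of_pos (by positivity : 0 < Real.pi / 20)] at h
  have l3 : (0.15707 : ℝ) ^ 3 ≤ (Real.pi / 20) ^ 3 := by gcongr; linarith
  have u3 : (Real.pi / 20) ^ 3 ≤ (0.15708 : ℝ) ^ 3 := by gcongr; linarith
  have u5 : (Real.pi / 20) ^ 5 ≤ (0.15708 : ℝ) ^ 5 := by gcongr; linarith
  norm_num at l3 u3 u5
  constructor <;> linarith [h.1, h.2]

lemma cos_pi_div_four_bounds :
    0.7071 < Real.cos (Real.pi / 4) ∧ Real.cos (Real.pi / 4) < 0.70711 := by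
  rw [Real.cos_pi_div_four]
  have h1 : 1.4142 < Real.sqrt 2 := Real.lt_sqrt_of_sq_lt (by norm_num)
  have h2 : Real.sqrt 2 < 1.41422 := by rw [Real.sqrt_lt' (by norm_num)]; norm_num
  constructor <;> linarith

lemma cos_thirteen_pi_div_twenty_bounds :
    -0.4544 < Real.cos (13 * Real.pi / 20) ∧ Real.cos (13 * Real.pi / 20) < -0.4535 := by
  rw [show 13 * Real.pi / 20 = Real.pi / 5 - Real.pi / 20 + Real.pi / 2 by ring,
    Real.cos_add_pi_div_two, Real.sin_sub]
  obtain ⟨a1, a2⟩ := cos_pi_div_five_bounds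
  obtain ⟨b1, b2⟩ := sin_pi_div_five_bounds
  obtain ⟨c1, c2⟩ := cos_pi_div_twenty_bounds
  obtain ⟨d1, d2⟩ := sin_pi_div_twenty_bounds
  constructor <;> nlinarith

/-- The sign of y is unknown in the applications, so the error term carries |y|. -/
lemma mul_bounds_of_near {y s m : ℝ} (h3 : m ≤ s) (h4 : s ≤ m + 0.0002) :
    m * y - 0.0002 * |y| ≤ y * s ∧ y * s ≤ m * y + 0.0002 * |y| := by
  have h : |y * (s - m)| ≤ |y| * 0.0002 := by
    rw [abs_mul]
    gcongr
    rw [abs_le]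
    constructor <;> linarith
  have := abs_le.mp h
  constructor <;> linarith [this.1, this.2]

/-- Bounds for the three denominators of `sinSqAngle θ`, as functions of `x = cos u`, `y = sin u`
where `u = θ - 5π/4`. -/
structure DenomBounds (x y d₀ d₁ d₂ : ℝ) : Prop where
  le_x : 0.7071 < x
  x_le : x ≤ 1
  sq_le : y ^ 2 ≤ 1 / 2
  sq_add : x ^ 2 + y ^ 2 = 1
  l0 : 0.809 + 0.9876 * x + 0.1563 * y - 0.0002 * |y| ≤ d₀
  u0 : d₀ ≤ 0.80902 + 0.9878 * x + 0.1563 * y + 0.0002 * |y|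
  o0 : d₀ ≤ 1.80902
  l1 : 0.9876 + 0.809 * x - 0.5877 * y - 0.0002 * |y| ≤ d₁
  u1 : d₁ ≤ 0.9878 + 0.80902 * x - 0.5877 * y + 0.0002 * |y|
  o1 : d₁ ≤ 1.9878
  l2 : 0.7071 + x ≤ d₂
  u2 : d₂ ≤ 0.70711 + x

/-- Centring at 5π/4 turns the interval of θ into |u| ≤ π/4 and expresses the three denominators
through cos u and sin u. -/
lemma cos_sub_eqs (θ : ℝ) :
    Real.cos (θ - 13 * Real.pi / 10) = Real.cos (θ - 5 * Real.pi / 4) * Real.cos (Real.pi / 20) +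
        Real.sin (θ - 5 * Real.pi / 4) * Real.sin (Real.pi / 20) ∧
      Real.cos (θ - 21 * Real.pi / 20) = Real.cos (θ - 5 * Real.pi / 4) * Real.cos (Real.pi / 5) -
        Real.sin (θ - 5 * Real.pi / 4) * Real.sin (Real.pi / 5) ∧
      Real.cos (θ - Real.pi / 4) = -Real.cos (θ - 5 * Real.pi / 4) := by
  refine ⟨?_, ?_, ?_⟩
  · rw [← Real.cos_sub]
    congr 1
    ring
  · rw [← Real.cos_add]
    congr 1
    ring
  · rw [← Real.cos_add_pi]
    congr 1
    ring

lemma denomBounds {θ : ℝ} (h1 : Real.pi ≤ θ) (h2 : θ ≤ 3 * Real.pi / 2) :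
    DenomBounds (Real.cos (θ - 5 * Real.pi / 4)) (Real.sin (θ - 5 * Real.pi / 4))
      (Real.cos (Real.pi / 5) + Real.cos (θ - 13 * Real.pi / 10))
      (Real.cos (Real.pi / 20) + Real.cos (θ - 21 * Real.pi / 20))
      (Real.cos (Real.pi / 4) - Real.cos (θ - Real.pi / 4)) := by
  have hx : Real.cos (Real.pi / 4) ≤ Real.cos (θ - 5 * Real.pi / 4) := by
    rw [← Real.cos_abs (θ - 5 * Real.pi / 4)]
    apply Real.cos_le_cos_of_nonneg_of_le_pi (abs_nonneg _) (by linarith)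
    rw [abs_le]
    constructor <;> linarith
  have hc4 : Real.cos (Real.pi / 4) ^ 2 = 1 / 2 := by
    rw [Real.cos_pi_div_four, div_pow, Real.sq_sqrt (by norm_num)]; norm_num
  have hxy : Real.cos (θ - 5 * Real.pi / 4) ^ 2 + Real.sin (θ - 5 * Real.pi / 4) ^ 2 = 1 :=
    Real.cos_sq_add_sin_sq _
  have ho := Real.cos_le_one (θ - 5 * Real.pi / 4)
  have ho0 := Real.cos_le_one (θ - 13 * Real.pi / 10)
  have ho1 := Real.cos_le_one (θ - 21 * Real.pi / 20)
  obtain ⟨e0, e1, e2⟩ := cos_sub_eqs θ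
  obtain ⟨f1, f2⟩ := cos_pi_div_four_bounds
  obtain ⟨a1, a2⟩ := cos_pi_div_five_bounds
  obtain ⟨b1, b2⟩ := sin_pi_div_five_bounds
  obtain ⟨c1, c2⟩ := cos_pi_div_twenty_bounds
  obtain ⟨d1, d2⟩ := sin_pi_div_twenty_bounds
  have k0 := mul_bounds_of_near (y := Real.sin (θ - 5 * Real.pi / 4)) d1.le (by linarith)
  have k1 := mul_bounds_of_near (y := Real.sin (θ - 5 * Real.pi / 4)) b1.le (by linarith)
  have hsq : Real.cos (Real.pi / 4) ^ 2 ≤ Real.cos (θ - 5 * Real.pi / 4) ^ 2 := by gcongr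
  have hx0 : 0 ≤ Real.cos (θ - 5 * Real.pi / 4) := by linarith
  have m0 := mul_le_mul_of_nonneg_left c1.le hx0
  have m1 := mul_le_mul_of_nonneg_left c2.le hx0
  have m2 := mul_le_mul_of_nonneg_left a1.le hx0
  have m3 := mul_le_mul_of_nonneg_left a2.le hx0
  constructor
  · linarith
  · exact ho
  · linarith
  · exact hxy
  · rw [e0]; linarith [k0.1]
  · rw [e0]; linarith [k0.2]
  · linarith
  · rw [e1]; linarith [k1.2]
  · rw [e1]; linarith [k1.1]
  · linarith
  · rw [e2]; linarith
  · rw [e2]; linarith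

/-! ### Bounds for sin² φ_k and the inequality between the Gram entries. -/

lemma sinSqAngle_zero (θ : ℝ) : sinSqAngle θ 0 =
    (Real.cos (2 * Real.pi / 5) + Real.cos (Real.pi / 5)) /
      (Real.cos (Real.pi / 5) + Real.cos (θ - 13 * Real.pi / 10)) := rfl

lemma sinSqAngle_one (θ : ℝ) : sinSqAngle θ 1 =
    (Real.cos (13 * Real.pi / 20) + Real.cos (Real.pi / 20)) /
      (Real.cos (Real.pi / 20) + Real.cos (θ - 21 * Real.pi / 20)) := rfl

lemma sinSqAngle_two (θ : ℝ) : sinSqAngle θ 2 =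
    2 * Real.cos (Real.pi / 4) / (Real.cos (Real.pi / 4) - Real.cos (θ - Real.pi / 4)) := rfl

lemma numerator_bounds :
    (1.118 < Real.cos (2 * Real.pi / 5) + Real.cos (Real.pi / 5) ∧
      Real.cos (2 * Real.pi / 5) + Real.cos (Real.pi / 5) < 1.11804) ∧
    (0.5332 < Real.cos (13 * Real.pi / 20) + Real.cos (Real.pi / 20) ∧
      Real.cos (13 * Real.pi / 20) + Real.cos (Real.pi / 20) < 0.5343) := by
  obtain ⟨a1, a2⟩ := cos_pi_div_five_bounds
  obtain ⟨b1, b2⟩ := cos_two_pi_div_five_bounds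
  obtain ⟨c1, c2⟩ := cos_pi_div_twenty_bounds
  obtain ⟨f1, f2⟩ := cos_thirteen_pi_div_twenty_bounds
  refine ⟨⟨?_, ?_⟩, ?_, ?_⟩ <;> linarith

lemma DenomBounds.abs_lt {x y d₀ d₁ d₂ : ℝ} (h : DenomBounds x y d₀ d₁ d₂) : |y| < 0.7072 := by
  have hy := h.sq_le
  rw [← sq_abs] at hy
  nlinarith [abs_nonneg y]

lemma DenomBounds.pos {x y d₀ d₁ d₂ : ℝ} (h : DenomBounds x y d₀ d₁ d₂) :
    1.39 < d₀ ∧ 1.14 < d₁ ∧ 1.4142 < d₂ := by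
  have hy := _root_.abs_lt.mp h.abs_lt
  have hy' := h.abs_lt
  have := h.le_x
  exact ⟨by linarith [h.l0], by linarith [h.l1], by linarith [h.l2]⟩

/-- The condition x ≤ 0.73 places θ near an end of its interval, where |sin u| is close to √2/2. The
sign of y tells which end: near 3π/2 the quotients exceed 0.67 and 0.44, near π they exceed 0.78 and
0.268. -/
lemma DenomBounds.one_lt_add {x y d₀ d₁ d₂ m n : ℝ} (h : DenomBounds x y d₀ d₁ d₂)
    (hx : x ≤ 0.73) (hm : 1.118 < m) (hn : 0.5332 < n) : 1 < m / d₀ + n / d₁ := by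
  have hx0 := h.le_x
  have hy1 := h.abs_lt
  have hy2 : 0.6834 < |y| := by
    have hsq : 0.4671 ≤ |y| ^ 2 := by
      rw [sq_abs]
      nlinarith [h.sq_add]
    nlinarith [abs_nonneg y]
  obtain ⟨g0, g1, -⟩ := h.pos
  have u0 := h.u0
  have u1 := h.u1
  have o1 := h.o1
  rcases le_or_gt 0 y with hy0 | hy0
  · rw [abs_of_nonneg hy0] at *
    have q0 : 0.67 < m / d₀ := by
      rw [lt_div_iff₀ (by linarith)]; linarith
    have q1 : 0.44 < n / d₁ := by
      rw [lt_div_iff₀ (by linarith)]; linarith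
    linarith
  · rw [abs_of_neg hy0] at *
    have q0 : 0.78 < m / d₀ := by
      rw [lt_div_iff₀ (by linarith)]; linarith
    have q1 : 0.268 < n / d₁ := by
      rw [lt_div_iff₀ (by linarith)]; linarith
    linarith

/-- The disjunction distinguishes θ near the ends, where cos u ≤ 0.73, from the middle, where sin²
φ₃ stays away from 1; `gram_estimate` needs one or the other. The last clause is used to exclude the
endpoints themselves. -/
lemma sinSqAngle_bounds {θ : ℝ} (h1 : Real.pi ≤ θ) (h2 : θ ≤ 3 * Real.pi / 2) :
    (0.6178 < sinSqAngle θ 0 ∧ sinSqAngle θ 0 < 0.9) ∧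
      (0.268 < sinSqAngle θ 1 ∧ sinSqAngle θ 1 < 0.9) ∧
      (0.8283 < sinSqAngle θ 2 ∧ sinSqAngle θ 2 ≤ 1) ∧
      (1 < sinSqAngle θ 0 + sinSqAngle θ 1 ∨ sinSqAngle θ 2 < 0.9843) ∧
      (Real.cos (θ - 5 * Real.pi / 4) = Real.cos (Real.pi / 4) →
        1 < sinSqAngle θ 0 + sinSqAngle θ 1) := by
  have hd := denomBounds h1 h2
  obtain ⟨⟨m1, m2⟩, n1, n2⟩ := numerator_bounds
  obtain ⟨f1, f2⟩ := cos_pi_div_four_bounds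
  have key : Real.cos (θ - 5 * Real.pi / 4) ≤ 0.73 → 1 < sinSqAngle θ 0 + sinSqAngle θ 1 :=
    fun h => hd.one_lt_add h m1 n1
  have hle : sinSqAngle θ 2 ≤ 1 := by
    rw [sinSqAngle_two, div_le_one (by linarith [hd.pos.2.2]), (cos_sub_eqs θ).2.2]
    have : Real.cos (Real.pi / 4) ≤ Real.cos (θ - 5 * Real.pi / 4) := by
      rw [← Real.cos_abs (θ - 5 * Real.pi / 4)]
      apply Real.cos_le_cos_of_nonneg_of_le_pi (abs_nonneg _) (by linarith)
      rw [abs_le]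
      constructor <;> linarith
    linarith
  obtain ⟨g0, g1, g2⟩ := hd.pos
  refine ⟨⟨?_, ?_⟩, ⟨?_, ?_⟩, ⟨?_, hle⟩, ?_, fun h => key (by linarith)⟩
  · rw [sinSqAngle_zero, lt_div_iff₀ (by linarith)]; linarith [hd.o0]
  · rw [sinSqAngle_zero, div_lt_iff₀ (by linarith)]; linarith
  · rw [sinSqAngle_one, lt_div_iff₀ (by linarith)]; linarith [hd.o1]
  · rw [sinSqAngle_one, div_lt_iff₀ (by linarith)]; linarith
  · rw [sinSqAngle_two, lt_div_iff₀ (by linarith)]; linarith [hd.u2, hd.x_le]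
  · rcases le_or_gt (Real.cos (θ - 5 * Real.pi / 4)) 0.73 with h | h
    · exact Or.inl (key h)
    · right
      rw [sinSqAngle_two, div_lt_iff₀ (by linarith)]; linarith [hd.l2]

lemma sinSqAngle_two_lt_one {θ : ℝ} (h : θ ∈ Set.Ioo Real.pi (3 * Real.pi / 2)) :
    sinSqAngle θ 2 < 1 := by
  have hd := denomBounds h.1.le h.2.le
  have hlt : Real.cos (Real.pi / 4) < Real.cos (θ - 5 * Real.pi / 4) := by
    rw [← Real.cos_abs (θ - 5 * Real.pi / 4)]
    apply Real.cos_lt_cos_of_nonneg_of_le_pi (abs_nonneg _) (by linarith [Real.pi_pos])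
    rw [_root_.abs_lt]
    constructor <;> linarith [h.1, h.2]
  rw [sinSqAngle_two, div_lt_one (by linarith [hd.pos.2.2]), (cos_sub_eqs θ).2.2]
  linarith

lemma cosAngle_sq {θ : ℝ} (h1 : Real.pi ≤ θ) (h2 : θ ≤ 3 * Real.pi / 2) (k : Fin 3) :
    cosAngle θ k ^ 2 = 1 - sinSqAngle θ k := by
  obtain ⟨⟨-, h0⟩, ⟨-, h1⟩, ⟨-, h2⟩, -⟩ := sinSqAngle_bounds h1 h2
  apply Real.sq_sqrt
  fin_cases k
  · change 0 ≤ 1 - sinSqAngle θ 0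
    linarith
  · change 0 ≤ 1 - sinSqAngle θ 1
    linarith
  · change 0 ≤ 1 - sinSqAngle θ 2
    linarith

lemma cosAngle_pos {θ : ℝ} (h : θ ∈ Set.Ioo Real.pi (3 * Real.pi / 2)) (k : Fin 3) :
    0 < cosAngle θ k := by
  obtain ⟨⟨-, h0⟩, ⟨-, h1⟩, -⟩ := sinSqAngle_bounds h.1.le h.2.le
  have h2 := sinSqAngle_two_lt_one h
  apply Real.sqrt_pos.mpr
  fin_cases k
  · change 0 < 1 - sinSqAngle θ 0
    linarith
  · change 0 < 1 - sinSqAngle θ 1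
    linarith
  · change 0 < 1 - sinSqAngle θ 2
    linarith

lemma cosAngle_lt_one {θ : ℝ} (h1 : Real.pi ≤ θ) (h2 : θ ≤ 3 * Real.pi / 2) (k : Fin 3) :
    cosAngle θ k < 1 := by
  have hs := cosAngle_sq h1 h2 k
  obtain ⟨⟨h0, -⟩, ⟨h1, -⟩, ⟨h2, -⟩, -⟩ := sinSqAngle_bounds h1 h2
  have : 0 < sinSqAngle θ k := by
    fin_cases k
    · change 0 < sinSqAngle θ 0
      linarith
    · change 0 < sinSqAngle θ 1
      linarith
    · change 0 < sinSqAngle θ 2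
      linarith
  nlinarith

/-- With P = r₀r₁ and Q the positive root of s₀s₁ = (1 - r₀²)(1 - r₁²), the claim is equivalent to
(r₂ - P)² ≤ Q². In terms of angles this says cos(φ₁ + φ₂) ≤ cos φ₃ ≤ cos(φ₁ - φ₂). -/
lemma gram_estimate {s0 s1 s2 r0 r1 r2 : ℝ} (p0 : 0 < r0) (p1 : 0 < r1) (p2 : 0 < r2)
    (q0 : r0 ^ 2 = 1 - s0) (q1 : r1 ^ 2 = 1 - s1) (q2 : r2 ^ 2 = 1 - s2)
    (h0 : 0.6178 < s0) (h0' : s0 < 0.9) (h1 : 0.268 < s1) (h1' : s1 < 0.9) (h2 : 0.8283 < s2)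
    (h3 : 1 < s0 + s1 ∨ s2 < 0.9843) :
    r0 ^ 2 + r1 ^ 2 + r2 ^ 2 - 1 ≤ 2 * (r0 * r1 * r2) := by
  obtain ⟨P, hP⟩ : ∃ P, P = r0 * r1 := ⟨_, rfl⟩
  have hPpos : 0 < P := by rw [hP]; positivity
  have hPsq : P ^ 2 = (1 - s0) * (1 - s1) := by rw [hP, mul_pow, q0, q1]
  have hQ : 0.6178 * 0.268 < s0 * s1 := by gcongr
  obtain ⟨Q, hQpos, hQsq⟩ : ∃ Q, 0 < Q ∧ Q ^ 2 = s0 * s1 :=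
    ⟨Real.sqrt (s0 * s1), Real.sqrt_pos.mpr (by linarith), Real.sq_sqrt (by linarith)⟩
  have hQ2 : 0.4068 < Q := by
    apply lt_of_pow_lt_pow_left₀ 2 hQpos.le
    rw [hQsq]
    linarith
  have hr2 : r2 < 0.4144 := by
    apply lt_of_pow_lt_pow_left₀ 2 (by norm_num)
    rw [q2]
    linarith
  have hP2 : 0.09 < P := by
    apply lt_of_pow_lt_pow_left₀ 2 hPpos.le
    have : 0.1 * 0.1 < (1 - s0) * (1 - s1) := by gcongr <;> linarith
    linarith
  have k1 : r2 - P ≤ Q := by linarith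
  have k2 : P - r2 ≤ Q := by
    -- In the first case P² ≤ Q² follows from s₀ + s₁ > 1. In the second, r₂ > 0.125 and P < 0.53
    -- give P - r₂ < 0.405, while Q > 0.4068.
    rcases h3 with h3 | h3
    · have : P ≤ Q := by
        apply le_of_sq_le_sq _ hQpos.le
        rw [hPsq, hQsq]
        linarith
      linarith
    · have hr2' : 0.125 < r2 := by
        apply lt_of_pow_lt_pow_left₀ 2 p2.le
        rw [q2]
        linarith
      have hP3 : P < 0.53 := by
        apply lt_of_pow_lt_pow_left₀ 2 (by norm_num)
        have : (1 - s0) * (1 - s1) < 0.3822 * 0.732 := by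
          apply mul_lt_mul' <;> linarith
        linarith
      linarith
  have k3 : (r2 - P) ^ 2 ≤ Q ^ 2 := sq_le_sq' (by linarith) k1
  have e : (r2 - P) ^ 2 = r2 ^ 2 - 2 * (r0 * r1 * r2) + P ^ 2 := by rw [hP]; ring
  rw [e, hPsq, hQsq, q2] at k3
  rw [q0, q1, q2]
  linarith

/-- The slice of the parameter domain over `θ` never contains `α = 0`. -/
lemma angular_bound_le_one {θ : ℝ} (h : θ ∈ Set.Ioo Real.pi (3 * Real.pi / 2)) :
    (∑ k, cosAngle θ k ^ 2 - 1) / (2 * ∏ k, cosAngle θ k) ≤ 1 := by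
  have hp := cosAngle_pos h
  have hsq := cosAngle_sq h.1.le h.2.le
  obtain ⟨⟨h0, h0'⟩, ⟨h1, h1'⟩, ⟨h2, h2'⟩, h3, -⟩ := sinSqAngle_bounds h.1.le h.2.le
  rw [Fin.sum_univ_three, Fin.prod_univ_three,
    div_le_one (mul_pos two_pos (mul_pos (mul_pos (hp 0) (hp 1)) (hp 2)))]
  exact gram_estimate (hp 0) (hp 1) (hp 2) (hsq 0) (hsq 1) (hsq 2) h0 h0' h1 h1' h2 h3

theorem paramDomain_nonempty : paramDomain.Nonempty := by
  have hpi := Real.pi_pos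
  have hθ : 5 * Real.pi / 4 ∈ Set.Ioo Real.pi (3 * Real.pi / 2) := ⟨by linarith, by linarith⟩
  -- At α = π the left side is -1, so it suffices that the sum of the r_k² be at least 1. At the
  -- midpoint θ = 5π/4 the sum of the sin² φ_k is at most 0.63 + 0.3 + 0.83 < 2.
  refine ⟨(5 * Real.pi / 4, Real.pi), hθ, ⟨hpi.le, by linarith⟩, ?_⟩
  dsimp only
  rw [Real.cos_pi]
  refine lt_of_lt_of_le (by norm_num : (-1 : ℝ) < 0) ?_
  have hp := cosAngle_pos hθ
  apply div_nonneg
  · rw [Fin.sum_univ_three, cosAngle_sq hθ.1.le hθ.2.le, cosAngle_sq hθ.1.le hθ.2.le,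
      cosAngle_sq hθ.1.le hθ.2.le]
    have hd := denomBounds hθ.1.le hθ.2.le
    rw [sub_self, Real.cos_zero, Real.sin_zero] at hd
    obtain ⟨⟨m1, m2⟩, n1, n2⟩ := numerator_bounds
    obtain ⟨f1, f2⟩ := cos_pi_div_four_bounds
    have g0 := hd.l0
    have g1 := hd.l1
    have g2 := hd.l2
    rw [abs_zero] at g0 g1
    have t0 : sinSqAngle (5 * Real.pi / 4) 0 ≤ 0.63 := by
      rw [sinSqAngle_zero, div_le_iff₀ (by linarith)]; linarith
    have t1 : sinSqAngle (5 * Real.pi / 4) 1 ≤ 0.3 := by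
      rw [sinSqAngle_one, div_le_iff₀ (by linarith)]; linarith
    have t2 : sinSqAngle (5 * Real.pi / 4) 2 ≤ 0.83 := by
      rw [sinSqAngle_two, div_le_iff₀ (by linarith)]; linarith
    linarith
  · rw [Fin.prod_univ_three]
    have := hp 0
    have := hp 1
    have := hp 2
    positivity

/-! ### Parameters of a decomposition -/

lemma norm_mul_cis_arg (z : ℂ) : (‖z‖ : ℂ) * cis z.arg = z := Complex.norm_mul_exp_arg_mul_I z

/-- The angle of a rotation factor `η` in `]0, 2π[`. -/
lemma rotation_angle {η : ℂ} (h : ‖η‖ = 1) (h1 : η ≠ 1) :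
    0 < (1 - η).re ∧ cis (2 * (1 - η).arg + Real.pi) = η ∧
      0 < 2 * (1 - η).arg + Real.pi ∧ 2 * (1 - η).arg + Real.pi < 2 * Real.pi := by
  have hre : 0 < (1 - η).re := by
    have hle : η.re ≤ 1 := by rw [← h]; exact Complex.re_le_norm η
    have hne : η.re ≠ 1 := by
      intro e
      have h2 : η.re ^ 2 + η.im ^ 2 = 1 := by
        have := Complex.sq_norm η
        rw [h, Complex.normSq_apply] at this
        linarith
      rw [e] at h2
      apply h1
      apply Complex.ext
      · simpa using e
      · have : η.im ^ 2 = 0 := by linarith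
        simpa using this
    rw [Complex.sub_re, Complex.one_re]
    linarith [lt_of_le_of_ne hle hne]
  have harg := abs_lt.mp (Complex.abs_arg_lt_pi_div_two_iff.mpr (Or.inl hre))
  refine ⟨hre, ?_, by linarith [harg.1], by linarith [harg.2]⟩
  set w := 1 - η with hw
  have hw0 : w ≠ 0 := by
    intro e
    rw [e] at hre
    simp at hre
  have hn : (‖w‖ : ℂ) ≠ 0 := by simpa using hw0
  have e1 := norm_mul_cis_arg w
  have e2 : w * (starRingEnd ℂ) w = (‖w‖ : ℂ) ^ 2 := by
    rw [Complex.mul_conj, Complex.normSq_eq_norm_sq]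
    norm_cast
  -- Hence w² = |w|²(-η): the argument of w = 1 - η is half that of -η, and doubling it and adding π
  -- gives an angle of η.
  have e3 : (starRingEnd ℂ) w * -η = w := by
    rw [hw, map_sub, map_one]
    linear_combination mul_conj_of_norm_one h
  rw [cis_add, cis_pi, two_mul, cis_add]
  have e4 : (starRingEnd ℂ) w ≠ 0 := by simpa using hw0
  have e5 : (‖w‖ : ℂ) ^ 2 * (cis w.arg * cis w.arg) = (‖w‖ : ℂ) ^ 2 * -η := by
    rw [← e2]
    apply mul_left_cancel₀ e4
    calc (starRingEnd ℂ) w * (w * (starRingEnd ℂ) w * (cis w.arg * cis w.arg))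
        = (starRingEnd ℂ) w * ((‖w‖ : ℂ) ^ 2 * (cis w.arg * cis w.arg)) := by rw [e2]
      _ = (starRingEnd ℂ) w * (((‖w‖ : ℂ) * cis w.arg) * ((‖w‖ : ℂ) * cis w.arg)) := by ring
      _ = (starRingEnd ℂ) w * (w * w) := by rw [e1]
      _ = (starRingEnd ℂ) w * (w * ((starRingEnd ℂ) w * -η)) := by rw [e3]
      _ = _ := by ring
  have e6 := mul_left_cancel₀ (pow_ne_zero 2 hn) e5
  rw [e6]
  ring

/-- The parameters `(θ, α)` of a pair of normalized lifts. -/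
def params (M N : Matrix (Fin 3) (Fin 3) ℂ) : ℝ × ℝ :=
  (2 * (rotationElement M N).trace.arg + Real.pi, (angularElement M N).trace.arg + Real.pi)

lemma theta_mem_of_cos {θ : ℝ} (h0 : 0 < θ) (h1 : θ < 2 * Real.pi)
    (h : Real.cos (Real.pi / 4) ≤ Real.cos (θ - 5 * Real.pi / 4)) :
    Real.pi ≤ θ ∧ θ ≤ 3 * Real.pi / 2 := by
  have hpi := Real.pi_pos
  have hc := cos_pi_div_four_bounds.1
  have hlow : -Real.pi < θ - 5 * Real.pi / 4 := by
    by_contra hcon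
    push Not at hcon
    have : 0 ≤ Real.cos (θ - 5 * Real.pi / 4 + Real.pi) :=
      Real.cos_nonneg_of_mem_Icc ⟨by linarith, by linarith⟩
    rw [Real.cos_add_pi] at this
    linarith
  have habs : |θ - 5 * Real.pi / 4| ≤ Real.pi / 4 := by
    by_contra hcon
    push Not at hcon
    have := Real.cos_lt_cos_of_nonneg_of_le_pi (by positivity)
      (abs_le.mpr ⟨hlow.le, by linarith⟩) hcon
    rw [Real.cos_abs] at this
    linarith
  rw [abs_le] at habs
  constructor <;> linarith [habs.1, habs.2]

/-- Cauchy–Schwarz in the orthogonal complement of p, where the form is positive definite. -/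
lemma herm_norm_sq_le_one {p c d : Fin 3 → ℂ} (hp : IsNegative p) (hc : herm c c = 1)
    (hd : herm d d = 1) (hpc : herm p c = 0) (hpd : herm p d = 0) : ‖herm d c‖ ^ 2 ≤ 1 := by
  set v := d - herm d c • c with hv
  have hvp : herm v p = 0 := by
    rw [hv, herm_sub_left, herm_smul_left, herm_eq_zero_symm hpc, herm_eq_zero_symm hpd]
    simp
  have hvv : (herm v v).re = 1 - ‖herm d c‖ ^ 2 := by
    have e : herm v v = 1 - herm d c * herm c d := by
      rw [hv]
      simp only [herm_sub_left, herm_sub_right, herm_smul_left, herm_smul_right, hc, hd, conj_herm]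
      ring
    rw [e, herm_mul_herm_swap, Complex.sub_re, Complex.one_re, Complex.ofReal_re]
  by_cases h0 : v = 0
  · rw [h0] at hvv
    simp at hvv
    linarith
  · have := herm_self_pos_of_orthogonal hp hvp h0
    linarith

lemma eq_cosAngle_of_sq {r θ : ℝ} {k : Fin 3} (hr : 0 ≤ r) (h : r ^ 2 = 1 - sinSqAngle θ k) :
    r = cosAngle θ k := by
  rw [cosAngle, ← h, Real.sqrt_sq hr]

lemma eq_div_sub_of {t d n : ℝ} (hn : 0 < n) (h : (1 - t) * d = n) : t = 1 - n / d := by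
  have hd : d ≠ 0 := by
    rintro rfl
    linarith [mul_zero (1 - t)]
  rw [← h, mul_div_cancel_right₀ _ hd]
  ring

/-! ### From a decomposition to its parameters. -/

namespace Triple

variable {T : Triple} {c : Fin 3 → Fin 3 → ℂ} {η : Fin 3 → ℂ}

lemma Dec.eta_one (h : T.Dec c η) {θ : ℝ} (hθ : η 0 = cis θ) :
    η 1 = cis (θ - Real.pi / 2) := by
  have e := congrArg (starRingEnd ℂ) h.detA
  rw [map_mul, map_mul, Complex.conj_conj, conj_cis, conj_cis, hθ, conj_cis] at e
  have e2 := congrArg (fun x => cis θ * x) e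
  simp only [← cis_add, ← mul_assoc] at e2
  rw [add_neg_cancel, cis_zero, one_mul] at e2
  rw [e2, cis_eq_iff]
  refine ⟨-1, ?_⟩
  push_cast
  ring

lemma Dec.eta_two (h : T.Dec c η) {θ : ℝ} (hθ : η 0 = cis θ) :
    η 2 = cis (θ - 21 * Real.pi / 10) := by
  have e := h.detC
  rw [hθ, conj_cis] at e
  have e2 := congrArg (fun x => x * cis θ) e
  simp only [mul_assoc, ← cis_add] at e2
  rw [neg_add_cancel, cis_zero, mul_one] at e2
  rw [e2, cis_eq_iff]
  refine ⟨2, ?_⟩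
  push_cast
  ring

/-- The three trace equations are linear in the squared Gram moduli and solve to 1 - sin² φ_k. The
equation for A also confines θ. -/
lemma Dec.norms (h : T.Dec c η) {θ : ℝ} (hθ : η 0 = cis θ) (h0 : 0 < θ) (h1 : θ < 2 * Real.pi) :
    Real.pi ≤ θ ∧ θ ≤ 3 * Real.pi / 2 ∧ ‖herm (c 2) (c 1)‖ ^ 2 = 1 - sinSqAngle θ 0 ∧
      ‖herm (c 0) (c 2)‖ ^ 2 = 1 - sinSqAngle θ 1 ∧
      ‖herm (c 1) (c 0)‖ ^ 2 = 1 - sinSqAngle θ 2 := by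
  have eA := h.traceA
  have eB := h.traceB
  have eC := h.traceC
  rw [h.eta_one hθ, conj_cis, hθ, trace_iff_A] at eA
  rw [h.eta_one hθ, h.eta_two hθ, conj_cis, trace_iff_B] at eB
  rw [h.eta_two hθ, hθ, conj_cis, trace_iff_C] at eC
  have hle := herm_norm_sq_le_one T.hA.frame.isNegative (h.unit 0) (h.unit 1) h.p0 h.p1
  have hc4 := cos_pi_div_four_bounds.1
  obtain ⟨⟨m1, -⟩, n1, -⟩ := numerator_bounds
  -- The trace equation of A reads (1 - t)(cos π/4 + cos u) = 2 cos π/4 with 0 ≤ 1 - t ≤ 1, which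
  -- forces cos u ≥ cos π/4.
  have hcos : Real.cos (Real.pi / 4) ≤ Real.cos (θ - 5 * Real.pi / 4) := by
    have hpos : 0 < Real.cos (Real.pi / 4) + Real.cos (θ - 5 * Real.pi / 4) := by
      by_contra hcon
      push Not at hcon
      have := mul_nonneg_of_nonpos_of_nonpos hcon (by linarith : -(1 - ‖herm (c 1) (c 0)‖ ^ 2) ≤ 0)
      linarith
    have : (1 - ‖herm (c 1) (c 0)‖ ^ 2) *
        (Real.cos (Real.pi / 4) + Real.cos (θ - 5 * Real.pi / 4)) ≤
        1 * (Real.cos (Real.pi / 4) + Real.cos (θ - 5 * Real.pi / 4)) := by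
      gcongr
      linarith [sq_nonneg ‖herm (c 1) (c 0)‖]
    linarith
  obtain ⟨hθ1, hθ2⟩ := theta_mem_of_cos h0 h1 hcos
  refine ⟨hθ1, hθ2, ?_, ?_, ?_⟩
  · rw [sinSqAngle_zero]
    exact eq_div_sub_of (by linarith) eB
  · rw [sinSqAngle_one]
    exact eq_div_sub_of (by linarith) eC
  · rw [sinSqAngle_two, (cos_sub_eqs θ).2.2, sub_neg_eq_add]
    exact eq_div_sub_of (by linarith) eA

/-- At either endpoint the third Gram entry vanishes, and the Gram determinant becomes sin² φ₁ +
sin² φ₂ - 1 > 0, contrary to its sign in signature (2,1). -/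
lemma Dec.theta_mem (h : T.Dec c η) (hT : ¬ T.Degenerate) {θ : ℝ} (hθ : η 0 = cis θ) (h0 : 0 < θ)
    (h1 : θ < 2 * Real.pi) : θ ∈ Set.Ioo Real.pi (3 * Real.pi / 2) := by
  obtain ⟨hθ1, hθ2, e0, e1, e2⟩ := h.norms hθ h0 h1
  have key : Real.cos (θ - 5 * Real.pi / 4) ≠ Real.cos (Real.pi / 4) := by
    intro he
    have hs := (sinSqAngle_bounds hθ1 hθ2).2.2.2.2 he
    have h2 : ‖herm (c 1) (c 0)‖ ^ 2 = 0 := by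
      rw [e2, sinSqAngle_two, (cos_sub_eqs θ).2.2, he, sub_neg_eq_add, ← two_mul, div_self,
        sub_self]
      linarith [cos_pi_div_four_bounds.1]
    have h3 : herm (c 1) (c 0) = 0 := by simpa using h2
    have hg := h.gram hT
    rw [e0, e1, h2, h3, mul_zero, Complex.zero_re] at hg
    linarith
  have hpi := Real.pi_pos
  refine ⟨lt_of_le_of_ne hθ1 ?_, lt_of_le_of_ne hθ2 ?_⟩
  · intro e
    apply key
    rw [← e, show Real.pi - 5 * Real.pi / 4 = -(Real.pi / 4) by ring, Real.cos_neg]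
  · intro e
    apply key
    rw [e, show 3 * Real.pi / 2 - 5 * Real.pi / 4 = Real.pi / 4 by ring]

/-- The angle α is arg(-P) + π for the triple product P, and its norm is known from `Dec.norms`; the
Gram inequality then bounds cos α. The last two clauses keep both traces off the branch cut of
`Complex.arg`, as continuity requires. -/
theorem Dec.hasParameters (h : T.Dec c η) (hT : ¬ T.Degenerate) :
    params (mat T.A) (mat T.B) ∈ paramDomain ∧
      HasParameters c η (params (mat T.A) (mat T.B)) ∧
      0 < (rotationElement (mat T.A) (mat T.B)).trace.re ∧
      (angularElement (mat T.A) (mat T.B)).trace ∈ Complex.slitPlane := by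
  obtain ⟨hre, hcis, hθ0, hθ1⟩ := rotation_angle (h.norm_one 0) (h.ne_one 0)
  have hκ : 0 < ‖herm T.q (c 0)‖ ^ 2 := by
    have := norm_pos_iff.mpr (h.q0 hT)
    positivity
  have harg : (rotationElement (mat T.A) (mat T.B)).trace.arg = (1 - η 0).arg := by
    rw [h.trace_rotationElement, Complex.arg_real_mul _ hκ]
  obtain ⟨s, hs, hang⟩ := h.trace_angularElement hT
  set θ := 2 * (1 - η 0).arg + Real.pi with hθdef
  set P := herm (c 2) (c 1) * herm (c 0) (c 2) * herm (c 1) (c 0) with hP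
  have hargα : (angularElement (mat T.A) (mat T.B)).trace.arg = (-P).arg := by
    rw [hang, Complex.arg_real_mul _ hs]
  set α := (-P).arg + Real.pi with hαdef
  have hparams : params (mat T.A) (mat T.B) = (θ, α) := by
    rw [params, harg, hargα]
  have hPα : P = (‖P‖ : ℂ) * cis α := by
    have := norm_mul_cis_arg (-P)
    rw [hαdef, cis_add, cis_pi, ← norm_neg P]
    linear_combination this
  have hθ := h.theta_mem hT hcis.symm hθ0 hθ1
  obtain ⟨-, -, e0, e1, e2⟩ := h.norms hcis.symm hθ0 hθ1
  have r0 := eq_cosAngle_of_sq (norm_nonneg _) e0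
  have r1 := eq_cosAngle_of_sq (norm_nonneg _) e1
  have r2 := eq_cosAngle_of_sq (norm_nonneg _) e2
  have hp0 := cosAngle_pos hθ 0
  have hp1 := cosAngle_pos hθ 1
  have hp2 := cosAngle_pos hθ 2
  have hPn : ‖P‖ = cosAngle θ 0 * cosAngle θ 1 * cosAngle θ 2 := by
    rw [hP, norm_mul, norm_mul, r0, r1, r2]
  have hPpos : 0 < ‖P‖ := by rw [hPn]; positivity
  have hbound : Real.cos α < (∑ k, cosAngle θ k ^ 2 - 1) / (2 * ∏ k, cosAngle θ k) := by
    rw [Fin.sum_univ_three, Fin.prod_univ_three, lt_div_iff₀ (by positivity), ← hPn]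
    have hg := h.gram hT
    have hre : P.re = ‖P‖ * Real.cos α := by
      conv_lhs => rw [hPα]
      rw [Complex.re_ofReal_mul, cis_re]
    rw [← hP, hre, r0, r1, r2] at hg
    linarith
  -- As arg takes values in ]-π, π], α lies in ]0, 2π]. Only the value 2π has to be excluded, and
  -- there cos α = 1 violates the bound.
  have hα2 : α ≠ 2 * Real.pi := by
    intro e
    rw [e, Real.cos_two_pi] at hbound
    linarith [angular_bound_le_one hθ]
  have hαm : α ∈ Set.Ico 0 (2 * Real.pi) := by
    have u1 := Complex.neg_pi_lt_arg (-P)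
    have u2 := Complex.arg_le_pi (-P)
    exact ⟨by linarith, lt_of_le_of_ne (by linarith) hα2⟩
  have hprod : (∏ k : Fin 3, herm (c (k - 1)) (c (k + 1))) = P := by
    rw [Fin.prod_univ_three]
    rfl
  rw [hparams]
  refine ⟨⟨hθ, hαm, hbound⟩, ⟨?_, ?_, ?_⟩, ?_, ?_⟩
  · intro k
    fin_cases k
    · exact hcis.symm
    · exact h.eta_one hcis.symm
    · exact h.eta_two hcis.symm
  · intro k
    fin_cases k
    · exact r0
    · exact r1
    · exact r2
  · refine ⟨?_, ?_⟩
    · rw [hprod]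
      exact norm_pos_iff.mp hPpos
    · rw [hprod]
      exact hPα
  · rw [h.trace_rotationElement, Complex.re_ofReal_mul]
    exact mul_pos hκ hre
  · rw [Complex.mem_slitPlane_iff_arg, hargα]
    refine ⟨fun e => hα2 (by rw [hαdef, e]; ring), ?_⟩
    rw [hang]
    exact mul_ne_zero (by exact_mod_cast hs.ne') (neg_ne_zero.mpr (norm_pos_iff.mp hPpos))

end Triple

/-- The conditions fix e^{iθ} and e^{iα}; two values of θ or of α allowed by the domain differ by
less than 2π. -/
lemma HasParameters.unique {c : Fin 3 → Fin 3 → ℂ} {η : Fin 3 → ℂ} {x y : ℝ × ℝ}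
    (hx : x ∈ paramDomain) (hy : y ∈ paramDomain) (h : HasParameters c η x)
    (h' : HasParameters c η y) : x = y := by
  have hpi := Real.pi_pos
  have small : ∀ {s t : ℝ}, |s - t| < 2 * Real.pi → cis s = cis t → s = t := by
    intro s t hst e
    obtain ⟨n, hn⟩ := (cis_eq_iff s t).mp e
    rw [hn, abs_mul, abs_of_pos (by positivity : 0 < 2 * Real.pi)] at hst
    have h1 : |(n : ℝ)| < 1 := by
      by_contra hcon
      push Not at hcon
      nlinarith
    have h2 : n = 0 := by
      have : |n| < 1 := by exact_mod_cast h1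
      exact Int.abs_lt_one_iff.mp this
    rw [h2] at hn
    simp at hn
    linarith
  obtain ⟨hx1, hx2, -⟩ := hx
  obtain ⟨hy1, hy2, -⟩ := hy
  apply Prod.ext
  · apply small
    · rw [abs_lt]
      constructor <;> linarith [hx1.1, hx1.2, hy1.1, hy1.2]
    · exact (h.1 0).symm.trans (h'.1 0)
  · apply small
    · rw [abs_lt]
      constructor <;> linarith [hx2.1, hx2.2, hy2.1, hy2.2]
    · obtain ⟨h0, e1⟩ := h.2.2
      have e2 := h'.2.2.2
      have hn : (‖∏ k : Fin 3, herm (c (k - 1)) (c (k + 1))‖ : ℂ) ≠ 0 := by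
        simpa only [ne_eq, Complex.ofReal_eq_zero, norm_eq_zero] using h0
      exact mul_left_cancel₀ hn (e1.symm.trans e2)

/-! ### Configurations of polar vectors up to isometry -/

lemma herm_colMatrix_mulVec (c : Fin 3 → Fin 3 → ℂ) (z w : Fin 3 → ℂ) :
    herm (colMatrix (c 0) (c 1) (c 2) *ᵥ z) (colMatrix (c 0) (c 1) (c 2) *ᵥ w) =
      ∑ i, ∑ j, z i * (starRingEnd ℂ) (w j) * herm (c i) (c j) := by
  simp only [colMatrix_mulVec, herm_add_left, herm_add_right, herm_smul_left, herm_smul_right,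
    Fin.sum_univ_three]
  ring

/-- The matrix that takes one family to the other preserves the form on a basis. Only the family `c`
is assumed independent. -/
lemma exists_isometry_of_gram_eq {c d : Fin 3 → Fin 3 → ℂ}
    (hdet : (colMatrix (c 0) (c 1) (c 2)).det ≠ 0)
    (h : ∀ i j, herm (c i) (c j) = herm (d i) (d j)) :
    ∃ g : U21, ∀ k, mat g *ᵥ c k = d k := by
  set X := colMatrix (c 0) (c 1) (c 2) with hX
  set Y := colMatrix (d 0) (d 1) (d 2) with hY
  have hu : IsUnit X.det := isUnit_iff_ne_zero.mpr hdet
  have hz : ∀ z, X *ᵥ (X⁻¹ *ᵥ z) = z := fun z => by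
    rw [mulVec_mulVec, mul_nonsing_inv _ hu, one_mulVec]
  have hz' : ∀ z, X⁻¹ *ᵥ (X *ᵥ z) = z := fun z => by
    rw [mulVec_mulVec, nonsing_inv_mul _ hu, one_mulVec]
  refine ⟨ofIsometry (Y * X⁻¹) ?_, ?_⟩
  · intro z w
    rw [← mulVec_mulVec, ← mulVec_mulVec]
    conv_rhs => rw [← hz z, ← hz w]
    rw [hX, hY, herm_colMatrix_mulVec, herm_colMatrix_mulVec]
    simp only [h]
  · have key : ∀ z, (Y * X⁻¹) *ᵥ (X *ᵥ z) = Y *ᵥ z := fun z => by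
      rw [← mulVec_mulVec, hz']
    intro k
    rw [mat_ofIsometry]
    fin_cases k
    · have := key ![1, 0, 0]
      simpa [hX, hY, colMatrix_mulVec] using this
    · have := key ![0, 1, 0]
      simpa [hX, hY, colMatrix_mulVec] using this
    · have := key ![0, 0, 1]
      simpa [hX, hY, colMatrix_mulVec] using this

lemma norm_div_eq_one {a b : ℂ} (hb : b ≠ 0) (h : ‖a‖ = ‖b‖) : ‖a / b‖ = 1 := by
  rw [norm_div, h, div_self (norm_ne_zero_iff.mpr hb)]

lemma conj_div_of_norm_eq {a b : ℂ} (ha : a ≠ 0) (hb : b ≠ 0) (h : ‖a‖ = ‖b‖) :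
    (starRingEnd ℂ) (a / b) = b / a := by
  have := mul_conj_of_norm_one (norm_div_eq_one hb h)
  field_simp at this ⊢
  linear_combination this

/-- Polar vectors are defined only up to phase. Rescaling `c' 1` and `c' 2` matches two Gram
entries, and equality of the triple products then matches the third. -/
lemma exists_isometry_of_invariants {c c' : Fin 3 → Fin 3 → ℂ}
    (hdet : (colMatrix (c 0) (c 1) (c 2)).det ≠ 0)
    (hu : ∀ k, herm (c k) (c k) = 1) (hu' : ∀ k, herm (c' k) (c' k) = 1)
    (h1 : ‖herm (c 0) (c 2)‖ = ‖herm (c' 0) (c' 2)‖)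
    (h2 : ‖herm (c 1) (c 0)‖ = ‖herm (c' 1) (c' 0)‖)
    (hprod : herm (c 2) (c 1) * herm (c 0) (c 2) * herm (c 1) (c 0) =
      herm (c' 2) (c' 1) * herm (c' 0) (c' 2) * herm (c' 1) (c' 0))
    (hne : herm (c 2) (c 1) * herm (c 0) (c 2) * herm (c 1) (c 0) ≠ 0) :
    ∃ (g : U21) (u : Fin 3 → ℂ), (∀ k, ‖u k‖ = 1) ∧ ∀ k, mat g *ᵥ c k = u k • c' k := by
  have hne' := hne
  rw [hprod] at hne'
  obtain ⟨⟨n0, n1⟩, n2⟩ := (by simpa [not_or] using hne :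
    (herm (c 2) (c 1) ≠ 0 ∧ herm (c 0) (c 2) ≠ 0) ∧ herm (c 1) (c 0) ≠ 0)
  obtain ⟨⟨n0', n1'⟩, n2'⟩ := (by simpa [not_or] using hne' :
    (herm (c' 2) (c' 1) ≠ 0 ∧ herm (c' 0) (c' 2) ≠ 0) ∧ herm (c' 1) (c' 0) ≠ 0)
  -- These phases are dictated by the entries (1,0) and (0,2), with `c' 0` left unscaled.
  set u1 := herm (c 1) (c 0) / herm (c' 1) (c' 0) with hu1
  set u2 := herm (c' 0) (c' 2) / herm (c 0) (c 2) with hu2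
  have hn1 : ‖u1‖ = 1 := norm_div_eq_one n2' h2
  have hn2 : ‖u2‖ = 1 := norm_div_eq_one n1 h1.symm
  have cu1 : (starRingEnd ℂ) u1 = herm (c' 1) (c' 0) / herm (c 1) (c 0) :=
    conj_div_of_norm_eq n2 n2' h2
  have cu2 : (starRingEnd ℂ) u2 = herm (c 0) (c 2) / herm (c' 0) (c' 2) :=
    conj_div_of_norm_eq n1' n1 h1.symm
  set d : Fin 3 → Fin 3 → ℂ := ![c' 0, u1 • c' 1, u2 • c' 2] with hd
  have e10 : herm (c 1) (c 0) = herm (d 1) (d 0) := by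
    change _ = herm (u1 • c' 1) (c' 0)
    rw [herm_smul_left, hu1]
    field_simp
  have e02 : herm (c 0) (c 2) = herm (d 0) (d 2) := by
    change _ = herm (c' 0) (u2 • c' 2)
    rw [herm_smul_right, cu2]
    field_simp
  have e21 : herm (c 2) (c 1) = herm (d 2) (d 1) := by
    change _ = herm (u2 • c' 2) (u1 • c' 1)
    rw [herm_smul_left, herm_smul_right, cu1, hu2]
    field_simp
    linear_combination hprod
  have ed : ∀ k, herm (d k) (d k) = 1 := by
    intro k
    fin_cases k
    · exact hu' 0
    · change herm (u1 • c' 1) (u1 • c' 1) = 1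
      rw [herm_smul_left, herm_smul_right, hu', mul_one, mul_conj_of_norm_one hn1]
    · change herm (u2 • c' 2) (u2 • c' 2) = 1
      rw [herm_smul_left, herm_smul_right, hu', mul_one, mul_conj_of_norm_one hn2]
  have hgram : ∀ i j, herm (c i) (c j) = herm (d i) (d j) := by
    intro i j
    fin_cases i <;> fin_cases j
    · exact (hu 0).trans (ed 0).symm
    · exact (conj_herm _ _).symm.trans ((congrArg _ e10).trans (conj_herm _ _))
    · exact e02
    · exact e10
    · exact (hu 1).trans (ed 1).symm
    · exact (conj_herm _ _).symm.trans ((congrArg _ e21).trans (conj_herm _ _))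
    · exact (conj_herm _ _).symm.trans ((congrArg _ e02).trans (conj_herm _ _))
    · exact e21
    · exact (hu 2).trans (ed 2).symm
  obtain ⟨g, hg⟩ := exists_isometry_of_gram_eq hdet hgram
  refine ⟨g, ![1, u1, u2], ?_, ?_⟩
  · intro k
    fin_cases k
    · exact norm_one
    · exact hn1
    · exact hn2
  · intro k
    rw [hg]
    fin_cases k
    · exact (one_smul ℂ (c' 0)).symm
    · rfl
    · rfl

lemma conj_reflMatrix {g : U21} {c c' : Fin 3 → ℂ} {u : ℂ} (hu : ‖u‖ = 1)
    (h : mat g *ᵥ c = u • c') (η : ℂ) :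
    mat g * reflMatrix c η * mat g⁻¹ = reflMatrix c' η := by
  rw [reflMatrix, reflMatrix, Matrix.mul_add, Matrix.add_mul, Matrix.mul_one, mat_mul_mat_inv,
    Matrix.mul_smul, Matrix.smul_mul, conj_rankOne, h, rankOne_smul, hu]
  simp

lemma conj_mul_mat (g : U21) (M N : Matrix (Fin 3) (Fin 3) ℂ) :
    mat g * (M * N) * mat g⁻¹ = (mat g * M * mat g⁻¹) * (mat g * N * mat g⁻¹) := by
  have : mat g⁻¹ * (mat g * (N * mat g⁻¹)) = N * mat g⁻¹ := by
    rw [← Matrix.mul_assoc, mat_inv_mul_mat, Matrix.one_mul]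
  simp only [Matrix.mul_assoc, this]

/-! ### Conjugacy of representations -/

lemma equiv_of_conj {ρ ρ' : Rep 4 5 20} (G : PU21) (h0 : ρ' (gen 0) = G * ρ (gen 0) * G⁻¹)
    (h1 : ρ' (gen 1) = G * ρ (gen 1) * G⁻¹) (h2 : ρ' (gen 2) = G * ρ (gen 2) * G⁻¹) :
    (⟦ρ⟧ : RepClasses 4 5 20) = ⟦ρ'⟧ := by
  apply Quotient.sound
  refine ⟨G, fun γ => ?_⟩
  have : ρ' = (MulAut.conj G).toMonoidHom.comp ρ := by
    apply PresentedGroup.ext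
    intro k
    fin_cases k
    · exact h0
    · exact h1
    · exact h2
  rw [this]
  rfl

lemma Triple.Lifts.equiv_of_conj {T T' : Triple} {ρ ρ' : Rep 4 5 20} (h : T.Lifts ρ)
    (h' : T'.Lifts ρ') {g : U21} (hA : mat T'.A = mat g * mat T.A * mat g⁻¹)
    (hB : mat T'.B = mat g * mat T.B * mat g⁻¹) :
    (⟦ρ⟧ : RepClasses 4 5 20) = ⟦ρ'⟧ := by
  have eA : T'.A = g * T.A * g⁻¹ := mat_injective hA
  have eB : T'.B = g * T.B * g⁻¹ := mat_injective hB
  have eC : T'.C = g * T.C * g⁻¹ := by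
    rw [T'.C_eq, T.C_eq, eA, eB]
    group
  apply CHyp.equiv_of_conj (toPU g)
  · rw [← h.1, ← h'.1, eA, map_mul, map_mul, map_inv]
  · rw [← h.2.1, ← h'.2.1, eB, map_mul, map_mul, map_inv]
  · rw [← h.2.2, ← h'.2.2, eC, map_mul, map_mul, map_inv]

lemma HasParameters.norms {c : Fin 3 → Fin 3 → ℂ} {η : Fin 3 → ℂ} {x : ℝ × ℝ}
    (h : HasParameters c η x) : ‖herm (c 2) (c 1)‖ = cosAngle x.1 0 ∧
      ‖herm (c 0) (c 2)‖ = cosAngle x.1 1 ∧ ‖herm (c 1) (c 0)‖ = cosAngle x.1 2 :=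
  ⟨h.2.1 0, h.2.1 1, h.2.1 2⟩

lemma HasParameters.prod {c : Fin 3 → Fin 3 → ℂ} {η : Fin 3 → ℂ} {x : ℝ × ℝ}
    (h : HasParameters c η x) :
    herm (c 2) (c 1) * herm (c 0) (c 2) * herm (c 1) (c 0) ≠ 0 ∧
    herm (c 2) (c 1) * herm (c 0) (c 2) * herm (c 1) (c 0) =
      ((cosAngle x.1 0 * cosAngle x.1 1 * cosAngle x.1 2 : ℝ) : ℂ) * cis x.2 := by
  obtain ⟨h0, h1⟩ := h.2.2
  rw [Fin.prod_univ_three] at h0 h1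
  refine ⟨h0, ?_⟩
  obtain ⟨e0, e1, e2⟩ := h.norms
  rw [← e0, ← e1, ← e2, ← norm_mul, ← norm_mul]
  exact h1

/-- The parameters determine the rotation factors, the moduli of the Gram entries and their triple
product. An isometry therefore carries one triangle of mirrors to the other and conjugates the
reflections. -/
theorem Triple.equiv_of_params {T T' : Triple} {ρ ρ' : Rep 4 5 20} (h : T.Lifts ρ)
    (h' : T'.Lifts ρ') (hT : ¬ T.Degenerate) (hT' : ¬ T'.Degenerate)
    (hp : params (mat T.A) (mat T.B) = params (mat T'.A) (mat T'.B)) :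
    (⟦ρ⟧ : RepClasses 4 5 20) = ⟦ρ'⟧ := by
  obtain ⟨c, η, hd⟩ := T.exists_decomposition hT
  obtain ⟨c', η', hd'⟩ := T'.exists_decomposition hT'
  have D := T.dec_of_decomposition hd
  have D' := T'.dec_of_decomposition hd'
  obtain ⟨-, P, -⟩ := D.hasParameters hT
  obtain ⟨-, P', -⟩ := D'.hasParameters hT'
  rw [← hp] at P'
  have hη : η = η' := funext fun k => (P.1 k).trans (P'.1 k).symm
  subst hη
  obtain ⟨-, a1, a2⟩ := P.norms
  obtain ⟨-, b1, b2⟩ := P'.norms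
  obtain ⟨g, u, hu, hg⟩ := exists_isometry_of_invariants (D.det_ne_zero hT) D.unit D'.unit
    (a1.trans b1.symm) (a2.trans b2.symm) (P.prod.2.trans P'.prod.2.symm)
    P.prod.1
  apply h.equiv_of_conj h' (g := g)
  · rw [D.A_eq, D'.A_eq, conj_mul_mat, conj_reflMatrix (hu 0) (hg 0), conj_reflMatrix (hu 1) (hg 1)]
  · rw [D.B_eq, D'.B_eq, conj_mul_mat, conj_reflMatrix (hu 1) (hg 1), conj_reflMatrix (hu 2) (hg 2)]

/-! ### The representation of a triple -/

lemma IsNormalForm.pow {g : U21} {μ ν : ℂ} {a b p : Fin 3 → ℂ} (h : IsNormalForm g μ ν a b p)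
    (n : ℕ) : IsNormalForm (g ^ n) (μ ^ n) (ν ^ n) a b p := by
  refine ⟨h.frame, ?_⟩
  induction n with
  | zero => simp [ellMatrix]
  | succ n ih =>
    rw [_root_.pow_succ, mat_mul, ih]
    apply ext_mulVec
    intro z
    rw [← mulVec_mulVec, ellMatrix_mulVec, ellMatrix_mulVec, (h.herm_apply z).1,
      (h.herm_apply z).2.1, h.mat_eq, ellMatrix_mulVec]
    module

lemma IsNormalForm.toPU_pow {g : U21} {s t : ℝ} {a b p : Fin 3 → ℂ}
    (h : IsNormalForm g (cis s) (cis t) a b p) (n : ℕ) (hs : cis (n * s) = 1)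
    (ht : cis (n * t) = 1) : toPU g ^ n = 1 := by
  have := (h.pow n).mat_eq
  rw [cis_pow, cis_pow, hs, ht] at this
  have e : g ^ n = 1 := by
    apply mat_injective
    rw [this]
    simp [ellMatrix]
  rw [← map_pow, e, map_one]

/-- The representation with normalized lift `T`. -/
def Triple.toRep (T : Triple) : Rep 4 5 20 :=
  PresentedGroup.toGroup (f := ![toPU T.A, toPU T.B, toPU T.C]) (by
    intro r hr
    simp only [triangleRels, Set.mem_insert_iff, Set.mem_singleton_iff] at hr
    rcases hr with rfl | rfl | rfl | rfl
    · rw [map_pow, FreeGroup.lift_apply_of]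
      apply T.hA.toPU_pow 4
      · rw [← cis_int_two_pi 3]; congr 1; push_cast; ring
      · rw [← cis_int_two_pi 2]; congr 1; push_cast; ring
    · rw [map_pow, FreeGroup.lift_apply_of]
      apply T.hB.toPU_pow 5
      · rw [← cis_int_two_pi 3]; congr 1; push_cast; ring
      · rw [← cis_int_two_pi 1]; congr 1; push_cast; ring
    · rw [map_pow, FreeGroup.lift_apply_of]
      apply T.hC.toPU_pow 20
      · rw [← cis_int_two_pi 16]; congr 1; push_cast; ring
      · rw [← cis_int_two_pi 3]; congr 1; push_cast; ring
    · rw [map_mul, map_mul, FreeGroup.lift_apply_of, FreeGroup.lift_apply_of,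
        FreeGroup.lift_apply_of]
      change toPU T.A * toPU T.B * toPU T.C = 1
      rw [← map_mul, ← map_mul, T.mul_eq, map_one])

lemma Triple.lifts_toRep (T : Triple) : T.Lifts T.toRep := by
  refine ⟨?_, ?_, ?_⟩ <;> rw [toRep, gen, PresentedGroup.toGroup.of] <;> rfl

/-! ### Negative vectors orthogonal to two positive vectors -/

/-- A vector orthogonal to `c` and `d` for the Hermitian form. -/
def crossVec (c d : Fin 3 → ℂ) : Fin 3 → ℂ :=
  ![(starRingEnd ℂ) (c 1 * d 2 - c 2 * d 1), (starRingEnd ℂ) (c 2 * d 0 - c 0 * d 2),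
    -(starRingEnd ℂ) (c 0 * d 1 - c 1 * d 0)]

lemma herm_crossVec_left (c d : Fin 3 → ℂ) : herm (crossVec c d) c = 0 := by
  rw [← conj_herm]
  simp [herm, crossVec]
  ring

lemma herm_crossVec_right (c d : Fin 3 → ℂ) : herm (crossVec c d) d = 0 := by
  rw [← conj_herm]
  simp [herm, crossVec]
  ring

lemma herm_crossVec_self (c d : Fin 3 → ℂ) :
    herm (crossVec c d) (crossVec c d) = herm c d * herm d c - herm c c * herm d d := by
  simp [herm, crossVec]
  ring

/-- The square norm of the cross vector is |⟨c, d⟩|² - 1, so the mirrors meet inside the complex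
hyperbolic plane. -/
lemma crossVec_isNegative {c d : Fin 3 → ℂ} (hc : herm c c = 1) (hd : herm d d = 1)
    (h : ‖herm c d‖ < 1) : IsNegative (crossVec c d) := by
  unfold IsNegative
  rw [herm_crossVec_self, hc, hd, herm_mul_herm_swap, Complex.sub_re, Complex.ofReal_re]
  have : ‖herm c d‖ ^ 2 < 1 := by
    rw [sq_lt_one_iff₀ (norm_nonneg _)]
    exact h
  simpa using this

/-! ### Standard configurations -/

/-- The numerator of the square of the last coordinate of the third standard polar vector. -/
def stdHeightNum (x : ℝ × ℝ) : ℝ :=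
  cosAngle x.1 0 ^ 2 + cosAngle x.1 1 ^ 2 + cosAngle x.1 2 ^ 2 - 1 -
    2 * (cosAngle x.1 0 * cosAngle x.1 1 * cosAngle x.1 2) * Real.cos x.2

/-- Standard polar vectors for the parameters `x = (θ, α)`. -/
def stdPolar (x : ℝ × ℝ) : Fin 3 → Fin 3 → ℂ :=
  ![![1, 0, 0],
    ![(cosAngle x.1 2 : ℂ), (Real.sqrt (1 - cosAngle x.1 2 ^ 2) : ℂ), 0],
    ![cosAngle x.1 1 * cis (-x.2),
      (cosAngle x.1 0 - cosAngle x.1 1 * cosAngle x.1 2 * cis (-x.2)) /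
        (Real.sqrt (1 - cosAngle x.1 2 ^ 2) : ℂ),
      (Real.sqrt (stdHeightNum x / (1 - cosAngle x.1 2 ^ 2)) : ℂ)]]

/-- This is the defining inequality of `paramDomain` with the denominator cleared; it is what allows
the third polar vector to have a real last coordinate. -/
lemma stdHeightNum_pos {x : ℝ × ℝ} (hx : x ∈ paramDomain) : 0 < stdHeightNum x := by
  have hp := cosAngle_pos hx.1
  have h0 := hp 0
  have h1 := hp 1
  have h2 := hp 2
  have h := hx.2.2
  rw [Fin.sum_univ_three, Fin.prod_univ_three, lt_div_iff₀ (by positivity)] at h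
  unfold stdHeightNum
  linarith

lemma one_sub_cosAngle_sq_pos {x : ℝ × ℝ} (hx : x ∈ paramDomain) : 0 < 1 - cosAngle x.1 2 ^ 2 := by
  have h1 := cosAngle_lt_one hx.1.1.le hx.1.2.le 2
  have h2 := cosAngle_pos hx.1 2
  nlinarith

lemma herm_stdPolar_10 (x : ℝ × ℝ) : herm (stdPolar x 1) (stdPolar x 0) = cosAngle x.1 2 := by
  simp [herm, stdPolar]

lemma herm_stdPolar_02 (x : ℝ × ℝ) :
    herm (stdPolar x 0) (stdPolar x 2) = cosAngle x.1 1 * cis x.2 := by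
  simp [herm, stdPolar, conj_cis]

lemma herm_stdPolar_21 {x : ℝ × ℝ} (hx : x ∈ paramDomain) :
    herm (stdPolar x 2) (stdPolar x 1) = cosAngle x.1 0 := by
  have hs : (Real.sqrt (1 - cosAngle x.1 2 ^ 2) : ℂ) ≠ 0 := by
    exact_mod_cast (Real.sqrt_pos.mpr (one_sub_cosAngle_sq_pos hx)).ne'
  simp only [herm, stdPolar, Matrix.cons_val, Matrix.cons_val_zero, Matrix.cons_val_one,
    Complex.conj_ofReal, map_zero, mul_zero, sub_zero]
  rw [div_mul_cancel₀ _ hs]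
  ring

/-- The standard vectors come from triangular orthogonalization: their upper coordinates realize the
required products, and the last coordinate is the height that makes the third vector a unit vector.
-/
lemma herm_stdPolar_self {x : ℝ × ℝ} (hx : x ∈ paramDomain) (k : Fin 3) :
    herm (stdPolar x k) (stdPolar x k) = 1 := by
  have hpos := one_sub_cosAngle_sq_pos hx
  have hs : (Real.sqrt (1 - cosAngle x.1 2 ^ 2) : ℂ) ^ 2 = 1 - (cosAngle x.1 2 : ℂ) ^ 2 := by
    have := Real.sq_sqrt hpos.le
    exact_mod_cast this
  have hne : 1 - (cosAngle x.1 2 : ℂ) ^ 2 ≠ 0 := by exact_mod_cast hpos.ne'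
  have hsne : (Real.sqrt (1 - cosAngle x.1 2 ^ 2) : ℂ) ≠ 0 := by
    exact_mod_cast (Real.sqrt_pos.mpr hpos).ne'
  fin_cases k
  · simp [herm, stdPolar]
  · simp only [herm, stdPolar]
    simp
    linear_combination hs
  · have hy : (Real.sqrt (stdHeightNum x / (1 - cosAngle x.1 2 ^ 2)) : ℂ) ^ 2 =
        (stdHeightNum x : ℂ) / (1 - (cosAngle x.1 2 : ℂ) ^ 2) := by
      have := Real.sq_sqrt (div_pos (stdHeightNum_pos hx) hpos).le
      exact_mod_cast this
    have hc := mul_conj_of_norm_one (norm_cis (-x.2))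
    rw [conj_cis, neg_neg] at hc
    have hh : (stdHeightNum x : ℂ) = (cosAngle x.1 0 : ℂ) ^ 2 + (cosAngle x.1 1 : ℂ) ^ 2 +
        (cosAngle x.1 2 : ℂ) ^ 2 - 1 - (cosAngle x.1 0 * cosAngle x.1 1 * cosAngle x.1 2) *
          (cis x.2 + cis (-x.2)) := by
      rw [← two_cos, stdHeightNum]
      push_cast
      ring
    change cosAngle x.1 1 * cis (-x.2) * (starRingEnd ℂ) (cosAngle x.1 1 * cis (-x.2)) +
      (cosAngle x.1 0 - cosAngle x.1 1 * cosAngle x.1 2 * cis (-x.2)) /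
        (Real.sqrt (1 - cosAngle x.1 2 ^ 2) : ℂ) *
        (starRingEnd ℂ) ((cosAngle x.1 0 - cosAngle x.1 1 * cosAngle x.1 2 * cis (-x.2)) /
          (Real.sqrt (1 - cosAngle x.1 2 ^ 2) : ℂ)) -
      (Real.sqrt (stdHeightNum x / (1 - cosAngle x.1 2 ^ 2)) : ℂ) *
        (starRingEnd ℂ) (Real.sqrt (stdHeightNum x / (1 - cosAngle x.1 2 ^ 2)) : ℂ) = 1
    simp only [map_mul, map_div₀, map_sub, Complex.conj_ofReal, conj_cis, neg_neg]
    rw [div_mul_div_comm, ← pow_two, hs, ← pow_two (Real.sqrt (stdHeightNum x / _) : ℂ), hy, hh]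
    field_simp
    linear_combination ((cosAngle x.1 1 : ℂ) ^ 2) * hc

lemma prod_herm_stdPolar {x : ℝ × ℝ} (hx : x ∈ paramDomain) :
    herm (stdPolar x 2) (stdPolar x 1) * herm (stdPolar x 0) (stdPolar x 2) *
      herm (stdPolar x 1) (stdPolar x 0) =
    ((cosAngle x.1 0 * cosAngle x.1 1 * cosAngle x.1 2 : ℝ) : ℂ) * cis x.2 := by
  rw [herm_stdPolar_10 x, herm_stdPolar_02 x, herm_stdPolar_21 hx]
  push_cast
  ring

lemma norm_herm_stdPolar {x : ℝ × ℝ} (hx : x ∈ paramDomain) :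
    ‖herm (stdPolar x 2) (stdPolar x 1)‖ = cosAngle x.1 0 ∧
      ‖herm (stdPolar x 0) (stdPolar x 2)‖ = cosAngle x.1 1 ∧
      ‖herm (stdPolar x 1) (stdPolar x 0)‖ = cosAngle x.1 2 := by
  have hp := cosAngle_pos hx.1
  rw [herm_stdPolar_10 x, herm_stdPolar_02 x, herm_stdPolar_21 hx, norm_mul, norm_cis, mul_one]
  simp only [Complex.norm_real, Real.norm_eq_abs, abs_of_pos (hp _), and_self]

lemma det_stdPolar_ne_zero {x : ℝ × ℝ} (hx : x ∈ paramDomain) :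
    (colMatrix (stdPolar x 0) (stdPolar x 1) (stdPolar x 2)).det ≠ 0 := by
  intro h
  have hg := gram_det (stdPolar x) (herm_stdPolar_self hx)
  obtain ⟨e0, e1, e2⟩ := norm_herm_stdPolar hx
  rw [h, prod_herm_stdPolar hx, e0, e1, e2, Complex.re_ofReal_mul, cis_re] at hg
  have := stdHeightNum_pos hx
  unfold stdHeightNum at this
  simp at hg
  linarith

lemma hasParameters_stdPolar {x : ℝ × ℝ} (hx : x ∈ paramDomain) :
    HasParameters (stdPolar x) (fun k => cis (rotationAngle x.1 k)) x := by
  obtain ⟨e0, e1, e2⟩ := norm_herm_stdPolar hx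
  have hp := cosAngle_pos hx.1
  have hP : 0 < cosAngle x.1 0 * cosAngle x.1 1 * cosAngle x.1 2 :=
    mul_pos (mul_pos (hp 0) (hp 1)) (hp 2)
  have hprod : (∏ k : Fin 3, herm (stdPolar x (k - 1)) (stdPolar x (k + 1))) =
      ((cosAngle x.1 0 * cosAngle x.1 1 * cosAngle x.1 2 : ℝ) : ℂ) * cis x.2 := by
    rw [Fin.prod_univ_three, ← prod_herm_stdPolar hx]
    rfl
  refine ⟨fun k => rfl, ?_, ?_, ?_⟩
  · intro k
    fin_cases k
    · exact e0
    · exact e1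
    · exact e2
  · rw [hprod]
    exact mul_ne_zero (by exact_mod_cast hP.ne') (cis_ne_zero _)
  · rw [hprod, norm_mul, norm_cis, mul_one, Complex.norm_real, Real.norm_eq_abs, abs_of_pos hP]
    rfl

/-- The standard complex reflections for the parameters `x`. -/
def stdRefl (x : paramDomain) (k : Fin 3) : U21 :=
  refl (stdPolar x k) (cis (rotationAngle (x : ℝ × ℝ).1 k)) (herm_stdPolar_self x.2 k) (norm_cis _)

lemma mat_refl_mul_inv {c d : Fin 3 → ℂ} {η ζ : ℂ} (hc : herm c c = 1) (hη : ‖η‖ = 1)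
    (hd : herm d d = 1) (hζ : ‖ζ‖ = 1) :
    mat (refl c η hc hη * (refl d ζ hd hζ)⁻¹) =
      reflMatrix c η * reflMatrix d ((starRingEnd ℂ) ζ) := by
  rw [mat_mul, mat_inv, refl, refl, mat_ofIsometry, mat_ofIsometry, adj_reflMatrix hd hζ]

/-- The prescribed trace and determinant fix the characteristic polynomial, and `crossVec c d` is a
negative vector fixed by both reflections, so `exists_normalForm` applies. -/
lemma exists_normalForm_refl_mul {c d : Fin 3 → ℂ} {s t a b : ℝ} (hc : herm c c = 1)
    (hd : herm d d = 1) (hcd : ‖herm c d‖ < 1)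
    (hdet : cis s * cis (-t) = cis a * cis b)
    (htr : 1 + cis s + cis (-t) + (cis s - 1) * (cis (-t) - 1) * (‖herm c d‖ ^ 2 : ℝ) =
      1 + cis a + cis b) (hab : cis a ≠ cis b) (ha : cis a ≠ 1) (hb : cis b ≠ 1) :
    ∃ v w p, IsNormalForm (refl c (cis s) hc (norm_cis s) * (refl d (cis t) hd (norm_cis t))⁻¹)
      (cis a) (cis b) v w p ∧ herm p c = 0 ∧ herm p d = 0 := by
  have hneg := crossVec_isNegative hc hd hcd
  set g := refl c (cis s) hc (norm_cis s) * (refl d (cis t) hd (norm_cis t))⁻¹ with hg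
  have hm : mat g = reflMatrix c (cis s) * reflMatrix d (cis (-t)) := by
    rw [hg, mat_refl_mul_inv, conj_cis]
  have hfix : mat g *ᵥ crossVec c d = crossVec c d := by
    rw [hm, ← mulVec_mulVec, reflMatrix_mulVec_of_orthogonal (herm_crossVec_right c d),
      reflMatrix_mulVec_of_orthogonal (herm_crossVec_left c d)]
  obtain ⟨v, w, p, hN⟩ := exists_normalForm g (norm_cis a) (norm_cis b) hab ha hb
    (by rw [hm, trace_reflMatrix_mul hc hd, htr])
    (by rw [hm, det_mul, det_reflMatrix hc, det_reflMatrix hd, hdet]) hneg hfix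
  obtain ⟨-, hp⟩ := scalar_eq_one (one_smul ℂ (mat g)).symm hneg hfix
    (hN.eigenvector_type hab ha hb hneg.ne_zero)
  exact ⟨v, w, p, hN, hp _ (herm_crossVec_left c d), hp _ (herm_crossVec_right c d)⟩

lemma one_sub_mul_div {n d t : ℝ} (hd : d ≠ 0) (h : t = 1 - n / d) : (1 - t) * d = n := by
  rw [h, sub_sub_cancel, div_mul_cancel₀ _ hd]

/-- The values of cos φ_k are the solutions of the three trace equations, so the products of
standard reflections have the prescribed angle pairs. Their parameters are recovered from
`HasParameters.unique`. -/
theorem exists_stdTriple (x : paramDomain) :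
    ∃ T : Triple, T.A = stdRefl x 0 * (stdRefl x 1)⁻¹ ∧ T.B = stdRefl x 1 * (stdRefl x 2)⁻¹ ∧
      T.C = stdRefl x 2 * (stdRefl x 0)⁻¹ ∧ ¬ T.Degenerate ∧
      params (mat T.A) (mat T.B) = x := by
  have hx := x.2
  obtain ⟨e0, e1, e2⟩ := norm_herm_stdPolar hx
  have hu := herm_stdPolar_self hx
  have hlt := cosAngle_lt_one hx.1.1.le hx.1.2.le
  have hsq := cosAngle_sq hx.1.1.le hx.1.2.le
  obtain ⟨g0, g1, g2⟩ := (denomBounds hx.1.1.le hx.1.2.le).pos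
  obtain ⟨⟨m1, -⟩, n1, -⟩ := numerator_bounds
  set θ := (x : ℝ × ℝ).1 with hθ
  obtain ⟨a₁, a₂, p, hA, hp0, hp1⟩ := exists_normalForm_refl_mul (hu 0) (hu 1)
    (s := θ) (t := θ - Real.pi / 2) (a := 3 * Real.pi / 2) (b := Real.pi)
    (by rw [norm_herm_comm, e2]; exact hlt 2)
    (by rw [← cis_add, ← cis_add, cis_eq_iff]; refine ⟨-1, ?_⟩; push_cast; ring)
    (by
      rw [norm_herm_comm, e2, trace_iff_A]
      apply one_sub_mul_div
      · rw [(cos_sub_eqs θ).2.2] at g2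
        linarith
      · rw [hsq 2, sinSqAngle_two, (cos_sub_eqs θ).2.2, sub_neg_eq_add])
    (cis_ne_cis 10 (by push_cast; ring) (by norm_num))
    (cis_ne_one 30 (by push_cast; ring) (by norm_num))
    (cis_ne_one 20 (by push_cast; ring) (by norm_num))
  obtain ⟨b₁, b₂, q, hB, hq1, hq2⟩ := exists_normalForm_refl_mul (hu 1) (hu 2)
    (s := θ - Real.pi / 2) (t := θ - 21 * Real.pi / 10) (a := 6 * Real.pi / 5)
    (b := 2 * Real.pi / 5)
    (by rw [norm_herm_comm, e0]; exact hlt 0)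
    (by rw [← cis_add, ← cis_add]; congr 1; ring)
    (by
      rw [norm_herm_comm, e0, trace_iff_B]
      apply one_sub_mul_div (by linarith)
      rw [hsq 0, sinSqAngle_zero])
    (cis_ne_cis 16 (by push_cast; ring) (by norm_num))
    (cis_ne_one 24 (by push_cast; ring) (by norm_num))
    (cis_ne_one 8 (by push_cast; ring) (by norm_num))
  obtain ⟨c₁, c₂, r, hC, hr2, hr0⟩ := exists_normalForm_refl_mul (hu 2) (hu 0)
    (s := θ - 21 * Real.pi / 10) (t := θ) (a := 8 * Real.pi / 5)
    (b := 3 * Real.pi / 10)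
    (by rw [norm_herm_comm, e1]; exact hlt 1)
    (by rw [← cis_add, ← cis_add, cis_eq_iff]; refine ⟨-2, ?_⟩; push_cast; ring)
    (by
      rw [norm_herm_comm, e1, trace_iff_C]
      apply one_sub_mul_div (by linarith)
      rw [hsq 1, sinSqAngle_one])
    (cis_ne_cis 26 (by push_cast; ring) (by norm_num))
    (cis_ne_one 32 (by push_cast; ring) (by norm_num))
    (cis_ne_one 6 (by push_cast; ring) (by norm_num))
  set T : Triple := ⟨stdRefl x 0 * (stdRefl x 1)⁻¹, stdRefl x 1 * (stdRefl x 2)⁻¹,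
    stdRefl x 2 * (stdRefl x 0)⁻¹, a₁, a₂, p, b₁, b₂, q, c₁, c₂, r, hA, hB, hC, by group⟩ with hT
  have hpi := Real.pi_pos
  have hθ1 := hx.1.1
  have hθ2 := hx.1.2
  have hne : ∀ k, cis (rotationAngle θ k) ≠ 1 := by
    have small : ∀ (t : ℝ) (m : ℤ), m * (2 * Real.pi) < t → t < (m + 1) * (2 * Real.pi) →
        cis t ≠ 1 := by
      intro t m h1 h2 e
      obtain ⟨n, rfl⟩ := (cis_eq_one_iff t).mp e
      have k1 := lt_of_mul_lt_mul_right h1 (by positivity)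
      have k2 := lt_of_mul_lt_mul_right h2 (by positivity)
      have k1' : m < n := by exact_mod_cast k1
      have k2' : n < m + 1 := by exact_mod_cast k2
      omega
    intro k
    fin_cases k
    · exact small θ 0 (by push_cast; linarith) (by push_cast; linarith)
    · exact small (θ - Real.pi / 2) 0 (by push_cast; linarith) (by push_cast; linarith)
    -- This angle lies between -11π/10 and -3π/5, in the period ]-2π, 0[, whence the index -1.
    · exact small (θ - 21 * Real.pi / 10) (-1) (by push_cast; linarith) (by push_cast; linarith)
  have D : T.Dec (stdPolar x) (fun k => cis (rotationAngle θ k)) :=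
    ⟨hu, fun k => norm_cis _, hne, mat_refl_mul_inv _ _ _ _, mat_refl_mul_inv _ _ _ _,
      mat_refl_mul_inv _ _ _ _, hp0, hp1, hq1, hq2, hr2, hr0⟩
  have hnd : ¬ T.Degenerate := by
    -- Such a z is a multiple of both p and q, hence orthogonal to all three polar vectors, which
    -- span ℂ³.
    rintro ⟨z, hz, hzA, hzB, -⟩
    obtain ⟨-, -, eA⟩ := (T.eigA hz.ne_zero (l := 1) (by simpa using hzA)).resolve_left
      (fun h => by unfold IsNegative at hz; linarith [h.1])
    obtain ⟨-, -, eB⟩ := (T.eigB hz.ne_zero (l := 1) (by simpa using hzB)).resolve_left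
      (fun h => by unfold IsNegative at hz; linarith [h.1])
    have z0 : herm z (stdPolar x 0) = 0 := by rw [eA, herm_smul_left, D.p0, mul_zero]
    have z1 : herm z (stdPolar x 1) = 0 := by rw [eA, herm_smul_left, D.p1, mul_zero]
    have z2 : herm z (stdPolar x 2) = 0 := by rw [eB, herm_smul_left, D.q2, mul_zero]
    apply hz.ne_zero
    apply eq_zero_of_herm_left
    intro w
    have hw : w = colMatrix (stdPolar x 0) (stdPolar x 1) (stdPolar x 2) *ᵥ
        ((colMatrix (stdPolar x 0) (stdPolar x 1) (stdPolar x 2))⁻¹ *ᵥ w) := by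
      rw [mulVec_mulVec, mul_nonsing_inv _ (isUnit_iff_ne_zero.mpr (det_stdPolar_ne_zero hx)),
        one_mulVec]
    rw [hw, colMatrix_mulVec]
    simp only [herm_add_right, herm_smul_right, z0, z1, z2, mul_zero, add_zero]
  refine ⟨T, rfl, rfl, rfl, hnd, ?_⟩
  obtain ⟨hmem, hpar, -⟩ := D.hasParameters hnd
  exact HasParameters.unique hmem hx hpar (hasParameters_stdPolar hx)

/-! ### Degenerate triples -/

lemma exists_phase (z : ℂ) : ∃ u : ℂ, ‖u‖ = 1 ∧ (starRingEnd ℂ) u * z = ‖z‖ := by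
  refine ⟨cis z.arg, norm_cis _, ?_⟩
  have h1 := norm_mul_cis_arg z
  have h2 := mul_conj_of_norm_one (norm_cis z.arg)
  linear_combination (-(starRingEnd ℂ) (cis z.arg)) * h1 + (‖z‖ : ℂ) * h2

lemma rankOne_smul_of_norm_one {u : ℂ} (hu : ‖u‖ = 1) (v : Fin 3 → ℂ) :
    rankOne (u • v) = rankOne v := by
  rw [rankOne_smul, hu]
  simp

/-- The element with eigenvalues `κ` on `Xa + Yb`, `l` on its orthogonal complement in the span of
`a` and `b`, and `1` on `p`. -/
def rotatedMatrix (κ l : ℂ) (X Y : ℝ) (a b p : Fin 3 → ℂ) : Matrix (Fin 3) (Fin 3) ℂ :=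
  1 + (κ - 1) • rankOne ((X : ℂ) • a + (Y : ℂ) • b) +
    (l - 1) • (1 + rankOne p - rankOne ((X : ℂ) • a + (Y : ℂ) • b))

lemma conj_ellMatrix (g : U21) (μ ν : ℂ) (a b : Fin 3 → ℂ) :
    mat g * ellMatrix μ ν a b * mat g⁻¹ = ellMatrix μ ν (mat g *ᵥ a) (mat g *ᵥ b) := by
  simp only [ellMatrix, Matrix.mul_add, Matrix.add_mul, Matrix.mul_one, mat_mul_mat_inv,
    Matrix.mul_smul, Matrix.smul_mul, conj_rankOne]

lemma conj_rotatedMatrix (g : U21) (κ l : ℂ) (X Y : ℝ) (a b p : Fin 3 → ℂ) :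
    mat g * rotatedMatrix κ l X Y a b p * mat g⁻¹ =
      rotatedMatrix κ l X Y (mat g *ᵥ a) (mat g *ᵥ b) (mat g *ᵥ p) := by
  simp only [rotatedMatrix, Matrix.mul_add, Matrix.add_mul, Matrix.mul_sub, Matrix.sub_mul,
    Matrix.mul_one, mat_mul_mat_inv, Matrix.mul_smul, Matrix.smul_mul, conj_rankOne, mulVec_add,
    mulVec_smul]

lemma trace_ellMatrix_mul_rotatedMatrix {a b p : Fin 3 → ℂ} (h : IsFrame a b p) {X Y : ℝ}
    (hXY : X ^ 2 + Y ^ 2 = 1) (μ ν κ l : ℂ) :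
    (ellMatrix μ ν a b * rotatedMatrix κ l X Y a b p).trace =
      1 + μ * l + ν * κ + (X ^ 2 : ℝ) * ((μ - ν) * (κ - l)) := by
  have hY : ((Y ^ 2 : ℝ) : ℂ) = 1 - (X ^ 2 : ℝ) := by
    rw [show Y ^ 2 = 1 - X ^ 2 by linarith]
    push_cast
    ring
  have hav : ‖herm a ((X : ℂ) • a + (Y : ℂ) • b)‖ ^ 2 = X ^ 2 := by
    rw [herm_add_right, herm_smul_right, herm_smul_right, h.aa, h.ab]
    simp
  have hbv : ‖herm b ((X : ℂ) • a + (Y : ℂ) • b)‖ ^ 2 = Y ^ 2 := by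
    rw [herm_add_right, herm_smul_right, herm_smul_right, h.bb, h.ba]
    simp
  have hvv : herm ((X : ℂ) • a + (Y : ℂ) • b) ((X : ℂ) • a + (Y : ℂ) • b) = 1 := by
    simp only [herm_add_right, herm_add_left, herm_smul_right, herm_smul_left, h.bb, h.ba, h.aa,
      h.ab, Complex.conj_ofReal]
    push_cast at hY
    linear_combination hY
  simp only [ellMatrix, rotatedMatrix, Matrix.mul_add, Matrix.add_mul, Matrix.mul_sub,
    Matrix.mul_one, Matrix.one_mul, Matrix.mul_smul, Matrix.smul_mul, trace_add, trace_sub,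
    trace_smul, trace_rankOne_two, trace_rankOne, h.aa, h.bb, h.pp, h.ap, h.bp, hav, hbv, hvv, hY,
    smul_eq_mul, trace_one]
  simp
  ring

lemma Triple.trace_mul (T : Triple) : (mat T.A * mat T.B).trace =
    1 + cis (-(8 * Real.pi / 5)) + cis (-(3 * Real.pi / 10)) := by
  rw [← adj_adj (mat T.A * mat T.B), T.adj_mul_eq, trace_adj, T.hC.trace, map_add, map_add,
    map_one, conj_cis, conj_cis]

lemma IsNegative.resolve {z : Fin 3 → ℂ} (hz : IsNegative z) {P Q : Prop}
    (h : (0 < (herm z z).re ∧ P) ∨ Q) : Q :=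
  h.resolve_left fun h1 => by unfold IsNegative at hz; linarith [h1.1]

lemma Triple.Degenerate.exists_smul {T : Triple} (h : T.Degenerate) :
    ∃ s : ℂ, ‖s‖ = 1 ∧ T.q = s • T.p := by
  obtain ⟨z, hz, hA, hB, -⟩ := h
  obtain ⟨-, -, eA⟩ := hz.resolve (T.eigA hz.ne_zero (l := 1) (by simpa using hA))
  obtain ⟨-, -, eB⟩ := hz.resolve (T.eigB hz.ne_zero (l := 1) (by simpa using hB))
  have hs : -herm z T.q ≠ 0 := by
    intro e
    rw [e] at eB
    exact hz.ne_zero (by simpa using eB)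
  set w := -herm z T.q with hw
  have e : T.q = (w⁻¹ * -herm z T.p) • T.p := by
    rw [← smul_smul, ← eA, eB, smul_smul, inv_mul_cancel₀ hs, one_smul]
  refine ⟨_, ?_, e⟩
  have hq := T.hB.frame.pp
  rw [e, herm_smul_left, herm_smul_right, T.hA.frame.pp, ← mul_assoc, Complex.mul_conj,
    Complex.normSq_eq_norm_sq] at hq
  have h2 : ‖w⁻¹ * -herm z T.p‖ ^ 2 = 1 := by
    have : ((‖w⁻¹ * -herm z T.p‖ ^ 2 : ℝ) : ℂ) = 1 := by linear_combination -hq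
    exact_mod_cast this
  rw [← Real.sqrt_sq (norm_nonneg (w⁻¹ * -herm z T.p)), h2, Real.sqrt_one]

/-- Phases of the eigenvectors of A do not affect A; they are chosen so that the first eigenvector
of B has real nonnegative coordinates X, Y. The pair (A, B) then depends on a frame and on X only.
-/
lemma Triple.Degenerate.exists_frame {T : Triple} (h : T.Degenerate) :
    ∃ (a b p : Fin 3 → ℂ) (X Y : ℝ), IsFrame a b p ∧ 0 ≤ X ∧ 0 ≤ Y ∧ X ^ 2 + Y ^ 2 = 1 ∧
      mat T.A = ellMatrix (cis (3 * Real.pi / 2)) (cis Real.pi) a b ∧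
      mat T.B = rotatedMatrix (cis (6 * Real.pi / 5)) (cis (2 * Real.pi / 5)) X Y a b p := by
  obtain ⟨s, hs, hq⟩ := h.exists_smul
  have hA := T.hA.frame
  have hB := T.hB.frame
  have hbp : herm T.b₁ T.p = 0 := by
    have := hB.ap
    rw [hq, herm_smul_right] at this
    refine (mul_eq_zero.mp this).resolve_left ?_
    intro e0
    rw [map_eq_zero] at e0
    rw [e0, norm_zero] at hs
    exact zero_ne_one hs
  obtain ⟨u, hu, hu'⟩ := exists_phase (herm T.b₁ T.a₁)
  obtain ⟨v, hv, hv'⟩ := exists_phase (herm T.b₁ T.a₂)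
  have hF : IsFrame (u • T.a₁) (v • T.a₂) T.p := by
    refine ⟨?_, ?_, hA.pp, ?_, ?_, ?_⟩ <;> simp only [herm_smul_left, herm_smul_right, hA.aa,
      hA.bb, hA.ab, hA.ap, hA.bp, mul_zero, mul_one]
    · exact (mul_comm _ _).trans (mul_conj_of_norm_one hu)
    · exact (mul_comm _ _).trans (mul_conj_of_norm_one hv)
  refine ⟨u • T.a₁, v • T.a₂, T.p, ‖herm T.b₁ T.a₁‖, ‖herm T.b₁ T.a₂‖, hF, norm_nonneg _,
    norm_nonneg _, ?_, ?_, ?_⟩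
  · have := hA.parseval T.b₁
    rw [hbp, hB.aa] at this
    simpa using this
  · rw [T.hA.mat_eq, ellMatrix, ellMatrix, rankOne_smul_of_norm_one hu,
      rankOne_smul_of_norm_one hv]
  · have e1 : ((‖herm T.b₁ T.a₁‖ : ℝ) : ℂ) • (u • T.a₁) +
        ((‖herm T.b₁ T.a₂‖ : ℝ) : ℂ) • (v • T.a₂) = T.b₁ := by
      have := hF.expand T.b₁
      rw [hbp, herm_smul_right, herm_smul_right, hu', hv', zero_smul, sub_zero] at this
      exact this.symm
    have e2 : rankOne T.b₂ = 1 + rankOne T.p - rankOne T.b₁ := by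
      rw [← rankOne_smul_of_norm_one hs T.p, ← hq, ← hB.sum_rankOne]
      abel
    rw [rotatedMatrix, e1, ← e2, T.hB.mat_eq, ellMatrix]

/-- The trace of AB is prescribed by C and is affine in X² with nonzero slope, so it determines X
and Y. The frame is unique up to U(2,1). -/
theorem Triple.Degenerate.equiv {T T' : Triple} {ρ ρ' : Rep 4 5 20} (h : T.Degenerate)
    (h' : T'.Degenerate) (hρ : T.Lifts ρ) (hρ' : T'.Lifts ρ') :
    (⟦ρ⟧ : RepClasses 4 5 20) = ⟦ρ'⟧ := by
  obtain ⟨a, b, p, X, Y, hF, hX, hY, hXY, hA, hB⟩ := h.exists_frame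
  obtain ⟨a', b', p', X', Y', hF', hX', hY', hXY', hA', hB'⟩ := h'.exists_frame
  have t1 := T.trace_mul
  have t2 := T'.trace_mul
  rw [hA, hB, trace_ellMatrix_mul_rotatedMatrix hF hXY] at t1
  rw [hA', hB', trace_ellMatrix_mul_rotatedMatrix hF' hXY'] at t2
  have hne : (cis (3 * Real.pi / 2) - cis Real.pi) *
      (cis (6 * Real.pi / 5) - cis (2 * Real.pi / 5)) ≠ 0 :=
    mul_ne_zero (sub_ne_zero.mpr (cis_ne_cis 10 (by push_cast; ring) (by norm_num)))
      (sub_ne_zero.mpr (cis_ne_cis 16 (by push_cast; ring) (by norm_num)))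
  have hsq : X ^ 2 = X' ^ 2 := by
    have := mul_right_cancel₀ hne (add_left_cancel (t1.trans t2.symm))
    exact_mod_cast this
  have eX : X = X' := by
    rw [← Real.sqrt_sq hX, hsq, Real.sqrt_sq hX']
  have eY : Y = Y' := by
    rw [← Real.sqrt_sq hY, ← Real.sqrt_sq hY']
    congr 1
    linarith
  subst eX eY
  have hg : mat (hF'.toU * hF.toU⁻¹) *ᵥ a = a' ∧ mat (hF'.toU * hF.toU⁻¹) *ᵥ b = b' ∧
      mat (hF'.toU * hF.toU⁻¹) *ᵥ p = p' := by
    refine ⟨?_, ?_, ?_⟩ <;> rw [mat_mul, ← mulVec_mulVec]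
    · rw [mat_inv_mulVec_eq (z := ![1, 0, 0]) (by simp [hF.toU_mulVec])]
      simp [hF'.toU_mulVec]
    · rw [mat_inv_mulVec_eq (z := ![0, 1, 0]) (by simp [hF.toU_mulVec])]
      simp [hF'.toU_mulVec]
    · rw [mat_inv_mulVec_eq (z := ![0, 0, 1]) (by simp [hF.toU_mulVec])]
      simp [hF'.toU_mulVec]
  apply hρ.equiv_of_conj hρ' (g := hF'.toU * hF.toU⁻¹)
  · rw [hA, hA', conj_ellMatrix, hg.1, hg.2.1]
  · rw [hB, hB', conj_rotatedMatrix, hg.1, hg.2.1, hg.2.2]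

lemma IsFrame.exists_normalForm {a b p : Fin 3 → ℂ} (h : IsFrame a b p) (s t : ℝ) :
    ∃ g, IsNormalForm g (cis s) (cis t) a b p := by
  have := (isNormalForm_ellipticE (s, t)).conj h.toU
  simp only [h.toU_mulVec] at this
  simp at this
  exact ⟨_, this⟩

/-- Take A diagonal and rotate the positive eigenvectors of B by an angle with squared cosine S.
Choosing S so that tr(AB) has the required value puts (AB)⁻¹ in the class prescribed for C. -/
theorem exists_degenerate : ∃ T : Triple, T.Degenerate := by
  obtain ⟨c1, c2⟩ := cos_pi_div_twenty_bounds
  obtain ⟨d1, d2⟩ := sin_pi_div_twenty_bounds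
  obtain ⟨a1, a2⟩ := cos_pi_div_five_bounds
  obtain ⟨b1, b2⟩ := sin_pi_div_five_bounds
  obtain ⟨f1, f2⟩ := cos_thirteen_pi_div_twenty_bounds
  have hc3 : 0.8 < Real.cos (3 * Real.pi / 20) := by
    rw [show 3 * Real.pi / 20 = Real.pi / 5 - Real.pi / 20 by ring, Real.cos_sub]
    nlinarith
  set k := Real.cos (3 * Real.pi / 20)
  set m := Real.cos (13 * Real.pi / 20)
  -- All terms of the trace equation share the phase cis(41π/20), and what remains is 2k(1 - S) +
  -- 2mS = -2m. This S is its solution; it lies in [0, 1] because m < 0 < k + m.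
  set S := (k + m) / (k - m) with hS
  have hkm : 0 < k - m := by linarith
  have hS0 : 0 ≤ S := div_nonneg (by linarith) hkm.le
  have hS1 : S ≤ 1 := by
    rw [hS, div_le_one hkm]
    linarith
  have hSeq : 2 * k * (1 - S) + 2 * m * S = -(2 * m) := by
    rw [hS]
    field_simp
    ring
  set X := Real.sqrt S
  set Y := Real.sqrt (1 - S)
  have hX : X ^ 2 = S := Real.sq_sqrt hS0
  have hY : Y ^ 2 = 1 - S := Real.sq_sqrt (by linarith)
  have hXC : (X : ℂ) * X = S := by
    rw [← hX]; push_cast; ring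
  have hYC : (Y : ℂ) * Y = 1 - S := by
    rw [← Complex.ofReal_mul, ← pow_two, hY]; push_cast; ring
  have hF : IsFrame ![(X : ℂ), Y, 0] ![(-Y : ℂ), X, 0] ![0, 0, 1] := by
    constructor <;> simp [herm]
    · linear_combination hXC + hYC
    · linear_combination hXC + hYC
    · ring
  obtain ⟨A, hA⟩ := isFrame_std.exists_normalForm (3 * Real.pi / 2) Real.pi
  obtain ⟨B, hB⟩ := hF.exists_normalForm (6 * Real.pi / 5) (2 * Real.pi / 5)
  have n1 : ‖herm ![(1 : ℂ), 0, 0] ![(X : ℂ), Y, 0]‖ ^ 2 = S := by simp [herm, hX]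
  have n2 : ‖herm ![(1 : ℂ), 0, 0] ![(-Y : ℂ), X, 0]‖ ^ 2 = 1 - S := by simp [herm, hY]
  have n3 : ‖herm ![(0 : ℂ), 1, 0] ![(X : ℂ), Y, 0]‖ ^ 2 = 1 - S := by simp [herm, hY]
  have n4 : ‖herm ![(0 : ℂ), 1, 0] ![(-Y : ℂ), X, 0]‖ ^ 2 = S := by simp [herm, hX]
  have htr : (mat (A * B)).trace = 1 + cis (-(8 * Real.pi / 5)) + cis (-(3 * Real.pi / 10)) := by
    rw [trace_mul_normalForm hA hB, n1, n2, n3, n4]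
    have e1 : cis (3 * Real.pi / 2) * cis (2 * Real.pi / 5) + cis Real.pi * cis (6 * Real.pi / 5) =
        cis (41 * Real.pi / 20) * (2 * k : ℝ) := by
      rw [← cis_add, ← cis_add, cis_add_cis, ← Real.cos_neg]
      congr 2
      · ring
      · congr 3; ring
    have e2 : cis (3 * Real.pi / 2) * cis (6 * Real.pi / 5) + cis Real.pi * cis (2 * Real.pi / 5) =
        cis (41 * Real.pi / 20) * (2 * m : ℝ) := by
      rw [← cis_add, ← cis_add, cis_add_cis,
        show (3 * Real.pi / 2 + 6 * Real.pi / 5 + (Real.pi + 2 * Real.pi / 5)) / 2 =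
          41 * Real.pi / 20 by ring,
        show (3 * Real.pi / 2 + 6 * Real.pi / 5 - (Real.pi + 2 * Real.pi / 5)) / 2 =
          13 * Real.pi / 20 by ring]
    have e3 : cis (-(8 * Real.pi / 5)) + cis (-(3 * Real.pi / 10)) =
        cis (41 * Real.pi / 20) * (-(2 * m) : ℝ) := by
      have h1 : cis ((-(8 * Real.pi / 5) + -(3 * Real.pi / 10)) / 2) =
          -cis (41 * Real.pi / 20) := by
        have h2 : -cis (41 * Real.pi / 20) = cis (Real.pi + 41 * Real.pi / 20) := by
          rw [cis_add, cis_pi]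
          ring
        rw [h2, cis_eq_iff]
        refine ⟨-2, ?_⟩
        push_cast
        ring
      rw [cis_add_cis, h1, ← Real.cos_neg,
        show -((-(8 * Real.pi / 5) - -(3 * Real.pi / 10)) / 2) = 13 * Real.pi / 20 by ring]
      change _ * ((2 * m : ℝ) : ℂ) = _
      rw [Complex.ofReal_neg]
      ring
    have e4 : ((2 * k : ℝ) : ℂ) * (1 - S) + ((2 * m : ℝ) : ℂ) * S = (-(2 * m) : ℝ) := by
      rw [← hSeq]
      push_cast
      ring
    rw [add_assoc 1 (cis (-(8 * Real.pi / 5))), e3, ← e4]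
    rw [Complex.ofReal_sub, Complex.ofReal_one]
    linear_combination (1 - (S : ℂ)) * e1 + (S : ℂ) * e2
  have hfix : mat (A * B) *ᵥ ![0, 0, 1] = ![0, 0, 1] := by
    rw [mat_mul, ← mulVec_mulVec, hB.apply_p, hA.apply_p]
  have hneg : IsNegative ![0, 0, 1] := isFrame_std.isNegative
  have hfixC : mat (A * B)⁻¹ *ᵥ ![0, 0, 1] = ![0, 0, 1] := mat_inv_mulVec_eq hfix
  obtain ⟨c₁, c₂, r, hC⟩ := exists_normalForm (A * B)⁻¹ (norm_cis (8 * Real.pi / 5))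
    (norm_cis (3 * Real.pi / 10)) (cis_ne_cis 26 (by push_cast; ring) (by norm_num))
    (cis_ne_one 32 (by push_cast; ring) (by norm_num))
    (cis_ne_one 6 (by push_cast; ring) (by norm_num))
    (by rw [mat_inv, trace_adj, htr, map_add, map_add, map_one, conj_cis, conj_cis, neg_neg,
      neg_neg])
    (by
      have h1 : (mat (A * B)⁻¹).det * (mat (A * B)).det = 1 := by
        rw [← det_mul, mat_inv_mul_mat, det_one]
      have h2 : (mat (A * B)).det = cis (3 * Real.pi / 2) * cis Real.pi *
          (cis (6 * Real.pi / 5) * cis (2 * Real.pi / 5)) := by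
        rw [mat_mul, det_mul, hA.det, hB.det]
      have h3 : cis (8 * Real.pi / 5) * cis (3 * Real.pi / 10) * (mat (A * B)).det = 1 := by
        rw [h2, ← cis_add, ← cis_add, ← cis_add, ← cis_add, ← cis_add, ← cis_int_two_pi 3]
        congr 1
        push_cast
        ring
      exact mul_right_cancel₀ (det_mat_ne_zero (A * B)) (h1.trans h3.symm))
    hneg hfixC
  exact ⟨⟨A, B, (A * B)⁻¹, _, _, _, _, _, _, c₁, c₂, r, hA, hB, hC, mul_inv_cancel _⟩,
    ![0, 0, 1], hneg, hA.apply_p, hB.apply_p, hfixC⟩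

/-! ### The invariants as polynomials -/

section Polynomials

variable {R S : Type*} [Ring R] [Algebra ℂ R] [Ring S] [Algebra ℂ S]

/-- The polynomial that defines `specProj`, in an arbitrary algebra. -/
def specPoly (μ ν : ℂ) (x : R) : R := ((1 - μ) * (1 - ν))⁻¹ • ((x - μ • 1) * (x - ν • 1))

/-- The polynomial that defines `rotationElement`, in an arbitrary algebra. -/
def rotationPoly (x y : R) : R :=
  (x - 1) * specPoly (cis (6 * Real.pi / 5)) (cis (2 * Real.pi / 5)) y

/-- The polynomial that defines `angularElement`, in an arbitrary algebra; `x'` and `y'` stand for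
the adjoints of `x` and `y`. -/
def angularPoly (x y x' y' : R) : R :=
  ((x - 1) * specPoly (cis (6 * Real.pi / 5)) (cis (2 * Real.pi / 5)) y * (x' - 1)) *
    ((y - 1) * specPoly (cis (8 * Real.pi / 5)) (cis (3 * Real.pi / 10)) (y' * x') * (y' - 1)) *
    ((y' * x' - 1) * specPoly (cis (3 * Real.pi / 2)) (cis Real.pi) x * (x * y - 1))

/-- The polynomial that defines the product of the projections onto the negative fixed vectors. -/
def overlapPoly (x y : R) : R :=
  specPoly (cis (3 * Real.pi / 2)) (cis Real.pi) x *
    specPoly (cis (6 * Real.pi / 5)) (cis (2 * Real.pi / 5)) y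

lemma map_specPoly (f : R →ₐ[ℂ] S) (μ ν : ℂ) (x : R) :
    f (specPoly μ ν x) = specPoly μ ν (f x) := by
  simp [specPoly]

lemma map_rotationPoly (f : R →ₐ[ℂ] S) (x y : R) :
    f (rotationPoly x y) = rotationPoly (f x) (f y) := by
  simp [rotationPoly, map_specPoly]

lemma map_angularPoly (f : R →ₐ[ℂ] S) (x y x' y' : R) :
    f (angularPoly x y x' y') = angularPoly (f x) (f y) (f x') (f y') := by
  simp [angularPoly, map_specPoly]

lemma map_overlapPoly (f : R →ₐ[ℂ] S) (x y : R) :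
    f (overlapPoly x y) = overlapPoly (f x) (f y) := by
  simp [overlapPoly, map_specPoly]

end Polynomials

lemma angularElement_eq (M N : Matrix (Fin 3) (Fin 3) ℂ) :
    angularElement M N = angularPoly M N (adj M) (adj N) := by
  simp only [angularElement, adj_sub, adj_one, adj_adj, adj_mul]
  rfl

lemma Triple.trace_overlapPoly (T : Triple) :
    (overlapPoly (mat T.A) (mat T.B)).trace = ((‖herm T.p T.q‖ ^ 2 : ℝ) : ℂ) := by
  rw [← trace_rankOne_two, ← neg_mul_neg, ← T.projA_eq, ← T.projB_eq]
  rfl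

/-- Equality case of the reversed Cauchy–Schwarz inequality: the component of q orthogonal to p is
isotropic in a positive definite plane, so it vanishes. Thus degeneracy is visible in a trace. -/
lemma Triple.degenerate_iff (T : Triple) : T.Degenerate ↔ ‖herm T.p T.q‖ ^ 2 = 1 := by
  constructor
  · intro h
    obtain ⟨s, hs, e⟩ := h.exists_smul
    rw [e, herm_smul_right, T.hA.frame.pp, norm_mul, Complex.norm_conj, hs]
    simp
  · intro h
    have hp := T.hA.frame.pp
    have hq := T.hB.frame.pp
    have hpq := herm_mul_herm_swap T.q T.p
    rw [norm_herm_comm, h, Complex.ofReal_one] at hpq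
    have h1 : herm (T.q + herm T.q T.p • T.p) T.p = 0 := by
      rw [herm_add_left, herm_smul_left, hp]
      ring
    have h2 : herm (T.q + herm T.q T.p • T.p) (T.q + herm T.q T.p • T.p) = 0 := by
      rw [herm_add_right, herm_smul_right, h1, mul_zero, add_zero, herm_add_left, herm_smul_left,
        hq, hpq]
      ring
    have h3 : T.q + herm T.q T.p • T.p = 0 := by
      by_contra hne
      have := herm_self_pos_of_orthogonal T.hA.frame.isNegative h1 hne
      rw [h2] at this
      exact lt_irrefl _ this
    have hs : T.q = (-herm T.q T.p) • T.p := by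
      rw [neg_smul]
      exact eq_neg_of_add_eq_zero_left h3
    refine T.degenerate_of_AB T.hB.frame.ne_zero (k := 1) (l := 1) ?_
      (by simpa using T.hB.apply_p)
    rw [hs, mulVec_smul, T.hA.apply_p, one_smul]

/-- Two triples whose lifts are the images of the same elements under two homomorphisms with the
same trace function define conjugate representations. -/
theorem Triple.equiv_of_trace_eq {R : Type*} [Ring R] [Algebra ℂ R] {T T' : Triple}
    {ρ ρ' : Rep 4 5 20} (h : T.Lifts ρ) (h' : T'.Lifts ρ')
    (f f' : R →ₐ[ℂ] Matrix (Fin 3) (Fin 3) ℂ) (htr : ∀ r, (f r).trace = (f' r).trace)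
    {x y x' y' : R} (hx : f x = mat T.A) (hy : f y = mat T.B) (hx' : f x' = adj (mat T.A))
    (hy' : f y' = adj (mat T.B)) (kx : f' x = mat T'.A) (ky : f' y = mat T'.B)
    (kx' : f' x' = adj (mat T'.A)) (ky' : f' y' = adj (mat T'.B)) :
    (⟦ρ⟧ : RepClasses 4 5 20) = ⟦ρ'⟧ := by
  have e1 : (rotationElement (mat T.A) (mat T.B)).trace =
      (rotationElement (mat T'.A) (mat T'.B)).trace := by
    have := htr (rotationPoly x y)
    rw [map_rotationPoly, map_rotationPoly, hx, hy, kx, ky] at this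
    exact this
  have e2 : (angularElement (mat T.A) (mat T.B)).trace =
      (angularElement (mat T'.A) (mat T'.B)).trace := by
    have := htr (angularPoly x y x' y')
    rw [map_angularPoly, map_angularPoly, hx, hy, hx', hy', kx, ky, kx', ky'] at this
    rw [angularElement_eq, angularElement_eq, this]
  have e3 : ‖herm T.p T.q‖ ^ 2 = ‖herm T'.p T'.q‖ ^ 2 := by
    have := htr (overlapPoly x y)
    rw [map_overlapPoly, map_overlapPoly, hx, hy, kx, ky, T.trace_overlapPoly,
      T'.trace_overlapPoly] at this
    exact_mod_cast this
  by_cases hT : T.Degenerate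
  · exact hT.equiv (T'.degenerate_iff.mpr (e3 ▸ T.degenerate_iff.mp hT)) h h'
  · refine T.equiv_of_params h h' hT (fun hT' => hT ?_) ?_
    · exact T.degenerate_iff.mpr (e3.trans (T'.degenerate_iff.mp hT'))
    · rw [params, params, e1, e2]

/-! ### Invariance under conjugation -/

/-- Conjugation by an element of `U(2,1)` as an automorphism of the matrix algebra. -/
def conjHom (g : U21) : Matrix (Fin 3) (Fin 3) ℂ →ₐ[ℂ] Matrix (Fin 3) (Fin 3) ℂ where
  toFun M := mat g * M * mat g⁻¹
  map_one' := by rw [Matrix.mul_one, mat_mul_mat_inv]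
  map_mul' M N := conj_mul_mat g M N
  map_zero' := by simp
  map_add' M N := by simp [Matrix.mul_add, Matrix.add_mul]
  commutes' r := by
    rw [Algebra.algebraMap_eq_smul_one, Matrix.mul_smul, Matrix.smul_mul, Matrix.mul_one,
      mat_mul_mat_inv]

lemma conjHom_apply (g : U21) (M : Matrix (Fin 3) (Fin 3) ℂ) :
    conjHom g M = mat g * M * mat g⁻¹ := rfl

lemma trace_conjHom (g : U21) (M : Matrix (Fin 3) (Fin 3) ℂ) : (conjHom g M).trace = M.trace := by
  rw [conjHom_apply, trace_mul_comm, ← Matrix.mul_assoc, mat_inv_mul_mat, Matrix.one_mul]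

lemma adj_conjHom (g : U21) (M : Matrix (Fin 3) (Fin 3) ℂ) :
    adj (conjHom g M) = conjHom g (adj M) := by
  rw [conjHom_apply, conjHom_apply, adj_mul, adj_mul, mat_inv, adj_adj, Matrix.mul_assoc]

lemma params_conjHom (g : U21) (M N : Matrix (Fin 3) (Fin 3) ℂ) :
    params (conjHom g M) (conjHom g N) = params M N := by
  have e1 : rotationElement (conjHom g M) (conjHom g N) = conjHom g (rotationElement M N) :=
    (map_rotationPoly (conjHom g) M N).symm
  have e2 : angularElement (conjHom g M) (conjHom g N) = conjHom g (angularElement M N) := by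
    rw [angularElement_eq, angularElement_eq, map_angularPoly, adj_conjHom, adj_conjHom]
  rw [params, params, e1, e2, trace_conjHom, trace_conjHom]

/-- The lift with trace `t` of an element of `PU(2,1)` whose lifts have trace of modulus `‖t‖`. -/
def normLift (t : ℂ) (g : PU21) : Matrix (Fin 3) (Fin 3) ℂ :=
  (t / (mat g.out).trace) • mat g.out

/-- Dividing by the trace cancels the scalar ambiguity, so the chosen representative `g.out` does
not matter. This makes the normalized lift accessible to continuity arguments. -/
lemma normLift_toPU (t : ℂ) (g : U21) :
    normLift t (toPU g) = (t / (mat g).trace) • mat g := by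
  have e : toPU (toPU g).out = toPU g := Quotient.out_eq _
  obtain ⟨l, hl, h⟩ := (toPU_eq_iff _ _).mp e
  have hl0 : l ≠ 0 := by
    rintro rfl
    simp at hl
  rw [normLift, h, trace_smul, smul_smul, smul_eq_mul, mul_comm l, div_mul_eq_mul_div,
    mul_div_mul_right _ _ hl0]

lemma normLift_conj (t : ℂ) (g : U21) (A : PU21) :
    normLift t (toPU g * A * (toPU g)⁻¹) = conjHom g (normLift t A) := by
  obtain ⟨M, rfl⟩ := toPU_surjective A
  rw [← map_inv, ← map_mul, ← map_mul, normLift_toPU, normLift_toPU, map_smul, conjHom_apply,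
    mat_mul, mat_mul, ← conjHom_apply, trace_conjHom]

lemma normLift_of_trace {t : ℂ} {g : U21} (h : (mat g).trace = t) (ht : t ≠ 0) :
    normLift t (toPU g) = mat g := by
  rw [normLift_toPU, h, div_self ht, one_smul]

/-- The trace of the normalized lift of `ρ(a)`. -/
def traceA : ℂ := 1 + cis (3 * Real.pi / 2) + cis Real.pi

/-- The trace of the normalized lift of `ρ(b)`. -/
def traceB : ℂ := 1 + cis (6 * Real.pi / 5) + cis (2 * Real.pi / 5)

lemma traceA_ne_zero : traceA ≠ 0 := by
  rw [traceA, cis_pi, add_right_comm, add_neg_cancel, zero_add]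
  exact cis_ne_zero _

lemma traceB_ne_zero : traceB ≠ 0 := by
  intro h
  have h1 := congrArg Complex.re h
  rw [traceB, Complex.add_re, Complex.add_re, cis_re, cis_re, Complex.one_re, Complex.zero_re,
    show 6 * Real.pi / 5 = Real.pi / 5 + Real.pi by ring, Real.cos_add_pi] at h1
  have h2 := cos_pi_div_five_bounds.2
  have h3 : 0 < Real.cos (2 * Real.pi / 5) :=
    Real.cos_pos_of_mem_Ioo ⟨by linarith [Real.pi_pos], by linarith [Real.pi_pos]⟩
  linarith

lemma Triple.trace_A (T : Triple) : (mat T.A).trace = traceA := T.hA.trace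

lemma Triple.trace_B (T : Triple) : (mat T.B).trace = traceB := T.hB.trace

/-- The parameters of a representation. -/
def repParams (ρ : Rep 4 5 20) : ℝ × ℝ :=
  params (normLift traceA (ρ (gen 0))) (normLift traceB (ρ (gen 1)))

lemma Triple.Lifts.normLift_eq {T : Triple} {ρ : Rep 4 5 20} (h : T.Lifts ρ) :
    normLift traceA (ρ (gen 0)) = mat T.A ∧ normLift traceB (ρ (gen 1)) = mat T.B := by
  rw [← h.1, ← h.2.1]
  exact ⟨normLift_of_trace T.trace_A traceA_ne_zero, normLift_of_trace T.trace_B traceB_ne_zero⟩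

lemma Triple.Lifts.repParams_eq {T : Triple} {ρ : Rep 4 5 20} (h : T.Lifts ρ) :
    repParams ρ = params (mat T.A) (mat T.B) := by
  rw [repParams, h.normLift_eq.1, h.normLift_eq.2]

lemma repParams_congr {ρ ρ' : Rep 4 5 20} (h : ρ ≈ ρ') : repParams ρ = repParams ρ' := by
  obtain ⟨G, hG⟩ := h
  obtain ⟨g, rfl⟩ := toPU_surjective G
  rw [repParams, repParams, hG, hG, normLift_conj, normLift_conj, params_conjHom]

/-- The parameters of a class of representations. -/
def classParams (x : RepClasses 4 5 20) : ℝ × ℝ :=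
  Quotient.lift repParams (fun _ _ h => repParams_congr h) x

lemma classParams_mk (ρ : Rep 4 5 20) : classParams ⟦ρ⟧ = repParams ρ := rfl

/-! ### Conjugation invariance of the angle pairs and of irreducibility. -/

lemma HasAnglePair.conj {A : PU21} {α : ℝ × ℝ} (h : HasAnglePair A α) (g : PU21) :
    HasAnglePair (g * A * g⁻¹) α :=
  IsConj.trans h (isConj_iff.mpr ⟨g, rfl⟩)

lemma FixesLine.conj {A : PU21} {z : Fin 3 → ℂ} (h : FixesLine A z) (g : U21) :
    FixesLine (toPU g * A * (toPU g)⁻¹) (mat g *ᵥ z) := by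
  obtain ⟨hz, M, rfl, l, hl⟩ := h
  rw [← map_inv, ← map_mul, ← map_mul, fixesLine_toPU]
  refine ⟨fun e => hz (mat_mulVec_injective g (e.trans (mulVec_zero _).symm)), l, ?_⟩
  rw [mulVec_mulVec, mat_mul, mat_mul, Matrix.mul_assoc, Matrix.mul_assoc, mat_inv_mul_mat,
    Matrix.mul_one, ← mulVec_mulVec, hl, mulVec_smul]

lemma mem_reps4520_of_equiv {ρ ρ' : Rep 4 5 20} (h : ρ ≈ ρ') (hρ : ρ ∈ reps4520) :
    ρ' ∈ reps4520 := by
  obtain ⟨G, hG⟩ := h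
  refine ⟨?_, ?_, ?_⟩ <;> rw [hG]
  exacts [hρ.1.conj G, hρ.2.1.conj G, hρ.2.2.conj G]

lemma isIrreducibleRep_of_equiv {ρ ρ' : Rep 4 5 20} (h : ρ' ≈ ρ) (hρ : IsIrreducibleRep ρ) :
    IsIrreducibleRep ρ' := by
  obtain ⟨G, hG⟩ := h
  obtain ⟨g, rfl⟩ := toPU_surjective G
  unfold IsIrreducibleRep IsIrreducibleTriple at *
  simp only [hG] at hρ
  obtain ⟨h1, h2, h3⟩ := hρ
  exact ⟨fun ⟨z, k1, k2⟩ => h1 ⟨_, k1.conj g, k2.conj g⟩,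
    fun ⟨z, k1, k2⟩ => h2 ⟨_, k1.conj g, k2.conj g⟩,
    fun ⟨z, k1, k2⟩ => h3 ⟨_, k1.conj g, k2.conj g⟩⟩

/-! ### Characters -/

/-- The scalar relating a lift to the normalized one is read off from its trace, so two lifts with
equal characters are off by the same scalars. -/
lemma exists_scalar_of_lift {g h : U21} {t : ℂ} (e : toPU g = toPU h) (ht : (mat h).trace = t)
    (h0 : t ≠ 0) : ‖(mat g).trace / t‖ = 1 ∧ mat g = ((mat g).trace / t) • mat h := by
  obtain ⟨l, hl, hg⟩ := (toPU_eq_iff g h).mp e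
  have : (mat g).trace / t = l := by
    rw [hg, trace_smul, ht, smul_eq_mul, mul_div_assoc, div_self h0, mul_one]
  rw [this]
  exact ⟨hl, hg⟩

/-- The linear extension to the group algebra of a representation in `U(2,1)`. -/
def groupAlgHom (σ : FreeGroup (Fin 2) →* U21) :
    MonoidAlgebra ℂ (FreeGroup (Fin 2)) →ₐ[ℂ] Matrix (Fin 3) (Fin 3) ℂ :=
  MonoidAlgebra.lift ℂ (Matrix (Fin 3) (Fin 3) ℂ) (FreeGroup (Fin 2))
    ((Units.coeHom _).comp (U21.subtype.comp σ))

lemma groupAlgHom_single (σ : FreeGroup (Fin 2) →* U21) (w : FreeGroup (Fin 2)) (s : ℂ) :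
    groupAlgHom σ (MonoidAlgebra.single w s) = s • mat (σ w) := by
  rw [groupAlgHom, MonoidAlgebra.lift_single]
  rfl

lemma trace_groupAlgHom {σ σ' : FreeGroup (Fin 2) →* U21}
    (h : ∀ w, (mat (σ w)).trace = (mat (σ' w)).trace) (r : MonoidAlgebra ℂ (FreeGroup (Fin 2))) :
    (groupAlgHom σ r).trace = (groupAlgHom σ' r).trace := by
  have : (traceLinearMap (Fin 3) ℂ ℂ).comp (groupAlgHom σ).toLinearMap =
      (traceLinearMap (Fin 3) ℂ ℂ).comp (groupAlgHom σ').toLinearMap := by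
    apply MonoidAlgebra.lhom_ext'
    intro w
    apply LinearMap.ext
    intro s
    simp [groupAlgHom_single, h]
  exact LinearMap.congr_fun this r

/-- Inverses in the free group supply the adjoints, so polynomials in A, B and their adjoints are
images of elements of the group algebra. -/
lemma groupAlgHom_single_eq {σ : FreeGroup (Fin 2) →* U21} {w : FreeGroup (Fin 2)} {g : U21}
    {k : ℂ} (hk : ‖k‖ = 1) (h : mat (σ w) = k • mat g) :
    groupAlgHom σ (MonoidAlgebra.single w k⁻¹) = mat g ∧
      groupAlgHom σ (MonoidAlgebra.single w⁻¹ k) = adj (mat g) := by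
  have hk0 : k ≠ 0 := by
    rintro rfl
    simp at hk
  constructor
  · rw [groupAlgHom_single, h, smul_smul, inv_mul_cancel₀ hk0, one_smul]
  · rw [groupAlgHom_single, map_inv, mat_inv, h, adj, adj, conjTranspose_smul, Matrix.mul_smul,
      Matrix.smul_mul, smul_smul]
    change (k * (starRingEnd ℂ) k) • _ = _
    rw [mul_conj_of_norm_one hk, one_smul]

/-- The same four elements of the group algebra map to the normalized lifts and their adjoints under
both representations, because the scalars agree. Equality of characters extends linearly to every
trace invariant. -/
theorem equiv_of_characters {ρ ρ' : Rep 4 5 20} (hρ : ρ ∈ reps4520) (hρ' : ρ' ∈ reps4520)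
    {σ σ' : FreeGroup (Fin 2) →* U21} (hσ : IsSULift σ ρ) (hσ' : IsSULift σ' ρ')
    (h : ∀ w, (mat (σ w)).trace = (mat (σ' w)).trace) :
    (⟦ρ⟧ : RepClasses 4 5 20) = ⟦ρ'⟧ := by
  obtain ⟨T, hT⟩ := exists_triple hρ
  obtain ⟨T', hT'⟩ := exists_triple hρ'
  obtain ⟨nA, eA⟩ := exists_scalar_of_lift (hσ.2.1.trans hT.1.symm) T.trace_A traceA_ne_zero
  obtain ⟨nB, eB⟩ := exists_scalar_of_lift (hσ.2.2.trans hT.2.1.symm) T.trace_B traceB_ne_zero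
  obtain ⟨-, eA'⟩ := exists_scalar_of_lift (hσ'.2.1.trans hT'.1.symm) T'.trace_A traceA_ne_zero
  obtain ⟨-, eB'⟩ := exists_scalar_of_lift (hσ'.2.2.trans hT'.2.1.symm) T'.trace_B traceB_ne_zero
  rw [← h] at eA' eB'
  obtain ⟨x1, x2⟩ := groupAlgHom_single_eq nA eA
  obtain ⟨y1, y2⟩ := groupAlgHom_single_eq nB eB
  obtain ⟨x1', x2'⟩ := groupAlgHom_single_eq nA eA'
  obtain ⟨y1', y2'⟩ := groupAlgHom_single_eq nB eB'
  exact T.equiv_of_trace_eq hT hT' (groupAlgHom σ) (groupAlgHom σ') (trace_groupAlgHom h)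
    x1 y1 x2 y2 x1' y1' x2' y2'

/-! ### Continuity of the parameters -/

lemma continuous_mat : Continuous mat := Units.continuous_val.comp continuous_subtype_val

lemma continuous_adj : Continuous adj :=
  (continuous_const.matrix_mul continuous_id.matrix_conjTranspose).matrix_mul continuous_const

/-- The unit topology also asks for continuity of the inverse, which here is the adjoint. -/
lemma continuous_of_mat {X : Type*} [TopologicalSpace X] {f : X → U21}
    (h : Continuous fun x => mat (f x)) : Continuous f := by
  refine Continuous.subtype_mk (f := fun x => (f x : GL (Fin 3) ℂ)) ?_ fun x => (f x).2
  refine Units.continuous_iff.mpr ⟨h, ?_⟩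
  have : (fun x => mat (f x)⁻¹) = fun x => adj (mat (f x)) := funext fun x => mat_inv _
  exact this ▸ continuous_adj.comp h

lemma continuous_toPU : Continuous toPU := QuotientGroup.isOpenQuotientMap_mk.continuous

lemma continuousAt_normLift (t : ℂ) {g : U21} (h : (mat g).trace ≠ 0) :
    ContinuousAt (normLift t) (toPU g) := by
  apply (QuotientGroup.isOpenQuotientMap_mk (N := Subgroup.center U21)).continuousAt_comp_iff.mp
  change ContinuousAt (fun k => normLift t (toPU k)) g
  simp only [normLift_toPU]
  have h1 := continuous_mat.continuousAt (x := g)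
  exact (continuousAt_const.div (continuous_mat.matrix_trace).continuousAt h).smul h1

lemma continuous_specProj (μ ν : ℂ) : Continuous (specProj μ ν) := by
  unfold specProj
  fun_prop

lemma continuous_rotationElement : Continuous fun z : Matrix (Fin 3) (Fin 3) ℂ ×
    Matrix (Fin 3) (Fin 3) ℂ => rotationElement z.1 z.2 := by
  have h1 := continuous_specProj
  unfold rotationElement projB
  fun_prop

lemma continuous_angularElement : Continuous fun z : Matrix (Fin 3) (Fin 3) ℂ ×
    Matrix (Fin 3) (Fin 3) ℂ => angularElement z.1 z.2 := by
  have h1 := continuous_specProj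
  have h2 := continuous_adj
  unfold angularElement projA projB projC
  fun_prop

lemma continuousAt_params {M N : Matrix (Fin 3) (Fin 3) ℂ}
    (h1 : 0 < (rotationElement M N).trace.re)
    (h2 : (angularElement M N).trace ∈ Complex.slitPlane) :
    ContinuousAt (fun z : Matrix (Fin 3) (Fin 3) ℂ × Matrix (Fin 3) (Fin 3) ℂ =>
      params z.1 z.2) (M, N) := by
  have key : ∀ {f : Matrix (Fin 3) (Fin 3) ℂ × Matrix (Fin 3) (Fin 3) ℂ → ℂ}, Continuous f →
      f (M, N) ∈ Complex.slitPlane → ContinuousAt (fun z => (f z).arg) (M, N) := fun hf h =>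
    ContinuousAt.comp (Complex.continuousAt_arg h) hf.continuousAt
  have k1 := key continuous_rotationElement.matrix_trace (Or.inl h1)
  have k2 := key continuous_angularElement.matrix_trace h2
  exact ((continuousAt_const.mul k1).add continuousAt_const).prodMk (k2.add continuousAt_const)

lemma continuous_eval {p q r : ℕ} (γ : TriangleGroup p q r) :
    Continuous fun ρ : Rep p q r => ρ γ :=
  (continuous_apply γ).comp continuous_induced_dom

/-- Near a non-degenerate representation both traces stay in the slit plane, where the argument is
continuous. -/
lemma continuousAt_repParams {ρ : Rep 4 5 20} {T : Triple} (h : T.Lifts ρ)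
    (hT : ¬ T.Degenerate) : ContinuousAt repParams ρ := by
  obtain ⟨c, η, hd⟩ := T.exists_decomposition hT
  obtain ⟨-, -, h1, h2⟩ := (T.dec_of_decomposition hd).hasParameters hT
  have hA : ContinuousAt (fun ρ : Rep 4 5 20 => normLift traceA (ρ (gen 0))) ρ := by
    refine ContinuousAt.comp (g := normLift traceA) ?_ (continuous_eval (gen 0)).continuousAt
    rw [← h.1]
    exact continuousAt_normLift _ (by rw [T.trace_A]; exact traceA_ne_zero)
  have hB : ContinuousAt (fun ρ : Rep 4 5 20 => normLift traceB (ρ (gen 1))) ρ := by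
    refine ContinuousAt.comp (g := normLift traceB) ?_ (continuous_eval (gen 1)).continuousAt
    rw [← h.2.1]
    exact continuousAt_normLift _ (by rw [T.trace_B]; exact traceB_ne_zero)
  have hP := continuousAt_params h1 h2
  rw [← h.normLift_eq.1, ← h.normLift_eq.2] at hP
  have key : ∀ {F : Matrix (Fin 3) (Fin 3) ℂ × Matrix (Fin 3) (Fin 3) ℂ → ℝ × ℝ}
      {u v : Rep 4 5 20 → Matrix (Fin 3) (Fin 3) ℂ}, ContinuousAt F (u ρ, v ρ) →
      ContinuousAt u ρ → ContinuousAt v ρ → ContinuousAt (fun ρ => F (u ρ, v ρ)) ρ :=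
    fun hF hu hv => hF.comp₂ hu hv
  exact key hP hA hB

lemma continuous_conjRep {p q r : ℕ} (g : PU21) :
    Continuous fun ρ : Rep p q r => (MulAut.conj g).toMonoidHom.comp ρ := by
  refine continuous_induced_rng.mpr (continuous_pi fun γ => ?_)
  exact (continuous_const.mul (continuous_eval γ)).mul continuous_const

/-- The saturation of an open set is the union of its preimages under all conjugations. -/
lemma isOpenQuotientMap_mk (p q r : ℕ) :
    IsOpenQuotientMap (fun ρ : Rep p q r => (⟦ρ⟧ : RepClasses p q r)) := by
  refine ⟨Quotient.mk_surjective, continuous_quotient_mk', fun U hU => ?_⟩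
  apply isQuotientMap_quotient_mk'.isOpen_preimage.mp
  have : Quotient.mk (repSetoid p q r) ⁻¹' ((fun ρ => ⟦ρ⟧) '' U) =
      ⋃ g : PU21, (fun ρ : Rep p q r => (MulAut.conj g).toMonoidHom.comp ρ) ⁻¹' U := by
    ext ρ
    simp only [Set.mem_preimage, Set.mem_image, Set.mem_iUnion]
    constructor
    · rintro ⟨ρ', hρ', e⟩
      obtain ⟨g, hg⟩ := Quotient.exact e.symm
      refine ⟨g, ?_⟩
      have : (MulAut.conj g).toMonoidHom.comp ρ = ρ' :=
        MonoidHom.ext fun γ => (hg γ).symm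
      exact this ▸ hρ'
    · rintro ⟨g, hg⟩
      exact ⟨_, hg, Quotient.sound (Setoid.symm ⟨g, fun γ => rfl⟩)⟩
  change IsOpen (Quotient.mk (repSetoid p q r) ⁻¹' _)
  rw [this]
  exact isOpen_iUnion fun g => hU.preimage (continuous_conjRep g)

/-! ### Continuity of the standard representations -/

lemma continuous_rep {p q r : ℕ} {X : Type*} [TopologicalSpace X] {f : X → Rep p q r}
    (h : ∀ k, Continuous fun x => f x (gen k)) : Continuous f := by
  refine continuous_induced_rng.mpr (continuous_pi fun γ => ?_)
  change Continuous fun x => f x γ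
  induction γ using PresentedGroup.induction_on with
  | _ w =>
    induction w using FreeGroup.induction_on with
    | C1 =>
      simp only [map_one]
      exact continuous_const
    | of k => exact h k
    | inv_of k ih =>
      simp only [map_inv]
      exact ih.inv
    | mul v w hv hw =>
      simp only [map_mul]
      exact hv.mul hw

lemma continuous_cis : Continuous cis := by
  unfold cis
  fun_prop

lemma continuous_cosAngle (k : Fin 3) :
    Continuous fun x : paramDomain => cosAngle (x : ℝ × ℝ).1 k := by
  have hb := fun x : paramDomain => (denomBounds x.2.1.1.le x.2.1.2.le).pos
  unfold cosAngle
  refine Real.continuous_sqrt.comp (continuous_const.sub ?_)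
  fin_cases k
  · exact continuous_const.div (by fun_prop) fun x => by linarith [(hb x).1]
  · exact continuous_const.div (by fun_prop) fun x => by linarith [(hb x).2.1]
  · exact continuous_const.div (by fun_prop) fun x => by linarith [(hb x).2.2]

lemma continuous_stdHeightNum : Continuous fun x : paramDomain => stdHeightNum x := by
  have h := continuous_cosAngle
  unfold stdHeightNum
  fun_prop

lemma continuous_stdPolar (k : Fin 3) : Continuous fun x : paramDomain => stdPolar x k := by
  have h := continuous_cosAngle
  have hh := continuous_stdHeightNum
  have hc := continuous_cis
  have hpos := fun x : paramDomain => one_sub_cosAngle_sq_pos x.2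
  have hsq : ∀ x : paramDomain, (Real.sqrt (1 - cosAngle (x : ℝ × ℝ).1 2 ^ 2) : ℂ) ≠ 0 :=
    fun x => by exact_mod_cast (Real.sqrt_pos.mpr (hpos x)).ne'
  have hs : Continuous fun x : paramDomain =>
      (Real.sqrt (1 - cosAngle (x : ℝ × ℝ).1 2 ^ 2) : ℂ) := by fun_prop
  have hy : Continuous fun x : paramDomain =>
      (Real.sqrt (stdHeightNum x / (1 - cosAngle (x : ℝ × ℝ).1 2 ^ 2)) : ℂ) :=
    Complex.continuous_ofReal.comp (Real.continuous_sqrt.comp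
      (hh.div (by fun_prop) fun x => (hpos x).ne'))
  refine continuous_pi fun j => ?_
  fin_cases k
  · exact continuous_const
  · fin_cases j
    · exact Complex.continuous_ofReal.comp (h 2)
    · exact hs
    · exact continuous_const
  · fin_cases j
    · change Continuous fun x : paramDomain =>
        (cosAngle (x : ℝ × ℝ).1 1 : ℂ) * cis (-(x : ℝ × ℝ).2)
      fun_prop
    · change Continuous fun x : paramDomain => ((cosAngle (x : ℝ × ℝ).1 0 : ℂ) -
        cosAngle (x : ℝ × ℝ).1 1 * cosAngle (x : ℝ × ℝ).1 2 * cis (-(x : ℝ × ℝ).2)) /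
          (Real.sqrt (1 - cosAngle (x : ℝ × ℝ).1 2 ^ 2) : ℂ)
      exact Continuous.div (by fun_prop) hs hsq
    · exact hy

lemma continuous_rankOne : Continuous rankOne := by
  unfold rankOne
  fun_prop

lemma continuous_stdRefl (k : Fin 3) : Continuous fun x : paramDomain => stdRefl x k := by
  apply continuous_of_mat
  simp only [stdRefl, refl, mat_ofIsometry, reflMatrix]
  have h1 := continuous_rankOne
  have h2 := continuous_stdPolar k
  have h3 := continuous_cis
  have h4 : Continuous fun x : paramDomain => rotationAngle (x : ℝ × ℝ).1 k := by
    fin_cases k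
    · change Continuous fun x : paramDomain => (x : ℝ × ℝ).1
      fun_prop
    · change Continuous fun x : paramDomain => (x : ℝ × ℝ).1 - Real.pi / 2
      fun_prop
    · change Continuous fun x : paramDomain => (x : ℝ × ℝ).1 - 21 * Real.pi / 10
      fun_prop
  fun_prop

/-! ### The parametrization of the irreducible classes -/

/-- A triple with parameters `x`, made of the standard complex reflections. -/
def stdTriple (x : paramDomain) : Triple := (exists_stdTriple x).choose

lemma stdTriple_spec (x : paramDomain) :
    (stdTriple x).A = stdRefl x 0 * (stdRefl x 1)⁻¹ ∧
      (stdTriple x).B = stdRefl x 1 * (stdRefl x 2)⁻¹ ∧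
      (stdTriple x).C = stdRefl x 2 * (stdRefl x 0)⁻¹ ∧ ¬ (stdTriple x).Degenerate ∧
      params (mat (stdTriple x).A) (mat (stdTriple x).B) = x :=
  (exists_stdTriple x).choose_spec

lemma continuous_stdRep : Continuous fun x => (stdTriple x).toRep := by
  have key : ∀ i j, Continuous fun x => toPU (stdRefl x i * (stdRefl x j)⁻¹) := fun i j =>
    continuous_toPU.comp ((continuous_stdRefl i).mul (continuous_stdRefl j).inv)
  refine continuous_rep fun k => ?_
  fin_cases k
  · convert key 0 1 using 2 with x
    exact (stdTriple x).lifts_toRep.1.symm.trans (congrArg toPU (stdTriple_spec x).1)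
  · convert key 1 2 using 2 with x
    exact (stdTriple x).lifts_toRep.2.1.symm.trans (congrArg toPU (stdTriple_spec x).2.1)
  · convert key 2 0 using 2 with x
    exact (stdTriple x).lifts_toRep.2.2.symm.trans (congrArg toPU (stdTriple_spec x).2.2.1)

lemma exists_triple_of_class {x : RepClasses 4 5 20} (hx : x ∈ irreducibleClasses4520)
    {ρ : Rep 4 5 20} (h : ⟦ρ⟧ = x) : ∃ T : Triple, T.Lifts ρ ∧ ¬ T.Degenerate := by
  obtain ⟨ρ', hρ', hirr, rfl⟩ := hx
  have e := Quotient.exact h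
  obtain ⟨T, hT⟩ := exists_triple (mem_reps4520_of_equiv (Setoid.symm e) hρ')
  exact ⟨T, hT, hT.irreducible_iff.mp (isIrreducibleRep_of_equiv e hirr)⟩

lemma mk_mem_irreducibleClasses {T : Triple} {ρ : Rep 4 5 20} (h : T.Lifts ρ)
    (hT : ¬ T.Degenerate) : (⟦ρ⟧ : RepClasses 4 5 20) ∈ irreducibleClasses4520 :=
  ⟨ρ, h.mem, h.irreducible_iff.mpr hT, rfl⟩

lemma Triple.params_mem (T : Triple) (hT : ¬ T.Degenerate) :
    params (mat T.A) (mat T.B) ∈ paramDomain := by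
  obtain ⟨c, η, hd⟩ := T.exists_decomposition hT
  exact ((T.dec_of_decomposition hd).hasParameters hT).1

lemma classParams_mem {x : RepClasses 4 5 20} (hx : x ∈ irreducibleClasses4520) :
    classParams x ∈ paramDomain := by
  obtain ⟨ρ, rfl⟩ := Quotient.exists_rep x
  obtain ⟨T, hT, hdeg⟩ := exists_triple_of_class hx rfl
  rw [classParams_mk, hT.repParams_eq]
  exact T.params_mem hdeg

/-- The parametrization of the irreducible classes by rotation angle and angular invariant. -/
def paramHomeo : paramDomain ≃ₜ irreducibleClasses4520 where
  toFun x := ⟨⟦(stdTriple x).toRep⟧,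
    mk_mem_irreducibleClasses (stdTriple x).lifts_toRep (stdTriple_spec x).2.2.2.1⟩
  invFun y := ⟨classParams y, classParams_mem y.2⟩
  left_inv x := by
    apply Subtype.ext
    change classParams ⟦(stdTriple x).toRep⟧ = x
    rw [classParams_mk, (stdTriple x).lifts_toRep.repParams_eq, (stdTriple_spec x).2.2.2.2]
  right_inv y := by
    obtain ⟨y, hy⟩ := y
    apply Subtype.ext
    obtain ⟨ρ, rfl⟩ := Quotient.exists_rep y
    obtain ⟨T, hT, hdeg⟩ := exists_triple_of_class hy rfl
    refine Triple.equiv_of_params (Triple.lifts_toRep _) hT (stdTriple_spec _).2.2.2.1 hdeg ?_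
    -- The standard triple attached to the class of ρ has by construction the parameters of ρ, so
    -- the two are conjugate.
    rw [(stdTriple_spec _).2.2.2.2]
    exact hT.repParams_eq
  continuous_toFun := (continuous_quotient_mk'.comp continuous_stdRep).subtype_mk _
  continuous_invFun := by
    refine Continuous.subtype_mk (continuous_iff_continuousAt.mpr ?_) _
    rintro ⟨y, hy⟩
    obtain ⟨ρ, rfl⟩ := Quotient.exists_rep y
    obtain ⟨T, hT, hdeg⟩ := exists_triple_of_class hy rfl
    refine ContinuousAt.comp (g := classParams) ?_ continuous_subtype_val.continuousAt
    -- Openness of the projection allows continuity at a class to be tested at a representation.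
    exact (isOpenQuotientMap_mk 4 5 20).continuousAt_comp_iff.mp (continuousAt_repParams hT hdeg)

lemma paramHomeo_spec (x : paramDomain) {ρ : Rep 4 5 20}
    (h : (⟦ρ⟧ : RepClasses 4 5 20) = (paramHomeo x : RepClasses 4 5 20)) :
    ∃ T : Triple, T.Lifts ρ ∧ ¬ T.Degenerate ∧ params (mat T.A) (mat T.B) = x := by
  obtain ⟨T, hT, hdeg⟩ := exists_triple_of_class (paramHomeo x).2 h
  refine ⟨T, hT, hdeg, ?_⟩
  rw [← hT.repParams_eq, ← classParams_mk, h]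
  exact congrArg Subtype.val (paramHomeo.symm_apply_apply x)

end CHyp

theorem proposition6p8 :
    -- exactly one class of reducible representations, and it is spherical reducible
    (∃ ρ₀ ∈ CHyp.reps4520,
      CHyp.IsSphericalReduciblePair (ρ₀ (CHyp.gen 0)) (ρ₀ (CHyp.gen 1)) ∧
      ∀ ρ ∈ CHyp.reps4520, ¬ CHyp.IsIrreducibleRep ρ →
        (⟦ρ⟧ : CHyp.RepClasses 4 5 20) = ⟦ρ₀⟧) ∧
    -- all the other representations are spherical decomposable
    (∀ ρ ∈ CHyp.reps4520, CHyp.IsIrreducibleRep ρ →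
      CHyp.IsSphericalDecomposable (ρ (CHyp.gen 0)) (ρ (CHyp.gen 1)) (ρ (CHyp.gen 2))) ∧
    -- and their classes are parameterized by the pairs (θ, α)
    (∃ Φ : CHyp.paramDomain ≃ₜ CHyp.irreducibleClasses4520,
      ∀ (x : CHyp.paramDomain) (ρ : CHyp.Rep 4 5 20),
        (⟦ρ⟧ : CHyp.RepClasses 4 5 20) = (Φ x : CHyp.RepClasses 4 5 20) →
        (∃ c η, CHyp.IsSphericalDecomposition (ρ (CHyp.gen 0)) (ρ (CHyp.gen 1))
          (ρ (CHyp.gen 2)) c η ∧ CHyp.HasParameters c η (x : ℝ × ℝ)) ∧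
        (∀ c η, CHyp.IsSphericalDecomposition (ρ (CHyp.gen 0)) (ρ (CHyp.gen 1))
          (ρ (CHyp.gen 2)) c η → CHyp.HasParameters c η (x : ℝ × ℝ))) ∧
    CHyp.paramDomain.Nonempty ∧
    -- classes in the relative component are determined by their characters
    (∀ ρ ∈ CHyp.reps4520, ∀ ρ' ∈ CHyp.reps4520, ∀ σ σ' : FreeGroup (Fin 2) →* CHyp.U21,
      CHyp.IsSULift σ ρ → CHyp.IsSULift σ' ρ' →
      (∀ w, (CHyp.mat (σ w)).trace = (CHyp.mat (σ' w)).trace) →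
      (⟦ρ⟧ : CHyp.RepClasses 4 5 20) = ⟦ρ'⟧) := by
  refine ⟨?_, ?_, ⟨CHyp.paramHomeo, ?_⟩, CHyp.paramDomain_nonempty, ?_⟩
  · obtain ⟨T, hT⟩ := CHyp.exists_degenerate
    have hl := T.lifts_toRep
    refine ⟨T.toRep, hl.mem, ?_, fun ρ hρ hirr => ?_⟩
    · obtain ⟨z, hz, hA, hB, -⟩ := hT
      rw [← hl.1, ← hl.2.1]
      exact ⟨z, hz, CHyp.fixesLine_toPU.mpr ⟨hz.ne_zero, 1, by simpa using hA⟩,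
        CHyp.fixesLine_toPU.mpr ⟨hz.ne_zero, 1, by simpa using hB⟩⟩
    · obtain ⟨T', hT'⟩ := CHyp.exists_triple hρ
      rw [hT'.irreducible_iff, not_not] at hirr
      exact hirr.equiv hT hT' hl
  · intro ρ hρ hirr
    obtain ⟨T, hT⟩ := CHyp.exists_triple hρ
    rw [← hT.1, ← hT.2.1, ← hT.2.2]
    exact T.isSphericalDecomposable (hT.irreducible_iff.mp hirr)
  · intro x ρ h
    obtain ⟨T, hT, hdeg, hx⟩ := CHyp.paramHomeo_spec x h
    rw [← hT.1, ← hT.2.1, ← hT.2.2, ← hx]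
    have key : ∀ c η, CHyp.IsSphericalDecomposition (CHyp.toPU T.A) (CHyp.toPU T.B)
        (CHyp.toPU T.C) c η →
        CHyp.HasParameters c η (CHyp.params (CHyp.mat T.A) (CHyp.mat T.B)) := fun c η hd =>
      ((T.dec_of_decomposition hd).hasParameters hdeg).2.1
    obtain ⟨c, η, hd⟩ := T.exists_decomposition hdeg
    exact ⟨⟨c, η, hd, key c η hd⟩, key⟩
  · intro ρ hρ ρ' hρ' σ σ' hσ hσ' h
    exact CHyp.equiv_of_characters hρ hρ' hσ hσ' h

end
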